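/- **Setting.** All objects are indexed by a security parameter $s$ (suppressed below). Let $\mathbb F$ be a finite field and $\mathbb K$ a finite abelian group of keys, elements of both being represented by numbers below $|\mathbb F|$, $|\mathbb K|$; field addition and negation are computable in polynomial time, $1/|\mathbb F|$ is negligible in $s$ (for instance $|\mathbb F|\ge \max(m^2,n^2)\,2^{s}$), and $F:\mathbb K\times\mathbb F\to\mathbb F$ is a pseudorandom function family against nonuniform PPT distinguishers. The numbers $m,n,d,\delta$ and the bit lengths of $u,|\mathbb F|,|\mathbb K|$ are polynomially bounded in $s$; let $\mathbb U=\{0,\dots,u-1\}$ and $\mathrm{dist}_\infty(q,w)=\max_k|q_k-w_k|$ on $\mathbb U^d$. The sender $\mathcal S$ holds $Q=\{q_j\}_{j\in[m]}\subseteq\mathbb U^d$, the receiver $\mathcal R$ holds $W=\{w_i\}_{i\in[n]}\subseteq\mathbb U^d$, and both sets satisfy the $\delta$-disjoint projection assumption: every item has a coordinate $k$ in which its interval (centre its $k$-th coordinate, radius $\delta$) is disjoint from the intervals of all other items of the same set. The functionality $\mathcal F_{\mathsf{FPSI}}$ gives $Z=\{q_j:\exists i,\ \mathrm{dist}_\infty(q_j,w_i)\le\delta\}$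 to $\mathcal R$ and nothing to $\mathcal S$. **Ideal functionalities.** $\mathcal F_{\mathsf{so\text{-}OPPRF}}$: on programmed points $L$ from one party and queries $x_1,x_2,\dots$ from the other, sample a random $\mathbb F$-valued function $F'$ with $F'(y)=z$ for all $(y,z)\in L$, and output uniformly random additive shares of each $F'(x_i)$ to the two parties and oracle access to $F'$ to the first one. $\mathcal F_{\mathsf{si\text{-}OPRF}}$: from additive shares of a key $k$ and of inputs $x_i$, output $F_k(x_i)$ to the second party. $\mathcal F_{\mathsf{PEQT}}$: from lists $(a_j)$, $(b_j)$, output the bits $\mathbf 1\{a_j=b_j\}$ to $\mathcal R$. $\mathcal F_{\mathsf{OT}}$: from message pairs of $\mathcal S$ and choice bits of $\mathcal R$, output the chosen messages to $\mathcal R$. **$\mathsf{LocalMap}$** for items $x_1,\dots,x_a$: in each dimension $k$ process $j=1,\dots,a$; sample $r_{j,k}\leftarrow\mathbb F$, merge $[x_{j,k}-\delta,x_{j,k}+\delta]$ with all current intervals that it meets, and give the merged interval the value $r_{j,k}$. Then $\mathsf{pid}_{x_j}$ is the sum over $k$ of the final value of the interval containing $x_{j,k}$, and $\mathsf{List}$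 consists of all $(k\|y,r)$ with $y$ in an interval of dimension $k$ with value $r$, padded with random values at reserved dummy keys to size $ad(2\delta+1)$. **Protocol $\Pi_{\mathsf{FPSI}}^{L_\infty}$.** (0) $\mathcal S$ enumerates its set in uniformly random order $q_1,\dots,q_m$. (1) Fuzzy mapping: each party runs $\mathsf{LocalMap}$ on its set and samples a uniform key share $k^{\mathcal S}$, resp. $k^{\mathcal R}$. With $\mathcal F_{\mathsf{so\text{-}OPPRF}}$ on $\mathsf{List}^{\mathcal S}$ and the queries $k\|w_{i,k}$, and summation over $k$, the parties get shares $r_{w_i}^{\mathcal S},r_{w_i}^{\mathcal R}$; with $\mathcal F_{\mathsf{si\text{-}OPRF}}$ on $(k^{\mathcal S},r_{w_i}^{\mathcal S})$ and $(k^{\mathcal R},r_{w_i}^{\mathcal R}+\mathsf{pid}_{w_i})$, $\mathcal R$ gets identifiers $\mathsf{ID}_{w_i}$. Symmetrically, with the same key shares, $\mathcal S$ gets $\mathsf{ID}_{q_j}$. (2) $\mathcal F_{\mathsf{so\text{-}OPPRF}}$ on the points $(\mathsf{ID}_{w_i}\|k\|(w_{i,k}+t),0)$, $-\delta\le t\le\delta$,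 from $\mathcal R$ and the queries $\mathsf{ID}_{q_j}\|k\|q_{j,k}$ from $\mathcal S$ gives shares $r^{\mathcal S}_{j,k},r^{\mathcal R}_{j,k}$; put $r_j^{\mathcal S}=\sum_k r^{\mathcal S}_{j,k}$, $r_j^{\mathcal R}=\sum_k r^{\mathcal R}_{j,k}$. (3) $\mathcal F_{\mathsf{PEQT}}$ on $(r_j^{\mathcal S})_j$, $(-r_j^{\mathcal R})_j$ gives $\mathcal R$ the bits $b_j=\mathbf 1\{r_j^{\mathcal S}+r_j^{\mathcal R}=0\}$. (4) $\mathcal F_{\mathsf{OT}}$ on $(\bot,q_j)_j$ and $(b_j)_j$ gives $\mathcal R$ the items $z_j$; $\mathcal R$ outputs $Z'=\{z_j: b_j=1\}$. **Theorem.** In the $(\mathcal F_{\mathsf{so\text{-}OPPRF}},\mathcal F_{\mathsf{si\text{-}OPRF}},\mathcal F_{\mathsf{PEQT}},\mathcal F_{\mathsf{OT}})$-hybrid model, $\Pi_{\mathsf{FPSI}}^{L_\infty}$ realizes $\mathcal F_{\mathsf{FPSI}}$ for the $L_\infty$ distance against semi-honest adversaries: there are PPT simulators $\mathsf{Sim}_{\mathcal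 S}$, $\mathsf{Sim}_{\mathcal R}$ such that, for all inputs $Q,W$ as above, $$(\mathsf{view}_{\mathcal S}(Q,W),Z')\approx_c(\mathsf{Sim}_{\mathcal S}(Q),Z),\qquad(\mathsf{view}_{\mathcal R}(Q,W),Z')\approx_c(\mathsf{Sim}_{\mathcal R}(W,Z),Z),$$ where the views include the party's coins and oracle access to the programmed functions it received, the simulators answer the oracle queries of the simulated views, and $\approx_c$ is indistinguishability for nonuniform PPT distinguishers, with an advantage bounded by one negligible function for all inputs. Moreover, for all such $Q,W$: always $Z\subseteq Z'$; for every $s$, the probability that the identifiers $\mathsf{ID}_{w_1},\dots,\mathsf{ID}_{w_n}$ are pairwise distinct and $Z'\ne Z$ is at most $m/|\mathbb F|$; and the probability that they are not pairwise distinct is negligible. -/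

import Mathlib

open MeasureTheory Filter
open scoped ENNReal

namespace FuzzyPSI

/-! ### Probabilistic polynomial time -/

/-- The data that algorithms work on: trees whose leaves are natural numbers (in binary). -/
inductive Data : Type
  | num (n : ℕ)
  | pair (a b : Data)

namespace Data

/-- The bit size of a datum. -/
def size : Data → ℕ
  | num n => Nat.size n + 1
  | pair a b => a.size + b.size + 1

def fst : Data → Data
  | num _ => num 0
  | pair a _ => a

def snd : Data → Data
  | num _ => num 0
  | pair _ b => b

def toNat : Data → ℕ
  | num n => n
  | pair _ _ => 0

def ofProp (p : Prop) [Decidable p] : Data := num (if p then 1 else 0)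

/-- Lists are coded as right-nested pairs ending in `num 0`. -/
def ofList : List Data → Data
  | [] => num 0
  | a :: l => pair a (ofList l)

/-- A finite family `f 0, …, f (n-1)`, coded as a list. -/
def ofFamily {n : ℕ} {α : Type} (enc : α → Data) (f : Fin n → α) : Data :=
  ofList (List.ofFn fun i => enc (f i))

/-- A finite matrix, coded as the list of its rows. -/
def ofMatrix {n d : ℕ} {α : Type} (enc : α → Data) (f : Fin n → Fin d → α) : Data :=
  ofFamily (ofFamily enc) f

/-- The number `s` in unary. -/
def unary (s : ℕ) : Data := ofList (List.replicate s (num 0))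

end Data

/-- Elementary operations of the machine model. -/
inductive Prim : Type
  | id | fst | snd | isPair | eq | add | sub | mul | div | le

open scoped Classical in
/-- The effect of an elementary operation; the binary ones act on a pair, numbers are natural
numbers with truncated subtraction and integer division, and truth values are `0` and `1`. -/
noncomputable def Prim.apply : Prim → Data → Data
  | .id, x => x
  | .fst, x => x.fst
  | .snd, x => x.snd
  | .isPair, x => Data.ofProp (∃ a b, x = Data.pair a b)
  | .eq, x => Data.ofProp (x.fst = x.snd)
  | .add, x => Data.num (x.fst.toNat + x.snd.toNat)
  | .sub, x => Data.num (x.fst.toNat - x.snd.toNat)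
  | .mul, x => Data.num (x.fst.toNat * x.snd.toNat)
  | .div, x => Data.num (x.fst.toNat / x.snd.toNat)
  | .le, x => Data.ofProp (x.fst.toNat ≤ x.snd.toNat)

/-- Programs: while-programs over `Data` with oracle calls and random choices. -/
inductive Code : Type
  | const (v : Data)
  | prim (p : Prim)
  | rand
  | query
  | pair (f g : Code)
  | seq (f g : Code)
  | branch (c f g : Code)
  | loop (c f : Code)

/-- The random tape: for every `k` and every address one cell with a value in `{0, …, k}`.
A program that runs for `t` steps reads at most `t` cells, and distinct cells are independent and
uniform, so reading a new cell is the same as drawing a fresh uniform element of `{0, …, k}`. -/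
abbrev Tape : Type := (c : ℕ × Data) → Fin (c.1 + 1)

/-- The law of the random tape: all cells are independent and uniformly distributed. -/
noncomputable def tapeMeasure : Measure Tape :=
  Measure.infinitePi fun c : ℕ × Data => (PMF.uniformOfFintype (Fin (c.1 + 1))).toMeasure

/-- A collection of oracles, indexed by natural numbers. -/
abbrev Oracles : Type := ℕ → Data → Data

/-- No oracles: every query is answered by `0`. -/
def noOracles : Oracles := fun _ _ => Data.num 0

/-- `Runs O ω c x y t`: with oracles `O` and random tape `ω`, the program `c` started on `x`
halts with result `y` after `t` steps. An elementary step costs one plus the bit sizes of the data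
that it reads and writes (logarithmic cost). -/
inductive Runs (O : Oracles) (ω : Tape) : Code → Data → Data → ℕ → Prop
  | const (v x : Data) : Runs O ω (.const v) x v (1 + x.size + v.size)
  | prim (p : Prim) (x : Data) : Runs O ω (.prim p) x (p.apply x) (1 + x.size + (p.apply x).size)
  | rand (x : Data) : Runs O ω .rand x (.num (ω (x.fst.toNat, x.snd)))
      (1 + x.size + (Data.num (ω (x.fst.toNat, x.snd))).size)
  | query (x : Data) : Runs O ω .query x (O x.fst.toNat x.snd)
      (1 + x.size + (O x.fst.toNat x.snd).size)
  | pair {f g : Code} {x y z : Data} {t t' : ℕ} :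
      Runs O ω f x y t → Runs O ω g x z t' → Runs O ω (.pair f g) x (.pair y z) (t + t' + 1)
  | seq {f g : Code} {x y z : Data} {t t' : ℕ} :
      Runs O ω f x y t → Runs O ω g y z t' → Runs O ω (.seq f g) x z (t + t' + 1)
  | branch_true {c f g : Code} {x b y : Data} {t t' : ℕ} :
      Runs O ω c x b t → b ≠ .num 0 → Runs O ω f x y t' →
      Runs O ω (.branch c f g) x y (t + t' + 1)
  | branch_false {c f g : Code} {x y : Data} {t t' : ℕ} :
      Runs O ω c x (.num 0) t → Runs O ω g x y t' → Runs O ω (.branch c f g) x y (t + t' + 1)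
  | loop_done {c f : Code} {x : Data} {t : ℕ} :
      Runs O ω c x (.num 0) t → Runs O ω (.loop c f) x x (t + 1)
  | loop_step {c f : Code} {x b y z : Data} {t t₁ t₂ : ℕ} :
      Runs O ω c x b t → b ≠ .num 0 → Runs O ω f x y t₁ → Runs O ω (.loop c f) y z t₂ →
      Runs O ω (.loop c f) x z (t + t₁ + t₂ + 1)

/-- A (strictly) probabilistic polynomial-time oracle program: it halts, for all inputs, oracles
and coins, in time polynomial in the size of the input and of the longest oracle answer. -/
def PolyTime (c : Code) : Prop :=
  ∃ p : Polynomial ℕ, ∀ (b : ℕ) (O : Oracles), (∀ i q, (O i q).size ≤ b) →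
    ∀ (ω : Tape) (x : Data), ∃ (y : Data) (t : ℕ), Runs O ω c x y t ∧ t ≤ p.eval (x.size + b)

open scoped Classical in
/-- The result of a program (`0` if it does not halt). -/
noncomputable def result (O : Oracles) (ω : Tape) (c : Code) (x : Data) : Data :=
  if h : ∃ y, ∃ t, Runs O ω c x y t then h.choose else .num 0

/-- The probability, over its coins, that the program `D` outputs `1`. -/
noncomputable def acceptProb (O : Oracles) (D : Code) (x : Data) : ℝ≥0∞ :=
  tapeMeasure {ω | ∃ t, Runs O ω D x (.num 1) t}

/-- Negligible functions of the security parameter. -/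
def Negligible (ε : ℕ → ℝ) : Prop :=
  Asymptotics.SuperpolynomialDecay atTop (fun s : ℕ => (s : ℝ)) ε

/-! ### Computational indistinguishability and simulation -/

/-- What a distinguisher is given: a datum, and oracles that it may query. -/
structure Observation where
  data : Data
  oracles : Oracles

/-- Probability that the distinguisher `D` with advice `a` outputs `1` on a sample of `μ`. -/
noncomputable def distProb (s : ℕ) (D : Code) (a : Data) (μ : PMF Observation) : ℝ≥0∞ :=
  ∑' v : Observation, μ v * acceptProb v.oracles D (.pair (Data.unary s) (.pair a v.data))

/-- A simulator consists of two programs with a common random tape: `main` outputs the view, and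
`oracle` answers the oracle queries of the simulated view. -/
structure Simulator where
  main : Code
  oracle : Code

/-- A simulator is probabilistic polynomial time. -/
def Simulator.IsPPT (S : Simulator) : Prop := PolyTime S.main ∧ PolyTime S.oracle

/-- The simulated view for the simulator input `x` and coins `ω`, together with the output `z` of
the ideal functionality. -/
noncomputable def Simulator.observation (S : Simulator) (x z : Data) (ω : Tape) : Observation where
  data := .pair (result noOracles ω S.main x) z
  oracles := fun i q => result noOracles ω S.oracle (.pair x (.pair (.num i) q))

/-- Probability that `D` with advice `a` outputs `1` on the simulated view and ideal output. -/
noncomputable def simProb (s : ℕ) (D : Code) (a : Data) (S : Simulator) (x z : Data) : ℝ≥0∞ :=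
  ∫⁻ ω, acceptProb (S.observation x z ω).oracles D
    (.pair (Data.unary s) (.pair a (S.observation x z ω).data)) ∂tapeMeasure

/-- The ensemble `real` (a party's view and the protocol output, indexed by the security parameter
`s` and the parties' inputs `i : ι s`) is computationally indistinguishable from the output of the
simulator `S` on `simInput` together with the ideal output, for nonuniform probabilistic
polynomial-time distinguishers and uniformly in the inputs. -/
def Simulates (S : Simulator) (ι : ℕ → Type) (real : (s : ℕ) → ι s → PMF Observation)
    (simInput idealOutput : (s : ℕ) → ι s → Data) : Prop :=
  ∀ D : Code, PolyTime D → ∀ p : Polynomial ℕ, ∃ ε : ℕ → ℝ, Negligible ε ∧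
    ∀ (s : ℕ) (i : ι s) (a : Data), a.size ≤ p.eval s →
      |(distProb s D a (real s i)).toReal
        - (simProb s D a S (simInput s i) (idealOutput s i)).toReal| ≤ ε s

/-! ### Field encodings and pseudorandom functions -/

/-- An element of a finite type with a fixed numbering, as a datum. -/
def encodeBy {α : Type} {N : ℕ} (e : α ≃ Fin N) (a : α) : Data := .num (e a)

open scoped Classical in
/-- The oracle of a function `f` for given encodings of arguments and values; queries that do not
encode an argument are answered by `0`. -/
noncomputable def oracleOf {X Y : Type} (encX : X → Data) (encY : Y → Data) (f : X → Y) :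
    Data → Data :=
  fun q => if h : ∃ x, encX x = q then encY (f h.choose) else .num 0

/-- A single oracle, with index `0`. -/
def oneOracle (f : Data → Data) : Oracles := fun i => if i = 0 then f else fun _ => .num 0

/-- Two oracles, with indices `0` and `1`. -/
def twoOracles (f g : Data → Data) : Oracles :=
  fun i => if i = 0 then f else if i = 1 then g else fun _ => .num 0

/-- The uniform distribution on a finite non-empty type. -/
noncomputable abbrev unif (α : Type) [Fintype α] [Nonempty α] : PMF α := PMF.uniformOfFintype α

section Family

variable (𝔽 : ℕ → Type) [∀ s, Field (𝔽 s)] [∀ s, Fintype (𝔽 s)]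
  (eF : ∀ s, 𝔽 s ≃ Fin (Fintype.card (𝔽 s)))

/-- Addition and negation of the fields `𝔽 s` are computable in polynomial time, for the
representation of field elements by the numberings `eF`. -/
def EfficientField : Prop :=
  (∃ c : Code, PolyTime c ∧ ∀ (s : ℕ) (a b : 𝔽 s) (ω : Tape), ∃ t, Runs noOracles ω c
    (.pair (Data.unary s) (.pair (.num (Fintype.card (𝔽 s)))
      (.pair (encodeBy (eF s) a) (encodeBy (eF s) b)))) (encodeBy (eF s) (a + b)) t) ∧
  (∃ c : Code, PolyTime c ∧ ∀ (s : ℕ) (a : 𝔽 s) (ω : Tape), ∃ t, Runs noOracles ω c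
    (.pair (Data.unary s) (.pair (.num (Fintype.card (𝔽 s))) (encodeBy (eF s) a)))
    (encodeBy (eF s) (-a)) t)

open scoped Classical in
/-- `F` is a pseudorandom function family: oracle access to `F_k` for a uniform key `k` is
indistinguishable from oracle access to a uniformly random function, for nonuniform probabilistic
polynomial-time programs. -/
def IsPRF (K : ℕ → Type) [∀ s, AddCommGroup (K s)] [∀ s, Fintype (K s)]
    (F : (s : ℕ) → K s → 𝔽 s → 𝔽 s) : Prop :=
  ∀ B : Code, PolyTime B → ∀ p : Polynomial ℕ, ∃ ε : ℕ → ℝ, Negligible ε ∧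
    ∀ (s : ℕ) (a : Data), a.size ≤ p.eval s →
      |(distProb s B a ((unif (K s)).map fun k =>
          ⟨.num 0, oneOracle (oracleOf (encodeBy (eF s)) (encodeBy (eF s)) (F s k))⟩)).toReal
        - (distProb s B a ((unif (𝔽 s → 𝔽 s)).map fun f =>
          ⟨.num 0, oneOracle (oracleOf (encodeBy (eF s)) (encodeBy (eF s)) f)⟩)).toReal| ≤ ε s

end Family

/-! ### Fuzzy private set intersection for the `L_∞` distance -/

/-- Public parameters: the set sizes `m` (sender) and `n` (receiver), the dimension `d`, the
threshold `δ`, and the size `u` of the coordinate universe `{0, …, u - 1}`. -/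
structure Params where
  m : ℕ
  n : ℕ
  d : ℕ
  δ : ℕ
  u : ℕ

/-- Points of the `d`-dimensional space over the universe `{0, …, u - 1}`. -/
abbrev Point (P : Params) : Type := Fin P.d → Fin P.u

/-- The integers `x + t` with `x` in the universe and `-δ ≤ t ≤ δ`. -/
abbrev Coord (P : Params) : Type := ↥(Finset.Ico (-(P.δ : ℤ)) (P.u + P.δ))

/-- An element of the universe as a coordinate. -/
def toCoord (P : Params) (x : Fin P.u) : Coord P :=
  ⟨(x : ℤ), by have := x.2; simp only [Finset.mem_Ico]; omega⟩

/-- The `L_∞` distance of two points. -/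
def distInf {P : Params} (q w : Point P) : ℕ :=
  Finset.univ.sup fun k => ((q k : ℤ) - (w k : ℤ)).natAbs

/-- The `δ`-disjoint projection assumption: every item has a dimension in which its
radius-`δ` interval is disjoint from those of all other items. -/
def DisjointProjection {P : Params} {a : ℕ} (x : Fin a → Point P) : Prop :=
  ∀ i, ∃ k, ∀ j, j ≠ i →
    Disjoint (Set.Icc ((x i k : ℤ) - P.δ) ((x i k : ℤ) + P.δ))
      (Set.Icc ((x j k : ℤ) - P.δ) ((x j k : ℤ) + P.δ))

section Protocol

open scoped Classical

/-- The fuzzy PSI functionality: the set of all sender items that are within distance `δ` of some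
receiver item (the output of the receiver; the sender has no output). -/
noncomputable def idealFPSI {P : Params} (Q : Fin P.m → Point P) (W : Fin P.n → Point P) :
    Finset (Point P) :=
  (Finset.univ.image Q).filter fun q => ∃ i, distInf q (W i) ≤ P.δ

variable {𝔽 K : Type} [Field 𝔽] [Fintype 𝔽] [AddCommGroup K] [Fintype K]

/-- The function that takes the values prescribed by the list `L`, and those of `ρ` elsewhere. -/
noncomputable def program {X : Type} (L : List (X × 𝔽)) (ρ : X → 𝔽) (x : X) : 𝔽 :=
  ((L.find? fun e => decide (e.1 = x)).map Prod.snd).getD (ρ x)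

/-- Output of the shared-output OPPRF functionality: the sender's shares and the programmed random
function (oracle access to which goes to the sender), and the receiver's shares. -/
structure SoOut (X ι 𝔽 : Type) where
  sender : ι → 𝔽
  fn : X → 𝔽
  receiver : ι → 𝔽

/-- Oblivious programmable PRF with secret-shared outputs: the sender inputs the list `L` of
programmed points, the receiver inputs the queries `x i`; the functionality samples a random
function `F'` subject to `F' q = z` for `(q, z) ∈ L` and a random additive sharing of each
`F' (x i)`. -/
noncomputable def soOPPRF {X ι : Type} [Fintype X] [Fintype ι] (L : List (X × 𝔽)) (x : ι → X) :
    PMF (SoOut X ι 𝔽) := do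
  let ρ ← unif (X → 𝔽)
  let y ← unif (ι → 𝔽)
  return { sender := y, fn := program L ρ, receiver := fun i => program L ρ (x i) - y i }

/-- OPRF with secret-shared inputs and key; the output goes to the receiver. -/
def siOPRF {ι : Type} (F : K → 𝔽 → 𝔽) (kS kR : K) (xS xR : ι → 𝔽) : ι → 𝔽 :=
  fun i => F (kS + kR) (xS i + xR i)

/-- Private equality test; the output goes to the receiver. -/
noncomputable def peqt {ι : Type} (x y : ι → 𝔽) : ι → Bool := fun i => decide (x i = y i)

/-- Oblivious transfer: the sender inputs pairs of messages and the receiver, who inputs the choice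
bits, gets the chosen messages. -/
def ot {ι M : Type} (msg : ι → M × M) (b : ι → Bool) : ι → M :=
  fun i => if b i then (msg i).2 else (msg i).1

/-! #### Local mapping -/

/-- The interval `[x - δ, x + δ]`. -/
noncomputable def interval (P : Params) (x : Fin P.u) : Finset (Coord P) :=
  Finset.univ.filter fun y => |(y : ℤ) - (x : ℤ)| ≤ P.δ

/-- Insert the interval `U` with value `r` into a list of disjoint intervals: all intervals that
meet `U` are removed and merged with `U`, and the merged interval gets the new value `r`. -/
noncomputable def insertInterval {P : Params} (U : Finset (Coord P)) (r : 𝔽)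
    (L : List (Finset (Coord P) × 𝔽)) : List (Finset (Coord P) × 𝔽) :=
  ((L.filter fun e => decide (¬ Disjoint U e.1)).foldl (fun V e => V ∪ e.1) U, r) ::
    L.filter fun e => decide (Disjoint U e.1)

/-- The list of disjoint intervals with values in one dimension, where `x j` are the coordinates of
the items in that dimension and `r j` the sampled values. -/
noncomputable def intervals {P : Params} {a : ℕ} (x : Fin a → Fin P.u) (r : Fin a → 𝔽) :
    List (Finset (Coord P) × 𝔽) :=
  (List.finRange a).foldl (fun L j => insertInterval (interval P (x j)) (r j) L) []

/-- The size to which the list of a party with `a` items is padded. -/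
abbrev listSize (P : Params) (a : ℕ) : ℕ := a * P.d * (2 * P.δ + 1)

/-- Keys of the programmed function: `k ‖ x` with a dimension `k` and a coordinate `x`, or one of
the reserved dummy keys. -/
abbrev MapKey (P : Params) (a : ℕ) : Type := (Fin P.d × Coord P) ⊕ Fin (listSize P a)

/-- The local identifiers `pid_j`, the sum over all dimensions of the value of the interval that
contains the coordinate of item `j`. -/
noncomputable def localPid {P : Params} {a : ℕ} (x : Fin a → Point P) (r : Fin a → Fin P.d → 𝔽)
    (j : Fin a) : 𝔽 :=
  ∑ k, (((intervals (fun i => x i k) (fun i => r i k)).find?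
    fun e => decide (toCoord P (x j k) ∈ e.1)).map Prod.snd).getD 0

/-- The key-value pairs `(k ‖ x, r)` for all `x` in an interval of dimension `k` with value `r`. -/
noncomputable def localEntries {P : Params} {a : ℕ} (x : Fin a → Point P)
    (r : Fin a → Fin P.d → 𝔽) : List (MapKey P a × 𝔽) :=
  (List.finRange P.d).flatMap fun k =>
    (intervals (fun i => x i k) (fun i => r i k)).flatMap fun e =>
      e.1.toList.map fun y => (Sum.inl (k, y), e.2)

/-- The list of the party, padded with dummy items up to the size `a d (2 δ + 1)`. -/
noncomputable def localList {P : Params} {a : ℕ} (x : Fin a → Point P)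
    (r : Fin a → Fin P.d → 𝔽) (dummy : Fin (listSize P a) → 𝔽) : List (MapKey P a × 𝔽) :=
  localEntries x r ++
    ((List.finRange (listSize P a)).filter
      fun i : Fin (listSize P a) => decide ((localEntries x r).length ≤ i.val)).map fun i => (Sum.inr i, dummy i)

/-! #### Fuzzy mapping -/

/-- View of a party with `a` items in the fuzzy mapping protocol, whose partner has `b` items: its
random values (`r` and `dummy` of the local mapping, and its share of the PRF key), the shares and
the function from the shared-output OPPRF in which it is the sender, its shares from the one in
which it is the receiver, and the identifiers of its items. -/
structure FMapView (P : Params) (a b : ℕ) (𝔽 K : Type) where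
  r : Fin a → Fin P.d → 𝔽
  dummy : Fin (listSize P a) → 𝔽
  key : K
  partnerShare : Fin b → Fin P.d → 𝔽
  fn : MapKey P a → 𝔽
  ownShare : Fin a → Fin P.d → 𝔽
  ident : Fin a → 𝔽

/-- The fuzzy mapping protocol; the first component is the sender's view, the second one is
the receiver's. -/
noncomputable def fuzzyMapping (P : Params) (F : K → 𝔽 → 𝔽)
    (q : Fin P.m → Point P) (w : Fin P.n → Point P) :
    PMF (FMapView P P.m P.n 𝔽 K × FMapView P P.n P.m 𝔽 K) := do
  let rS ← unif (Fin P.m → Fin P.d → 𝔽)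
  let dummyS ← unif (Fin (listSize P P.m) → 𝔽)
  let rR ← unif (Fin P.n → Fin P.d → 𝔽)
  let dummyR ← unif (Fin (listSize P P.n) → 𝔽)
  let kS ← unif K
  let kR ← unif K
  let oW ← soOPPRF (localList q rS dummyS)
    (fun e : Fin P.n × Fin P.d => Sum.inl (e.2, toCoord P (w e.1 e.2)))
  let idW := siOPRF F kS kR (fun i => ∑ k, oW.sender (i, k))
    (fun i => (∑ k, oW.receiver (i, k)) + localPid w rR i)
  let oQ ← soOPPRF (localList w rR dummyR)
    (fun e : Fin P.m × Fin P.d => Sum.inl (e.2, toCoord P (q e.1 e.2)))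
  let idQ := siOPRF F kR kS (fun j => ∑ k, oQ.sender (j, k))
    (fun j => (∑ k, oQ.receiver (j, k)) + localPid q rS j)
  return ({ r := rS, dummy := dummyS, key := kS,
            partnerShare := fun i k => oW.sender (i, k), fn := oW.fn,
            ownShare := fun j k => oQ.receiver (j, k), ident := idQ },
          { r := rR, dummy := dummyR, key := kR,
            partnerShare := fun j k => oQ.sender (j, k), fn := oQ.fn,
            ownShare := fun i k => oW.receiver (i, k), ident := idW })

/-! #### The fuzzy PSI protocol -/

/-- Keys `ID ‖ k ‖ x` of the function programmed in the filtering phase. -/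
abbrev FilterKey (P : Params) (𝔽 : Type) : Type := 𝔽 × Fin P.d × Coord P

/-- The points `(ID_{w_i} ‖ k ‖ (w_{i,k} + t), 0)` for all `i`, `k` and `-δ ≤ t ≤ δ`. -/
noncomputable def filterList {P : Params} (w : Fin P.n → Point P) (ident : Fin P.n → 𝔽) :
    List (FilterKey P 𝔽 × 𝔽) :=
  (List.finRange P.n).flatMap fun i => (List.finRange P.d).flatMap fun k =>
    (interval P (w i k)).toList.map fun y => ((ident i, k, y), 0)

/-- The sender's view: its input and coins (the random order in which it enumerates its set), its
view in the fuzzy mapping, and its shares in the filtering phase. -/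
structure SenderView (P : Params) (𝔽 K : Type) where
  input : Fin P.m → Point P
  order : Equiv.Perm (Fin P.m)
  fmap : FMapView P P.m P.n 𝔽 K
  share : Fin P.m → Fin P.d → 𝔽

/-- The receiver's view: its input, its view in the fuzzy mapping, its shares and the programmed
function of the filtering phase, and its outputs of the equality tests and oblivious transfers. -/
structure ReceiverView (P : Params) (𝔽 K : Type) where
  input : Fin P.n → Point P
  fmap : FMapView P P.n P.m 𝔽 K
  share : Fin P.m → Fin P.d → 𝔽
  fn : FilterKey P 𝔽 → 𝔽
  bits : Fin P.m → Bool
  items : Fin P.m → Option (Point P)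

/-- An execution: the views of both parties and the output of the receiver. -/
structure Execution (P : Params) (𝔽 K : Type) where
  sender : SenderView P 𝔽 K
  receiver : ReceiverView P 𝔽 K
  output : Finset (Point P)

/-- The fuzzy PSI protocol for the `L_∞` distance. -/
noncomputable def fuzzyPSI (P : Params) (F : K → 𝔽 → 𝔽)
    (Q : Fin P.m → Point P) (W : Fin P.n → Point P) : PMF (Execution P 𝔽 K) := do
  let π ← unif (Equiv.Perm (Fin P.m))
  let q : Fin P.m → Point P := fun j => Q (π j)
  let v ← fuzzyMapping P F q W
  let o ← soOPPRF (filterList W v.2.ident)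
    (fun e : Fin P.m × Fin P.d => (v.1.ident e.1, e.2, toCoord P (q e.1 e.2)))
  let b := peqt (fun j => ∑ k, o.receiver (j, k)) (fun j => -∑ k, o.sender (j, k))
  let z := ot (fun j => (none, some (q j))) b
  return { sender := { input := Q, order := π, fmap := v.1,
                       share := fun j k => o.receiver (j, k) }
           receiver := { input := W, fmap := v.2, share := fun j k => o.sender (j, k),
                         fn := o.fn, bits := b, items := z }
           output := Finset.univ.filter fun p => ∃ j, b j = true ∧ z j = some p }

end Protocol

/-! ### Encodings of inputs, outputs and views -/

section Encoding

variable {P : Params} {𝔽 K : Type} {N M : ℕ}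

def encodeFin {k : ℕ} (i : Fin k) : Data := .num i

def encodePoint (x : Point P) : Data := Data.ofFamily encodeFin x

/-- A set of points is coded as the list of its elements in lexicographic order. -/
def encodeSet (Z : Finset (Point P)) : Data :=
  .ofList (((Z.image fun x => List.ofFn x).sort (· ≤ ·)).map
    fun l => Data.ofList (l.map encodeFin))

/-- A coordinate, shifted by `δ` to make it a natural number. -/
def encodeCoord (y : Coord P) : Data := .num ((y : ℤ) + P.δ).toNat

def encodeMapKey {a : ℕ} : MapKey P a → Data
  | .inl (k, y) => .pair (.num 0) (.pair (encodeFin k) (encodeCoord y))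
  | .inr i => .pair (.num 1) (encodeFin i)

def encodeFilterKey (eF : 𝔽 ≃ Fin N) (x : FilterKey P 𝔽) : Data :=
  .pair (encodeBy eF x.1) (.pair (encodeFin x.2.1) (encodeCoord x.2.2))

/-- The view in the fuzzy mapping without the programmed function, which is given as an oracle. -/
def encodeFMapView (eF : 𝔽 ≃ Fin N) (eK : K ≃ Fin M) {a b : ℕ} (v : FMapView P a b 𝔽 K) : Data :=
  .ofList [Data.ofMatrix (encodeBy eF) v.r, Data.ofFamily (encodeBy eF) v.dummy,
    encodeBy eK v.key, Data.ofMatrix (encodeBy eF) v.partnerShare,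
    Data.ofMatrix (encodeBy eF) v.ownShare, Data.ofFamily (encodeBy eF) v.ident]

/-- The sender's view and the output: the programmed function of the fuzzy mapping is an oracle. -/
noncomputable def observeSender (eF : 𝔽 ≃ Fin N) (eK : K ≃ Fin M) (e : Execution P 𝔽 K) :
    Observation where
  data := .pair
    (.ofList [Data.ofFamily encodePoint e.sender.input, Data.ofFamily encodeFin e.sender.order,
      encodeFMapView eF eK e.sender.fmap, Data.ofMatrix (encodeBy eF) e.sender.share])
    (encodeSet e.output)
  oracles := oneOracle (oracleOf encodeMapKey (encodeBy eF) e.sender.fmap.fn)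

/-- The receiver's view and the output: the two programmed functions are oracles. -/
noncomputable def observeReceiver (eF : 𝔽 ≃ Fin N) (eK : K ≃ Fin M) (e : Execution P 𝔽 K) :
    Observation where
  data := .pair
    (.ofList [Data.ofFamily encodePoint e.receiver.input, encodeFMapView eF eK e.receiver.fmap,
      Data.ofMatrix (encodeBy eF) e.receiver.share,
      Data.ofFamily (fun b : Bool => Data.ofProp (b = true)) e.receiver.bits,
      Data.ofFamily
        (fun z : Option (Point P) => z.elim (.num 0) fun x => .pair (.num 1) (encodePoint x))
        e.receiver.items])
    (encodeSet e.output)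
  oracles := twoOracles (oracleOf encodeMapKey (encodeBy eF) e.receiver.fmap.fn)
    (oracleOf (encodeFilterKey eF) (encodeBy eF) e.receiver.fn)

/-- The input of a simulator: the security parameter and the public parameters (in unary, except for
the size of the universe), the number of field elements and of keys, the input of the corrupted party, and its output from the ideal
functionality. -/
def simulatorInput (s : ℕ) (P : Params) (N M : ℕ) (input output : Data) : Data :=
  .ofList [Data.unary s, Data.unary P.m, Data.unary P.n, Data.unary P.d, Data.unary P.δ,
    .num P.u, .num N, .num M, input, output]

end Encoding

/-! ### Security -/

section Security

variable (P : ℕ → Params) (𝔽 K : ℕ → Type) [∀ s, Field (𝔽 s)] [∀ s, Fintype (𝔽 s)]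
  [∀ s, AddCommGroup (K s)] [∀ s, Fintype (K s)]

/-- The set sizes, the dimension and the threshold are polynomial in the security parameter, and so
are the bit lengths of coordinates, field elements and keys. -/
def PolyBounded : Prop :=
  ∃ p : Polynomial ℕ, ∀ s,
    (P s).m ≤ p.eval s ∧ (P s).n ≤ p.eval s ∧ (P s).d ≤ p.eval s ∧ (P s).δ ≤ p.eval s ∧
    Nat.size (P s).u ≤ p.eval s ∧ Nat.size (Fintype.card (𝔽 s)) ≤ p.eval s ∧
    Nat.size (Fintype.card (K s)) ≤ p.eval s

/-- Admissible inputs: both sets satisfy the disjoint projection assumption. -/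
structure Inputs (P : Params) where
  Q : Fin P.m → Point P
  W : Fin P.n → Point P
  disjQ : DisjointProjection Q
  disjW : DisjointProjection W

variable (eF : ∀ s, 𝔽 s ≃ Fin (Fintype.card (𝔽 s))) (eK : ∀ s, K s ≃ Fin (Fintype.card (K s)))

/-- The protocol realizes the fuzzy PSI functionality against semi-honest adversaries: there are
probabilistic polynomial-time simulators for the sender (from its input) and for the receiver
(from its input and the ideal output) such that view and protocol output are computationally
indistinguishable from simulated view and ideal output. -/
def RealizesFPSI (F : (s : ℕ) → K s → 𝔽 s → 𝔽 s) : Prop :=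
  ∃ simS simR : Simulator, simS.IsPPT ∧ simR.IsPPT ∧
    Simulates simS (fun s => Inputs (P s))
      (fun s i => (fuzzyPSI (P s) (F s) i.Q i.W).map (observeSender (eF s) (eK s)))
      (fun s i => simulatorInput s (P s) (Fintype.card (𝔽 s)) (Fintype.card (K s))
        (Data.ofFamily encodePoint i.Q) (.num 0))
      (fun _ i => encodeSet (idealFPSI i.Q i.W)) ∧
    Simulates simR (fun s => Inputs (P s))
      (fun s i => (fuzzyPSI (P s) (F s) i.Q i.W).map (observeReceiver (eF s) (eK s)))
      (fun s i => simulatorInput s (P s) (Fintype.card (𝔽 s)) (Fintype.card (K s))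
        (Data.ofFamily encodePoint i.W) (encodeSet (idealFPSI i.Q i.W)))
      (fun _ i => encodeSet (idealFPSI i.Q i.W))

end Security

end FuzzyPSI

open FuzzyPSI

namespace FuzzyPSI

/-! ### Elementary facts about the machine model -/

/-! An execution is a deterministic function of one tuple of independent uniform coins
(`fuzzyPSI_eq_map`). Every probability is therefore a finite average over `Coins`, and every game
hop is a bijective change of coins, the resampling of a coordinate on which the rest does not depend
(`resample`), a bad event (`abs_expect_sub_le_prob`), or the pseudorandomness of `F`.

Correctness. How intervals merge does not depend on the random values, so a local identifier is a
sum of one entry of `r` per dimension (`localPid_eq`). The whole `δ`-interval of an item lies in one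
merged interval. Hence, if two items of the two parties are close, the programmed function of each
party, evaluated at the other item and summed over the dimensions, gives the local identifier of the
item it was programmed for; both items feed the sum of the two local identifiers to the PRF
(`prfInput_eq_of_close`), receive the same identifier, and hit only programmed zeros in the filter.
So no item of the intersection is lost. If the receiver's identifiers are distinct, an item that is
far from all receiver items queries at least one unprogrammed filter key. The filter sum is then
uniform and vanishes with probability `1 / |𝔽|`, and a union bound over the `m` items gives
`prob_bad_le`.

Collisions. By the disjoint projection assumption each item has a dimension in which its random
value enters its own local identifier and no other. Differences of PRF inputs are thus uniform, and
the inputs of a party with `a` items collide with probability at most `a² / |𝔽|`. Pseudorandomness,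
applied to a distinguisher that looks for repetitions, carries this over to the identifiers
(`exists_prob_identW_le`).

Security. Outside the bad event the output is the ideal one and the equality tests are right. The
additive shares in a view are one-time pads, the sum of the key shares is uniform given either
share, and on distinct inputs the PRF values may be replaced by independent uniform ones
(`ident_hybrid`). What remains is uniform data together with the party's own programmed functions,
which the simulators can sample. The places at which the receiver gets the items of the intersection
are uniformly distributed because of the sender's random order (`exists_perm_getElem_pointList`).

The reductions and simulators must be actual polynomial-time programs. The `PT` calculus produces
them, `host` runs a distinguisher inside another program, and the oracles of random functions with
huge domains are answered lazily: the value at a query is the content of a tape cell whose address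
contains the query. One handler (`Handler.answer`) serves the simulators and the reductions alike.
-/

theorem Data.one_le_size (x : Data) : 1 ≤ x.size := by
  cases x <;> simp [Data.size]

theorem Data.size_fst_le (x : Data) : x.fst.size ≤ x.size := by
  cases x <;> simp [Data.size, Data.fst]; omega

theorem Data.size_snd_le (x : Data) : x.snd.size ≤ x.size := by
  cases x <;> simp [Data.size, Data.snd]; omega

theorem Data.size_ofProp_le (p : Prop) [Decidable p] : (Data.ofProp p).size ≤ 2 := by
  unfold Data.ofProp; split_ifs <;> simp [Data.size]

theorem Runs.size_input_le {O : Oracles} {ω : Tape} {c : Code} {x y : Data} {t : ℕ}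
    (h : Runs O ω c x y t) : x.size ≤ t := by
  induction h <;> omega

/-- Logarithmic cost charges for all data written, so a time bound is also a size bound. This is
what makes polynomial time closed under composition. -/
theorem Runs.size_output_le {O : Oracles} {ω : Tape} {c : Code} {x y : Data} {t : ℕ}
    (h : Runs O ω c x y t) : y.size ≤ t := by
  induction h with
  | pair _ _ h1 h2 => simp only [Data.size]; omega
  | loop_done h => have := h.size_input_le; omega
  | _ => omega

/-- With oracles and tape fixed, exactly one rule applies in each configuration. Hence the choice
made in `result` is harmless. -/
theorem Runs.deterministic {O : Oracles} {ω : Tape} {c : Code} {x y : Data} {t : ℕ}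
    (h : Runs O ω c x y t) : ∀ {y' : Data} {t' : ℕ}, Runs O ω c x y' t' → y = y' ∧ t = t' := by
  induction h with
  | const => intro _ _ h'; cases h'; exact ⟨rfl, rfl⟩
  | prim => intro _ _ h'; cases h'; exact ⟨rfl, rfl⟩
  | rand => intro _ _ h'; cases h'; exact ⟨rfl, rfl⟩
  | query => intro _ _ h'; cases h'; exact ⟨rfl, rfl⟩
  | pair _ _ h1 h2 =>
    intro _ _ h'
    cases h' with
    | pair a b =>
      obtain ⟨rfl, rfl⟩ := h1 a
      obtain ⟨rfl, rfl⟩ := h2 b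
      exact ⟨rfl, rfl⟩
  | seq _ _ h1 h2 =>
    intro _ _ h'
    cases h' with
    | seq a b =>
      obtain ⟨rfl, rfl⟩ := h1 a
      obtain ⟨rfl, rfl⟩ := h2 b
      exact ⟨rfl, rfl⟩
  | branch_true _ hb _ h1 h2 =>
    intro _ _ h'
    cases h' with
    | branch_true a _ b =>
      obtain ⟨rfl, rfl⟩ := h1 a
      obtain ⟨rfl, rfl⟩ := h2 b
      exact ⟨rfl, rfl⟩
    | branch_false a b => exact absurd (h1 a).1 hb
  | branch_false _ _ h1 h2 =>
    intro _ _ h'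
    cases h' with
    | branch_true a hb b => exact absurd (h1 a).1.symm hb
    | branch_false a b =>
      obtain ⟨_, rfl⟩ := h1 a
      obtain ⟨rfl, rfl⟩ := h2 b
      exact ⟨rfl, rfl⟩
  | loop_done _ h1 =>
    intro _ _ h'
    cases h' with
    | loop_done a =>
      obtain ⟨_, rfl⟩ := h1 a
      exact ⟨rfl, rfl⟩
    | loop_step a hb b c => exact absurd (h1 a).1.symm hb
  | loop_step _ hb _ _ h1 h2 h3 =>
    intro _ _ h'
    cases h' with
    | loop_done a => exact absurd (h1 a).1 hb
    | loop_step a _ b c =>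
      obtain ⟨_, rfl⟩ := h1 a
      obtain ⟨rfl, rfl⟩ := h2 b
      obtain ⟨rfl, rfl⟩ := h3 c
      exact ⟨rfl, rfl⟩

theorem result_eq {O : Oracles} {ω : Tape} {c : Code} {x y : Data} {t : ℕ}
    (h : Runs O ω c x y t) : result O ω c x = y := by
  have hex : ∃ y, ∃ t, Runs O ω c x y t := ⟨y, t, h⟩
  rw [result, dif_pos hex]
  obtain ⟨t', h'⟩ := hex.choose_spec
  exact (h'.deterministic h).1

/-- A computation reads only finitely many cells of the random tape. -/
theorem Runs.exists_finset {O : Oracles} {ω : Tape} {c : Code} {x y : Data} {t : ℕ}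
    (h : Runs O ω c x y t) : ∃ S : Finset (ℕ × Data), ∀ ω' : Tape, (∀ i ∈ S, ω' i = ω i) →
      Runs O ω' c x y t := by
  classical
  induction h with
  | const v x => exact ⟨∅, fun _ _ => .const v x⟩
  | prim p x => exact ⟨∅, fun _ _ => .prim p x⟩
  | rand x =>
    refine ⟨{(x.fst.toNat, x.snd)}, fun ω' h => ?_⟩
    have := h (x.fst.toNat, x.snd) (by simp)
    rw [← this]
    exact .rand x
  | query x => exact ⟨∅, fun _ _ => .query x⟩
  | pair _ _ h1 h2 =>
    obtain ⟨S, hS⟩ := h1; obtain ⟨T, hT⟩ := h2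
    exact ⟨S ∪ T, fun ω' h => .pair (hS ω' fun i hi => h i (by simp [hi]))
      (hT ω' fun i hi => h i (by simp [hi]))⟩
  | seq _ _ h1 h2 =>
    obtain ⟨S, hS⟩ := h1; obtain ⟨T, hT⟩ := h2
    exact ⟨S ∪ T, fun ω' h => .seq (hS ω' fun i hi => h i (by simp [hi]))
      (hT ω' fun i hi => h i (by simp [hi]))⟩
  | branch_true _ hb _ h1 h2 =>
    obtain ⟨S, hS⟩ := h1; obtain ⟨T, hT⟩ := h2
    exact ⟨S ∪ T, fun ω' h => .branch_true (hS ω' fun i hi => h i (by simp [hi])) hb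
      (hT ω' fun i hi => h i (by simp [hi]))⟩
  | branch_false _ _ h1 h2 =>
    obtain ⟨S, hS⟩ := h1; obtain ⟨T, hT⟩ := h2
    exact ⟨S ∪ T, fun ω' h => .branch_false (hS ω' fun i hi => h i (by simp [hi]))
      (hT ω' fun i hi => h i (by simp [hi]))⟩
  | loop_done _ h1 =>
    obtain ⟨S, hS⟩ := h1
    exact ⟨S, fun ω' h => .loop_done (hS ω' h)⟩
  | loop_step _ hb _ _ h1 h2 h3 =>
    obtain ⟨S, hS⟩ := h1; obtain ⟨T, hT⟩ := h2; obtain ⟨U, hU⟩ := h3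
    exact ⟨S ∪ T ∪ U, fun ω' h => .loop_step (hS ω' fun i hi => h i (by simp [hi])) hb
      (hT ω' fun i hi => h i (by simp [hi])) (hU ω' fun i hi => h i (by simp [hi]))⟩

/-- Data are finite binary trees with natural numbers as leaves. -/
def Data.code : Data → ℕ
  | .num n => 2 * n
  | .pair a b => 2 * Nat.pair a.code b.code + 1

theorem Data.code_injective : Function.Injective Data.code := by
  intro x
  induction x with
  | num n =>
    intro y h
    cases y with
    | num m => simp only [Data.code] at h; congr 1; omega
    | pair a b => simp only [Data.code] at h; omega
  | pair a b ha hb =>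
    intro y h
    cases y with
    | num m => simp only [Data.code] at h; omega
    | pair c d =>
      simp only [Data.code] at h
      have h' : Nat.pair a.code b.code = Nat.pair c.code d.code := by omega
      rw [Nat.pair_eq_pair] at h'
      rw [ha h'.1, hb h'.2]

instance : Countable Data := Data.code_injective.countable

/-- A halting computation reads finitely many cells, so the event is open in the product topology.
As there are only countably many cells, each finite, open sets are measurable for the product
σ-algebra. -/
theorem measurableSet_runs (O : Oracles) (c : Code) (x y : Data) :
    MeasurableSet {ω : Tape | ∃ t, Runs O ω c x y t} := by
  have hopen : IsOpen {ω : Tape | ∃ t, Runs O ω c x y t} := by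
    rw [isOpen_pi_iff]
    rintro ω ⟨t, h⟩
    obtain ⟨S, hS⟩ := h.exists_finset
    refine ⟨S, fun i => {ω i}, fun i hi => ⟨isOpen_discrete _, rfl⟩, fun ω' h' => ⟨t, hS ω' ?_⟩⟩
    intro i hi
    exact h' i hi
  exact hopen.measurableSet

instance : IsProbabilityMeasure tapeMeasure := by
  unfold tapeMeasure; infer_instance

theorem acceptProb_le_one (O : Oracles) (D : Code) (x : Data) : acceptProb O D x ≤ 1 :=
  prob_le_one

/-! ### Functions computable in polynomial time -/

theorem eval_mono (p : Polynomial ℕ) {a b : ℕ} (h : a ≤ b) : p.eval a ≤ p.eval b := by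
  rw [Polynomial.eval_eq_sum_range, Polynomial.eval_eq_sum_range]
  gcongr

/-- A function of oracles, random tape and input. -/
abbrev Fn : Type := Oracles → Tape → Data → Data

/-- The function is computed by a polynomial-time program. -/
def PT (f : Fn) : Prop :=
  ∃ c : Code, ∃ p : Polynomial ℕ, ∀ (b : ℕ) (O : Oracles), (∀ i q, (O i q).size ≤ b) →
    ∀ (ω : Tape) (x : Data), ∃ t : ℕ, Runs O ω c x (f O ω x) t ∧ t ≤ p.eval (x.size + b)

theorem PT.size_le {f : Fn} (h : PT f) : ∃ p : Polynomial ℕ, ∀ (b : ℕ) (O : Oracles),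
    (∀ i q, (O i q).size ≤ b) → ∀ ω x, (f O ω x).size ≤ p.eval (x.size + b) := by
  obtain ⟨c, p, h⟩ := h
  refine ⟨p, fun b O hO ω x => ?_⟩
  obtain ⟨t, ht, hp⟩ := h b O hO ω x
  exact ht.size_output_le.trans hp

theorem PT.const (v : Data) : PT fun _ _ _ => v := by
  refine ⟨.const v, Polynomial.X + Polynomial.C (1 + v.size), fun b O _ ω x =>
    ⟨_, .const v x, ?_⟩⟩
  simp; omega

theorem PT.id : PT fun _ _ x => x := by
  refine ⟨.prim .id, 2 * Polynomial.X + 1, fun b O _ ω x => ⟨_, .prim .id x, ?_⟩⟩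
  simp [Prim.apply]; omega

theorem PT.pair {f g : Fn} (hf : PT f) (hg : PT g) : PT fun O ω x => .pair (f O ω x) (g O ω x) := by
  obtain ⟨c, p, hf⟩ := hf
  obtain ⟨d, q, hg⟩ := hg
  refine ⟨.pair c d, p + q + 1, fun b O hO ω x => ?_⟩
  obtain ⟨t, h1, h2⟩ := hf b O hO ω x
  obtain ⟨t', h1', h2'⟩ := hg b O hO ω x
  refine ⟨_, .pair h1 h1', ?_⟩
  simp; omega

/-- The size of the intermediate result is bounded by the running time `p` of the first program,
hence the composed polynomial. -/
theorem PT.comp {f g : Fn} (hg : PT g) (hf : PT f) : PT fun O ω x => g O ω (f O ω x) := by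
  obtain ⟨c, p, hf⟩ := hf
  obtain ⟨d, q, hg⟩ := hg
  refine ⟨.seq c d, p + q.comp (p + Polynomial.X) + 1, fun b O hO ω x => ?_⟩
  obtain ⟨t, h1, h2⟩ := hf b O hO ω x
  obtain ⟨t', h1', h2'⟩ := hg b O hO ω (f O ω x)
  refine ⟨_, .seq h1 h1', ?_⟩
  have := h1.size_output_le
  have := eval_mono q (show (f O ω x).size + b ≤ p.eval (x.size + b) + (x.size + b) by omega)
  simp; omega

/-- The truth value of a proposition. -/
noncomputable def bit (p : Prop) : Data := @Data.ofProp p (Classical.propDecidable p)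

/-- Separates the truth value from the decidability instance, so that the combinators below apply
whichever instance a definition has picked. -/
theorem ofProp_eq_bit (p : Prop) [Decidable p] : Data.ofProp p = bit p := by
  unfold bit Data.ofProp; congr

theorem bit_eq_zero {p : Prop} : bit p = .num 0 ↔ ¬ p := by
  unfold bit Data.ofProp; split_ifs <;> simp [*]

theorem bit_true {p : Prop} (h : p) : bit p = .num 1 := by
  unfold bit Data.ofProp; rw [if_pos h]

theorem bit_false {p : Prop} (h : ¬ p) : bit p = .num 0 := bit_eq_zero.2 h

theorem size_bit_le (p : Prop) : (bit p).size ≤ 2 :=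
  @Data.size_ofProp_le p (Classical.propDecidable p)

theorem PT.ite {p : Oracles → Tape → Data → Prop} {f g : Fn} {dec : ∀ O ω x, Decidable (p O ω x)}
    (hc : PT fun O ω x => bit (p O ω x)) (hf : PT f) (hg : PT g) :
    PT fun O ω x => if p O ω x then f O ω x else g O ω x := by
  obtain ⟨k, r, hc⟩ := hc
  obtain ⟨c, p', hf⟩ := hf
  obtain ⟨d, q, hg⟩ := hg
  refine ⟨.branch k c d, r + p' + q + 1, fun b O hO ω x => ?_⟩
  obtain ⟨s, hs, hs'⟩ := hc b O hO ω x
  obtain ⟨t, h1, h2⟩ := hf b O hO ω x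
  obtain ⟨t', h1', h2'⟩ := hg b O hO ω x
  by_cases h : p O ω x
  · refine ⟨_, by beta_reduce; rw [if_pos h]; exact .branch_true hs (by simpa [bit_eq_zero] using h) h1, ?_⟩
    simp; omega
  · simp only [bit_eq_zero.2 h] at hs
    refine ⟨_, by beta_reduce; rw [if_neg h]; exact .branch_false hs h1', ?_⟩
    simp; omega

theorem PT.query' : PT fun O _ x => O x.fst.toNat x.snd := by
  refine ⟨.query, Polynomial.X + 1, fun b O hO ω x => ⟨_, .query x, ?_⟩⟩
  have := hO x.fst.toNat x.snd
  simp; omega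

/-- A cell with index `k` holds a number at most `k`, so the answer is no larger than the input that
names `k`. -/
theorem PT.rand' : PT fun _ ω x => .num (ω (x.fst.toNat, x.snd)) := by
  refine ⟨.rand, 2 * Polynomial.X + 2, fun b O hO ω x => ⟨_, .rand x, ?_⟩⟩
  have h1 : (ω (x.fst.toNat, x.snd) : ℕ) ≤ x.fst.toNat := by
    have := (ω (x.fst.toNat, x.snd)).2
    simp only at this; omega
  have h2 := Nat.size_le_size h1
  have h3 : Nat.size x.fst.toNat ≤ x.size := by
    cases x with
    | num n => simp [Data.fst, Data.toNat]
    | pair a b =>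
      cases a <;> simp [Data.fst, Data.toNat, Data.size]
      omega
  simp [Data.size]; omega

theorem PT.query {i : ℕ} {f : Fn} (hf : PT f) : PT fun O ω x => O i (f O ω x) :=
  PT.query'.comp ((PT.const (.num i)).pair hf)

theorem PT.rand {f g : Fn} (hf : PT f) (hg : PT g) :
    PT fun O ω x => .num (ω ((f O ω x).toNat, g O ω x)) :=
  PT.rand'.comp (hf.pair hg)

theorem Data.size_num_add_le (a b : ℕ) : Nat.size (a + b) ≤ Nat.size a + Nat.size b + 1 := by
  have ha := Nat.lt_size_self a
  have hb := Nat.lt_size_self b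
  rw [Nat.size_le]
  have h1 := Nat.pow_le_pow_right (n := 2) (by norm_num) (Nat.le_add_right a.size b.size)
  have h2 := Nat.pow_le_pow_right (n := 2) (by norm_num) (Nat.le_add_left b.size a.size)
  rw [pow_succ]; omega

theorem Data.size_num_mul_le (a b : ℕ) : Nat.size (a * b) ≤ Nat.size a + Nat.size b := by
  have ha := Nat.lt_size_self a
  have hb := Nat.lt_size_self b
  rw [Nat.size_le, pow_add]
  exact Nat.mul_lt_mul'' ha hb

theorem Data.size_toNat_le (x : Data) : Nat.size x.toNat ≤ x.size := by
  cases x <;> simp [Data.toNat, Data.size]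

theorem Prim.apply_isPair (x : Data) : Prim.isPair.apply x = bit (∃ a b, x = .pair a b) := rfl
theorem Prim.apply_eq (x : Data) : Prim.eq.apply x = bit (x.fst = x.snd) := rfl
theorem Prim.apply_le (x : Data) : Prim.le.apply x = bit (x.fst.toNat ≤ x.snd.toNat) :=
  ofProp_eq_bit _

theorem Prim.size_apply_le (p : Prim) (x : Data) : (p.apply x).size ≤ 2 * x.size + 2 := by
  have h1 := x.fst.size_toNat_le
  have h2 := x.snd.size_toNat_le
  have h3 := x.size_fst_le
  have h4 := x.size_snd_le
  cases p
  case isPair => rw [Prim.apply_isPair]; have := size_bit_le (∃ a b, x = Data.pair a b); omega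
  case eq => rw [Prim.apply_eq]; have := size_bit_le (x.fst = x.snd); omega
  case le => rw [Prim.apply_le]; have := size_bit_le (x.fst.toNat ≤ x.snd.toNat); omega
  all_goals simp only [Prim.apply]
  · omega
  · omega
  · omega
  · have := Data.size_num_add_le x.fst.toNat x.snd.toNat
    simp only [Data.size]; omega
  · have := Nat.size_le_size (Nat.sub_le x.fst.toNat x.snd.toNat)
    simp only [Data.size]; omega
  · have := Data.size_num_mul_le x.fst.toNat x.snd.toNat
    simp only [Data.size]; omega
  · have := Nat.size_le_size (Nat.div_le_self x.fst.toNat x.snd.toNat)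
    simp only [Data.size]; omega

theorem PT.prim (p : Prim) : PT fun _ _ x => p.apply x := by
  refine ⟨.prim p, 3 * Polynomial.X + 3, fun b O _ ω x => ⟨_, .prim p x, ?_⟩⟩
  have := p.size_apply_le x
  simp; omega

theorem PT.fst {f : Fn} (hf : PT f) : PT fun O ω x => (f O ω x).fst := (PT.prim .fst).comp hf
theorem PT.snd {f : Fn} (hf : PT f) : PT fun O ω x => (f O ω x).snd := (PT.prim .snd).comp hf

section

variable {f g : Fn} (hf : PT f) (hg : PT g)
include hf hg

theorem PT.eq : PT fun O ω x => bit (f O ω x = g O ω x) := by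
  simpa [Prim.apply_eq, Data.fst, Data.snd] using (PT.prim .eq).comp (hf.pair hg)
theorem PT.add : PT fun O ω x => Data.num ((f O ω x).toNat + (g O ω x).toNat) := by
  simpa [Prim.apply, Data.fst, Data.snd] using (PT.prim .add).comp (hf.pair hg)
theorem PT.sub : PT fun O ω x => Data.num ((f O ω x).toNat - (g O ω x).toNat) := by
  simpa [Prim.apply, Data.fst, Data.snd] using (PT.prim .sub).comp (hf.pair hg)
theorem PT.mul : PT fun O ω x => Data.num ((f O ω x).toNat * (g O ω x).toNat) := by
  simpa [Prim.apply, Data.fst, Data.snd] using (PT.prim .mul).comp (hf.pair hg)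
theorem PT.le : PT fun O ω x => bit ((f O ω x).toNat ≤ (g O ω x).toNat) := by
  simpa [Prim.apply_le, Data.fst, Data.snd] using (PT.prim .le).comp (hf.pair hg)

end

theorem PT.isPair {f : Fn} (hf : PT f) : PT fun O ω x => bit (∃ a b, f O ω x = .pair a b) := by
  simpa [Prim.apply_isPair] using (PT.prim .isPair).comp hf

theorem PT.not {p : Oracles → Tape → Data → Prop} (hp : PT fun O ω x => bit (p O ω x)) :
    PT fun O ω x => bit (¬ p O ω x) := by
  convert hp.eq (PT.const (.num 0)) using 5
  rw [bit_eq_zero]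

theorem PT.and {p q : Oracles → Tape → Data → Prop} (hp : PT fun O ω x => bit (p O ω x))
    (hq : PT fun O ω x => bit (q O ω x)) : PT fun O ω x => bit (p O ω x ∧ q O ω x) := by
  classical
  convert PT.ite (dec := fun O ω x => Classical.propDecidable (p O ω x)) hp hq (PT.const (.num 0))
    using 4 with O ω x
  split_ifs with h <;> simp [h, bit_eq_zero]

/-- The entries of a list. -/
def Data.toList : Data → List Data
  | .num _ => []
  | .pair a b => a :: b.toList

theorem Data.length_toList_le (l : Data) : l.toList.length ≤ l.size := by
  induction l with
  | num n => simp [Data.toList]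
  | pair a b _ hb => simp [Data.toList, Data.size]; omega

/-- Iteration over the entries of a list is possible in polynomial time if the intermediate results
remain small. -/
theorem PT.foldl {l a g : Fn} (hl : PT l) (ha : PT a) (hg : PT g)
    (hbound : ∃ q : Polynomial ℕ, ∀ (b : ℕ) (O : Oracles), (∀ i q, (O i q).size ≤ b) → ∀ ω x,
      ∀ l', l' <+: (l O ω x).toList →
        (l'.foldl (fun acc e => g O ω (.pair x (.pair acc e))) (a O ω x)).size
          ≤ q.eval (x.size + b)) :
    PT fun O ω x =>
      (l O ω x).toList.foldl (fun acc e => g O ω (.pair x (.pair acc e))) (a O ω x) := by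
  -- A state of the loop has the form `(x, (acc, rest))`; the loop runs as long as `rest` is a pair
  -- and consumes its head in each round.
  have hcond : PT fun _ _ st => bit (∃ a b, st.snd.snd = .pair a b) := PT.id.snd.snd.isPair
  have hbody : PT fun O ω st => .pair st.fst
      (.pair (g O ω (.pair st.fst (.pair st.snd.fst st.snd.snd.fst))) st.snd.snd.snd) :=
    PT.id.fst.pair ((hg.comp (PT.id.fst.pair (PT.id.snd.fst.pair PT.id.snd.snd.fst))).pair
      PT.id.snd.snd.snd)
  obtain ⟨c, pc, hc⟩ := hcond
  obtain ⟨d, pd, hd⟩ := hbody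
  -- `A` bounds all intermediate results and `S` every state. Both stay fixed during the induction,
  -- so each round costs at most the same amount.
  have key : ∀ (b A : ℕ) (O : Oracles), (∀ i q, (O i q).size ≤ b) → ∀ (ω : Tape)
      (x rest acc : Data), (∀ l', l' <+: rest.toList →
        (l'.foldl (fun acc e => g O ω (.pair x (.pair acc e))) acc).size ≤ A) →
      ∀ S, x.size + A + rest.size + 2 ≤ S →
      ∃ t r, Runs O ω (.loop c d) (.pair x (.pair acc rest))
        (.pair x (.pair (rest.toList.foldl (fun acc e => g O ω (.pair x (.pair acc e))) acc) r)) t ∧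
        t ≤ (rest.toList.length + 1) * (pc.eval (S + b) + pd.eval (S + b) + 1) := by
    intro b A O hO ω x rest
    induction rest with
    | num n =>
      intro acc hA S hS
      obtain ⟨t, h1, h2⟩ := hc b O hO ω (.pair x (.pair acc (.num n)))
      have hacc := hA [] (by simp)
      simp only [List.foldl_nil] at hacc
      have h3 := eval_mono pc (show (Data.pair x (.pair acc (.num n))).size + b ≤ S + b by
        simp only [Data.size] at hS ⊢; omega)
      have e : bit (∃ a b, (Data.pair x (Data.pair acc (Data.num n))).snd.snd = .pair a b)
          = .num 0 := by
        simp [bit_eq_zero, Data.snd]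
      simp only [e] at h1
      refine ⟨_, _, .loop_done h1, ?_⟩
      simp only [Data.toList, List.length_nil]
      omega
    | pair e rest _ ih =>
      intro acc hA S hS
      obtain ⟨t, h1, h2⟩ := hc b O hO ω (.pair x (.pair acc (.pair e rest)))
      obtain ⟨t₁, h1', h2'⟩ := hd b O hO ω (.pair x (.pair acc (.pair e rest)))
      have hacc := hA [] (by simp)
      simp only [List.foldl_nil] at hacc
      have hsz : (Data.pair x (.pair acc (.pair e rest))).size + b ≤ S + b := by
        simp only [Data.size] at hS ⊢; omega
      have h3 := eval_mono pc hsz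
      have h3' := eval_mono pd hsz
      obtain ⟨t₂, r, h4, h5⟩ := ih (g O ω (.pair x (.pair acc e))) (by
        intro l' hl'
        have := hA (e :: l') (by simpa [Data.toList] using hl')
        simpa using this) S (by simp only [Data.size] at hS ⊢; omega)
      refine ⟨_, _, .loop_step h1 ?_ h1' h4, ?_⟩
      · simp [bit_eq_zero, Data.snd]
      · simp only [Data.toList, List.length_cons]
        rw [add_mul (_ + 1) 1]
        omega
  obtain ⟨q, hq⟩ := hbound
  obtain ⟨cl, pl, hl⟩ := hl
  obtain ⟨ca, pa, ha⟩ := ha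
  -- The program builds the state `(x, (a, l))`, runs the loop, and projects to the accumulator. The
  -- polynomial is a crude sum of the costs of these three steps.
  refine ⟨.seq (.pair (.prim .id) (.pair ca cl)) (.seq (.loop c d) (.seq (.prim .snd) (.prim .fst))),
    3 * Polynomial.X + pl + pa + 20 + 3 * q + (pl + 1) *
      ((pc.comp (2 * Polynomial.X + q + pl + 2)) + pd.comp (2 * Polynomial.X + q + pl + 2) + 4)
      * 4, ?_⟩
  intro b O hO ω x
  obtain ⟨t₁, h1, h1'⟩ := ha b O hO ω x
  obtain ⟨t₂, h2, h2'⟩ := hl b O hO ω x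
  have h2s := h2.size_output_le
  have h2l := (l O ω x).length_toList_le
  obtain ⟨t₃, r, h3, h3'⟩ := key b (q.eval (x.size + b)) O hO ω x (l O ω x) (a O ω x)
    (hq b O hO ω x) (x.size + q.eval (x.size + b) + pl.eval (x.size + b) + 2) (by omega)
  have h3s := h3.size_output_le
  refine ⟨_, .seq (.pair (.prim .id x) (.pair h1 h2)) (.seq h3 (.seq (.prim .snd _) (.prim .fst _))),
    ?_⟩
  have hF := hq b O hO ω x _ List.prefix_rfl
  set R := ((l O ω x).toList.foldl (fun acc e => g O ω (.pair x (.pair acc e))) (a O ω x)) with hR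
  have e1 : (x.size + q.eval (x.size + b) + pl.eval (x.size + b) + 2) + b ≤
      2 * (x.size + b) + q.eval (x.size + b) + pl.eval (x.size + b) + 2 := by omega
  have e2 := eval_mono pc e1
  have e3 := eval_mono pd e1
  simp only [Prim.apply, Data.fst, Data.snd, Data.size] at h3s ⊢
  simp only [Polynomial.eval_add, Polynomial.eval_mul, Polynomial.eval_comp, Polynomial.eval_X,
    Polynomial.eval_one, Polynomial.eval_ofNat]
  set Y := Polynomial.eval (2 * (x.size + b) + q.eval (x.size + b) + pl.eval (x.size + b) + 2) pc +
    Polynomial.eval (2 * (x.size + b) + q.eval (x.size + b) + pl.eval (x.size + b) + 2) pd with hY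
  have e4 : t₃ ≤ (pl.eval (x.size + b) + 1) * (Y + 4) := by
    refine h3'.trans ?_
    gcongr ?_ * ?_
    · omega
    · omega
  have e5 : t₃ * 4 ≤ (pl.eval (x.size + b) + 1) * (Y + 4) * 4 := by gcongr
  omega

theorem PT.polyTime {f : Fn} (h : PT f) : ∃ c : Code, PolyTime c ∧
    ∀ O, (∃ b, ∀ i q, (O i q).size ≤ b) → ∀ ω x, ∃ t, Runs O ω c x (f O ω x) t := by
  obtain ⟨c, p, h⟩ := h
  refine ⟨c, ⟨p, fun b O hO ω x => ?_⟩, ?_⟩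
  · obtain ⟨t, h1, h2⟩ := h b O hO ω x
    exact ⟨_, t, h1, h2⟩
  · rintro O ⟨b, hO⟩ ω x
    obtain ⟨t, h1, -⟩ := h b O hO ω x
    exact ⟨t, h1⟩

end FuzzyPSI

namespace FuzzyPSI

/-! ### List processing in polynomial time -/

noncomputable instance : DecidableEq Data := Classical.decEq _

@[simp] theorem Data.toList_ofList (l : List Data) : (Data.ofList l).toList = l := by
  induction l <;> simp_all [Data.ofList, Data.toList]

@[simp] theorem Data.fst_pair (a b : Data) : (Data.pair a b).fst = a := rfl
@[simp] theorem Data.snd_pair (a b : Data) : (Data.pair a b).snd = b := rfl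
@[simp] theorem Data.toNat_num (n : ℕ) : (Data.num n).toNat = n := rfl

theorem Data.size_le_of_mem {l e : Data} (h : e ∈ l.toList) : e.size ≤ l.size := by
  induction l with
  | num n => simp [Data.toList] at h
  | pair a b _ hb =>
    simp only [Data.toList, List.mem_cons] at h
    simp only [Data.size]
    rcases h with rfl | h
    · omega
    · have := hb h; omega

theorem Data.size_ofList_toList (l : Data) : (Data.ofList l.toList).size ≤ l.size := by
  induction l with
  | num n => simp [Data.toList, Data.ofList, Data.size]
  | pair a b _ hb => simp [Data.toList, Data.ofList, Data.size]; omega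

theorem Data.size_ofList (l : List Data) : (Data.ofList l).size = (l.map fun e => e.size + 1).sum + 1 := by
  induction l with
  | nil => simp [Data.ofList, Data.size]
  | cons a l ih => simp [Data.ofList, Data.size, ih]; omega

theorem Data.size_ofList_sublist {l l' : List Data} (h : l.Sublist l') :
    (Data.ofList l).size ≤ (Data.ofList l').size := by
  rw [Data.size_ofList, Data.size_ofList]
  have := (h.map fun e => e.size + 1).sum_le_sum (by simp)
  omega

theorem Data.size_ofList_append (l l' : List Data) :
    (Data.ofList (l ++ l')).size + 1 = (Data.ofList l).size + (Data.ofList l').size := by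
  simp only [Data.size_ofList, List.map_append, List.sum_append]; omega

/-- Steps, intermediate results and inputs of an iteration, as functions of oracles and tape. -/
abbrev Fn₂ : Type := Oracles → Tape → Data → Data → Data
abbrev Fn₃ : Type := Oracles → Tape → Data → Data → Data → Data

/-- The same statement with a curried step function, the form in which the later folds are written.
-/
theorem PT.foldl_of_bound {l a : Fn} {G : Fn₃} (hl : PT l) (ha : PT a)
    (hG : PT fun O ω y => G O ω y.fst y.snd.fst y.snd.snd)
    (hbound : ∃ q : Polynomial ℕ, ∀ (b : ℕ) (O : Oracles), (∀ i q, (O i q).size ≤ b) → ∀ ω x,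
      ∀ l', l' <+: (l O ω x).toList →
        (l'.foldl (G O ω x) (a O ω x)).size ≤ q.eval (x.size + b)) :
    PT fun O ω x => (l O ω x).toList.foldl (G O ω x) (a O ω x) :=
  PT.foldl hl ha hG hbound

/-- If every step of an iteration increases the size by a polynomial that does not depend on the
intermediate result, then the iteration is possible in polynomial time. -/
theorem PT.foldl_additive {l a : Fn} {G : Fn₃} (hl : PT l) (ha : PT a)
    (hG : PT fun O ω y => G O ω y.fst y.snd.fst y.snd.snd)
    (hbound : ∃ q : Polynomial ℕ, ∀ (b : ℕ) (O : Oracles), (∀ i q, (O i q).size ≤ b) → ∀ ω x acc e,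
      (G O ω x acc e).size ≤ acc.size + q.eval (x.size + e.size + b)) :
    PT fun O ω x => (l O ω x).toList.foldl (G O ω x) (a O ω x) := by
  refine PT.foldl_of_bound hl ha hG ?_
  obtain ⟨q, hq⟩ := hbound
  obtain ⟨pl, hpl⟩ := hl.size_le
  obtain ⟨pa, hpa⟩ := ha.size_le
  refine ⟨pa + pl * q.comp (Polynomial.X + pl), fun b O hO ω x l' hl' => ?_⟩
  have h1 := hpl b O hO ω x
  have h2 := hpa b O hO ω x
  have key : ∀ (l' : List Data) (acc : Data), (∀ e ∈ l', e.size ≤ pl.eval (x.size + b)) →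
      (l'.foldl (G O ω x) acc).size ≤
        acc.size + l'.length * q.eval (x.size + b + pl.eval (x.size + b)) := by
    intro l'
    induction l' with
    | nil => simp
    | cons e l' ih =>
      intro acc h
      rw [List.foldl_cons, List.length_cons, add_mul]
      have h3 := ih (G O ω x acc e) fun e' he' => h e' (by simp [he'])
      have h4 := hq b O hO ω x acc e
      have h5 := h e (by simp)
      have h6 := eval_mono q (show x.size + e.size + b ≤ x.size + b + pl.eval (x.size + b) by omega)
      omega
  have h3 := key l' (a O ω x) fun e he =>
    (Data.size_le_of_mem (hl'.subset he)).trans h1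
  have h4 : l'.length ≤ pl.eval (x.size + b) :=
    hl'.length_le.trans ((Data.length_toList_le _).trans h1)
  simp only [Polynomial.eval_add, Polynomial.eval_mul, Polynomial.eval_comp, Polynomial.eval_X]
  have := Nat.mul_le_mul_right (q.eval (x.size + b + pl.eval (x.size + b))) h4
  omega

/-- Consing during a left fold reverses the list, so `PT.map` and `PT.append` are obtained by
reversing once more. -/
theorem foldl_pair_eq (f : Data → Data) (l : List Data) : ∀ acc : List Data,
    l.foldl (fun acc e => Data.pair (f e) acc) (Data.ofList acc)
      = Data.ofList ((l.map f).reverse ++ acc) := by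
  induction l with
  | nil => simp
  | cons e l ih =>
    intro acc
    simpa [Data.ofList] using ih (f e :: acc)

theorem PT.map_reverse {l : Fn} {F : Fn₂} (hl : PT l) (hF : PT fun O ω y => F O ω y.fst y.snd) :
    PT fun O ω x => Data.ofList ((l O ω x).toList.map (F O ω x)).reverse := by
  have := PT.foldl_additive (G := fun O ω x acc e => .pair (F O ω x e) acc) hl (PT.const (.num 0))
    ((hF.comp (PT.id.fst.pair PT.id.snd.snd)).pair PT.id.snd.fst) (by
      obtain ⟨q, hq⟩ := hF.size_le
      refine ⟨q.comp (Polynomial.X + 1) + 1, fun b O hO ω x acc e => ?_⟩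
      have := hq b O hO ω (.pair x e)
      simp only [Data.fst_pair, Data.snd_pair, Data.size] at this ⊢
      simp only [Polynomial.eval_add, Polynomial.eval_comp, Polynomial.eval_X, Polynomial.eval_one]
      rw [show x.size + e.size + b + 1 = x.size + e.size + 1 + b by ring]
      omega)
  convert this using 4 with O ω x
  simpa [Data.ofList] using (foldl_pair_eq (F O ω x) (l O ω x).toList []).symm

theorem PT.map {l : Fn} {F : Fn₂} (hl : PT l) (hF : PT fun O ω y => F O ω y.fst y.snd) :
    PT fun O ω x => Data.ofList ((l O ω x).toList.map (F O ω x)) := by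
  have := PT.map_reverse (F := fun _ _ _ e => e) (PT.map_reverse hl hF) PT.id.snd
  simpa [Function.comp_def] using this

theorem PT.append {l l' : Fn} (hl : PT l) (hl' : PT l') :
    PT fun O ω x => Data.ofList ((l O ω x).toList ++ (l' O ω x).toList) := by
  have h1 : PT fun O ω x => Data.ofList (l O ω x).toList.reverse := by
    simpa using PT.map_reverse (F := fun _ _ _ e => e) hl PT.id.snd
  have h2 : PT fun O ω x => Data.ofList (l' O ω x).toList := by
    simpa using PT.map (F := fun _ _ _ e => e) hl' PT.id.snd
  have := PT.foldl_additive (G := fun O ω x acc e => .pair e acc) h1 h2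
    (PT.id.snd.snd.pair PT.id.snd.fst) (by
      refine ⟨Polynomial.X + 1, fun b O hO ω x acc e => ?_⟩
      simp only [Data.size, Polynomial.eval_add, Polynomial.eval_X, Polynomial.eval_one]
      omega)
  convert this using 4 with O ω x
  simpa using (foldl_pair_eq (fun e => e) (l O ω x).toList.reverse (l' O ω x).toList).symm

theorem PT.flatMap {l : Fn} {F : Fn₂} (hl : PT l) (hF : PT fun O ω y => F O ω y.fst y.snd) :
    PT fun O ω x => Data.ofList ((l O ω x).toList.flatMap fun e => (F O ω x e).toList) := by
  have := PT.foldl_additive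
    (G := fun O ω x acc e => Data.ofList (acc.toList ++ (F O ω x e).toList)) hl (PT.const (.num 0))
    (PT.append PT.id.snd.fst (hF.comp (PT.id.fst.pair PT.id.snd.snd))) (by
      obtain ⟨q, hq⟩ := hF.size_le
      refine ⟨q.comp (Polynomial.X + 1), fun b O hO ω x acc e => ?_⟩
      have h1 := hq b O hO ω (.pair x e)
      have h2 := Data.size_ofList_append acc.toList (F O ω x e).toList
      have h3 := acc.size_ofList_toList
      have h4 := (F O ω x e).size_ofList_toList
      simp only [Data.fst_pair, Data.snd_pair, Data.size] at h1
      simp only [Polynomial.eval_add, Polynomial.eval_comp, Polynomial.eval_X, Polynomial.eval_one]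
      rw [show x.size + e.size + b + 1 = x.size + e.size + 1 + b by ring]
      omega)
  convert this using 4 with O ω x
  have key : ∀ (l acc : List Data), l.foldl
      (fun acc e => Data.ofList (acc.toList ++ (F O ω x e).toList)) (Data.ofList acc)
        = Data.ofList (acc ++ l.flatMap fun e => (F O ω x e).toList) := by
    intro l
    induction l with
    | nil => simp
    | cons e l ih => intro acc; simp [ih]
  simpa [Data.ofList] using (key (l O ω x).toList []).symm

theorem PT.filter {l : Fn} {p : Oracles → Tape → Data → Data → Prop}
    {dec : ∀ O ω x e, Decidable (p O ω x e)} (hl : PT l)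
    (hp : PT fun O ω y => bit (p O ω y.fst y.snd)) :
    PT fun O ω x => Data.ofList ((l O ω x).toList.filter fun e => decide (p O ω x e)) := by
  -- A filter replaces each entry by a list with one or no element.
  have := PT.flatMap (F := fun O ω x e => if p O ω x e then .pair e (.num 0) else .num 0) hl
    (PT.ite (dec := fun O ω y => dec O ω y.fst y.snd) hp (PT.id.snd.pair (PT.const _))
      (PT.const _))
  convert this using 5 with O ω x
  induction (l O ω x).toList with
  | nil => rfl
  | cons e l ih =>
    by_cases h : p O ω x e <;> simp [h, ih, Data.toList]

/-- Optional values as data. -/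
def Data.ofOption : Option Data → Data
  | none => .num 0
  | some e => .pair (.num 1) e

theorem PT.find {l : Fn} {p : Oracles → Tape → Data → Data → Prop}
    {dec : ∀ O ω x e, Decidable (p O ω x e)} (hl : PT l)
    (hp : PT fun O ω y => bit (p O ω y.fst y.snd)) :
    PT fun O ω x => Data.ofOption ((l O ω x).toList.find? fun e => decide (p O ω x e)) := by
  have h := PT.filter (dec := dec) hl hp
  have := PT.ite (dec := fun _ _ _ => Classical.propDecidable _) h.isPair
    ((PT.const (.num 1)).pair h.fst) (PT.const (.num 0))
  convert this using 4 with O ω x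
  rw [← List.head?_filter]
  cases List.filter (fun e => decide (p O ω x e)) (l O ω x).toList <;>
    simp [Data.ofOption, Data.ofList]

theorem Nat.size_le_self' (n : ℕ) : Nat.size n ≤ n := by
  rw [Nat.size_le]; exact Nat.lt_two_pow_self

theorem PT.length {l : Fn} (hl : PT l) : PT fun O ω x => Data.num (l O ω x).toList.length := by
  have := PT.foldl_additive (G := fun O ω x acc e => .num (acc.toNat + (Data.num 1).toNat)) hl
    (PT.const (.num 0)) (PT.id.snd.fst.add (PT.const (.num 1))) (by
      refine ⟨3, fun b O hO ω x acc e => ?_⟩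
      have h1 := Data.size_num_add_le acc.toNat 1
      have h2 := acc.size_toNat_le
      simp [Data.size] at h1 ⊢; omega)
  convert this using 4 with O ω x
  have key : ∀ (l : List Data) (n : ℕ), l.foldl
      (fun acc _ => Data.num (acc.toNat + (Data.num 1).toNat)) (.num n) = .num (n + l.length) := by
    intro l
    induction l with
    | nil => simp
    | cons e l ih => intro n; rw [List.foldl_cons, ih]; simp; omega
  rw [key]; simp

theorem PT.nth {l i : Fn} (hl : PT l) (hi : PT i) :
    PT fun O ω x => (l O ω x).toList.getD (i O ω x).toNat (.num 0) := by
  -- The accumulator holds the current position and the entry found so far. The added zeros turn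
  -- arbitrary data into numbers, so that equality of data becomes equality of positions.
  let G : Fn₃ := fun O ω x acc e => .pair (.num (acc.fst.toNat + (Data.num 1).toNat))
    (if Data.num (acc.fst.toNat + (Data.num 0).toNat)
      = Data.num ((i O ω x).toNat + (Data.num 0).toNat) then e else acc.snd)
  have key : ∀ O ω x (l : List Data), l.foldl (G O ω x) (.pair (.num 0) (.num 0))
      = .pair (.num l.length) (l.getD (i O ω x).toNat (.num 0)) := by
    intro O ω x l
    induction l using List.reverseRecOn with
    | nil => simp
    | append_singleton l e ih =>
      simp only [List.foldl_append, ih, List.foldl_cons, List.foldl_nil, G]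
      simp only [Data.fst_pair, Data.toNat_num, List.length_append, List.length_singleton,
        Data.snd_pair, add_zero, Data.num.injEq]
      split_ifs with h
      · simp [← h]
      · rcases lt_or_gt_of_ne h with h | h
        · simp only [List.getD_eq_getElem?_getD]
          have h1 : l[(i O ω x).toNat]? = none := List.getElem?_eq_none (by omega)
          have h2 : (l ++ [e])[(i O ω x).toNat]? = none := List.getElem?_eq_none (by
            rw [List.length_append, List.length_singleton]; omega)
          rw [h1, h2]
        · simp only [List.getD_eq_getElem?_getD]
          rw [List.getElem?_append_left h]
  have := PT.foldl_of_bound (G := G) hl (PT.const (.pair (.num 0) (.num 0))) (by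
      refine (PT.id.snd.fst.fst.add (PT.const (.num 1))).pair
        (PT.ite (PT.eq (PT.id.snd.fst.fst.add (PT.const (.num 0)))
          ((hi.comp PT.id.fst).add (PT.const (.num 0)))) PT.id.snd.snd PT.id.snd.fst.snd)) (by
      obtain ⟨q, hq⟩ := hl.size_le
      refine ⟨2 * q + 10, fun b O hO ω x l' hl' => ?_⟩
      rw [key O ω x]
      have h1 := hq b O hO ω x
      have h2 : l'.length ≤ (l O ω x).size :=
        hl'.length_le.trans (Data.length_toList_le _)
      have h3 := Nat.size_le_self' l'.length
      have h4 : (l'.getD (i O ω x).toNat (.num 0)).size ≤ (l O ω x).size := by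
        rw [List.getD_eq_getElem?_getD]
        rcases h : l'[(i O ω x).toNat]? with _ | e
        · simpa [Data.size] using (l O ω x).one_le_size
        · exact Data.size_le_of_mem (hl'.subset (List.mem_of_getElem? h))
      simp [Data.size] at *
      omega)
  have := this.snd
  simpa only [key, Data.snd_pair] using this

theorem PT.range {l : Fn} (hl : PT l) :
    PT fun O ω x => Data.ofList ((List.range (l O ω x).toList.length).map Data.num) := by
  -- A counter and the list of its earlier values, in descending order; a final reversal puts them
  -- in order.
  let G : Fn₃ := fun O ω x acc e => .pair (.num (acc.fst.toNat + (Data.num 1).toNat))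
    (.pair acc.fst acc.snd)
  have key : ∀ O ω x (l : List Data), l.foldl (G O ω x) (.pair (.num 0) (.num 0))
      = .pair (.num l.length) (.ofList ((List.range l.length).map Data.num).reverse) := by
    intro O ω x l
    induction l using List.reverseRecOn with
    | nil => simp [Data.ofList]
    | append_singleton l e ih =>
      simp only [List.foldl_append, ih, List.foldl_cons, List.foldl_nil, G]
      simp [List.range_succ, Data.ofList]
  have h := PT.foldl_of_bound (G := G) hl (PT.const (.pair (.num 0) (.num 0)))
      ((PT.id.snd.fst.fst.add (PT.const (.num 1))).pair (PT.id.snd.fst.fst.pair PT.id.snd.fst.snd)) (by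
      obtain ⟨q, hq⟩ := hl.size_le
      refine ⟨q * (q + 2) + q + 10, fun b O hO ω x l' hl' => ?_⟩
      rw [key O ω x]
      have h1 := hq b O hO ω x
      have h2 : l'.length ≤ q.eval (x.size + b) :=
        (hl'.length_le.trans (Data.length_toList_le _)).trans h1
      have h3 := Nat.size_le_self' l'.length
      have h4 : (((List.range l'.length).map Data.num).reverse.map fun e => e.size + 1).sum
          ≤ l'.length * (q.eval (x.size + b) + 2) := by
        refine (List.sum_le_card_nsmul _ (q.eval (x.size + b) + 2) ?_).trans (by simp)
        intro n hn
        simp only [List.mem_map, List.mem_reverse, List.mem_range] at hn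
        obtain ⟨_, ⟨a, ha, rfl⟩, rfl⟩ := hn
        have := Nat.size_le_self' a
        simp only [Data.size]; omega
      have h5 := Nat.mul_le_mul_right (q.eval (x.size + b) + 2) h2
      simp only [Data.size, Data.size_ofList, Polynomial.eval_add, Polynomial.eval_mul,
        Polynomial.eval_ofNat]
      omega)
  have := PT.map_reverse (F := fun _ _ _ e => e) h.snd PT.id.snd
  simpa only [key, Data.snd_pair, Data.toList_ofList, List.map_id', List.reverse_reverse] using this

end FuzzyPSI

namespace FuzzyPSI

/-! ### Independent parts of the random tape -/

/-- Two tapes as one: the first one is found at the addresses `pair (num 0) a`. -/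
def glue (ω₁ ω₂ : Tape) : Tape
  | (k, .pair (.num 0) a) => ω₁ (k, a)
  | c => ω₂ c

/-- The part of a tape at the addresses `pair (num 0) a`. -/
def leftTape (ω : Tape) : Tape := fun c => ω (c.1, .pair (.num 0) c.2)

theorem leftTape_glue (ω₁ ω₂ : Tape) : leftTape (glue ω₁ ω₂) = ω₁ := rfl

/-- The address lies in the second part of a glued tape. -/
def IsRight (c : ℕ × Data) : Prop := ∀ a, c.2 ≠ .pair (.num 0) a

theorem glue_of_isRight {c : ℕ × Data} (h : IsRight c) (ω₁ ω₂ : Tape) : glue ω₁ ω₂ c = ω₂ c := by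
  unfold glue
  split
  · rename_i k a
    exact absurd rfl (h a)
  · rfl

theorem measurable_glue : Measurable fun p : Tape × Tape => glue p.1 p.2 := by
  refine measurable_pi_lambda _ fun c => ?_
  by_cases h : IsRight c
  · simp only [glue_of_isRight h]
    exact (measurable_pi_apply c).comp measurable_snd
  · obtain ⟨k, a⟩ := c
    simp only [IsRight, ne_eq, not_forall, not_not] at h
    obtain ⟨a', rfl⟩ := h
    exact (measurable_pi_apply (k, a')).comp measurable_fst

/-- The addresses split into the image of `emb` and the right part, so a cylinder pulls back to a
rectangle. The product of its two measures is the product over all constrained cells, and this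
characterizes the infinite product measure. -/
theorem map_glue : (tapeMeasure.prod tapeMeasure).map (fun p => glue p.1 p.2) = tapeMeasure := by
  classical
  have := Measure.isProbabilityMeasure_map (μ := tapeMeasure.prod tapeMeasure)
    measurable_glue.aemeasurable
  refine Measure.eq_infinitePi _ fun S t ht => ?_
  rw [Measure.map_apply measurable_glue (by
    exact MeasurableSet.pi S.countable_toSet fun i _ => ht i)]
  let emb : ℕ × Data ↪ ℕ × Data := ⟨fun c => (c.1, .pair (.num 0) c.2), fun a b h => by
    simp only [Prod.mk.injEq, Data.pair.injEq, true_and] at h; exact Prod.ext h.1 h.2⟩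
  let S₁ : Finset (ℕ × Data) := S.preimage emb emb.injective.injOn
  let S₂ : Finset (ℕ × Data) := S.filter IsRight
  have hS : S = S₁.map emb ∪ S₂ := by
    ext c
    simp only [Finset.mem_union, Finset.mem_map, S₁, S₂, Finset.mem_filter, Finset.mem_preimage]
    constructor
    · intro hc
      by_cases h : IsRight c
      · exact .inr ⟨hc, h⟩
      · simp only [IsRight, ne_eq, not_forall, not_not] at h
        obtain ⟨a, ha⟩ := h
        have : emb (c.1, a) = c := Prod.ext rfl ha.symm
        exact .inl ⟨(c.1, a), by rwa [this], this⟩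
    · rintro (⟨a, ha, rfl⟩ | h)
      · exact ha
      · exact h.1
  have hdisj : Disjoint (S₁.map emb) S₂ := by
    rw [Finset.disjoint_left]
    intro c hc hc'
    obtain ⟨a, -, rfl⟩ := Finset.mem_map.1 hc
    exact (Finset.mem_filter.1 hc').2 a.2 rfl
  have hpre : (fun p : Tape × Tape => glue p.1 p.2) ⁻¹' Set.pi S t =
      Set.pi S₁ (fun c => t (emb c)) ×ˢ Set.pi S₂ t := by
    ext ⟨ω₁, ω₂⟩
    simp only [Set.mem_preimage, Set.mem_pi, Set.mem_prod, Finset.mem_coe]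
    constructor
    · intro h
      refine ⟨fun c hc => h (emb c) (Finset.mem_preimage.1 hc), fun c hc => ?_⟩
      have h1 := h c (Finset.mem_filter.1 hc).1
      rwa [glue_of_isRight (Finset.mem_filter.1 hc).2] at h1
    · rintro ⟨h1, h2⟩ c hc
      rw [hS, Finset.mem_union] at hc
      rcases hc with hc | hc
      · obtain ⟨a, ha, rfl⟩ := Finset.mem_map.1 hc
        exact h1 a ha
      · rw [glue_of_isRight (Finset.mem_filter.1 hc).2]
        exact h2 c hc
  rw [hpre, Measure.prod_prod]
  unfold tapeMeasure
  rw [Measure.infinitePi_pi (s := S₁) (t := fun c => t (emb c)) _ (fun i _ => ht (emb i)),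
    Measure.infinitePi_pi _ (fun i _ => ht _)]
  conv_rhs => rw [hS, Finset.prod_union hdisj, Finset.prod_map]
  rfl

/-- Fubini: the coins of a hosted program and those of its environment can be averaged one after the
other. -/
theorem lintegral_tape_glue {A : Set Tape} (hA : MeasurableSet A) :
    tapeMeasure A = ∫⁻ ω₂, tapeMeasure {ω₁ | glue ω₁ ω₂ ∈ A} ∂tapeMeasure := by
  conv_lhs => rw [← map_glue]
  rw [Measure.map_apply measurable_glue hA, Measure.prod_apply_symm (measurable_glue hA)]
  rfl

/-- Finitely many different cells of the tape are independent and uniformly distributed. -/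
theorem map_cells {ι : Type} [Fintype ι] (cell : ι → ℕ × Data) (hcell : Function.Injective cell)
    {V : ι → Type} [∀ i, Fintype (V i)] [Fintype (∀ i, V i)] (e : ∀ i, V i ≃ Fin ((cell i).1 + 1)) (v : ∀ i, V i) :
    tapeMeasure {ω | (fun i => (e i).symm (ω (cell i))) = v} = (Fintype.card (∀ i, V i) : ℝ≥0∞)⁻¹ := by
  classical
  let S : Finset (ℕ × Data) := Finset.univ.map ⟨cell, hcell⟩
  -- The value required at address `c`, transported along `cell i = c`. Injectivity of `cell` makes
  -- this set a singleton at each used address.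
  let t : (c : ℕ × Data) → Set (Fin (c.1 + 1)) := fun c => {x | ∀ i (h : cell i = c), h ▸ e i (v i) = x}
  have hset : {ω : Tape | (fun i => (e i).symm (ω (cell i))) = v} = Set.pi S t := by
    ext ω
    simp only [Set.mem_ofPred_eq, Set.mem_pi, S, Finset.coe_map, Finset.coe_univ, Set.image_univ,
      Set.mem_range, t, forall_exists_index, Function.Embedding.coeFn_mk]
    constructor
    · rintro h c i rfl j hj
      obtain rfl := hcell hj
      rw [← congrFun h j, Equiv.apply_symm_apply]
    · intro h
      funext i
      rw [Equiv.symm_apply_eq]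
      exact (h _ i rfl i rfl).symm
  have htS : ∀ c, MeasurableSet (t c) := fun c => MeasurableSet.of_discrete
  have hcard : Fintype.card (∀ i, V i) = ∏ i, Fintype.card (V i) := by
    exact (@Fintype.card_congr _ _ _ Pi.instFintype (Equiv.refl _)).trans Fintype.card_pi
  rw [hset]
  unfold tapeMeasure
  rw [Measure.infinitePi_pi _ (fun i _ => htS _), Finset.prod_map, hcard, Nat.cast_prod,
    ENNReal.prod_inv_distrib (by simp [Set.Pairwise])]
  refine Finset.prod_congr rfl fun i _ => ?_
  have hti : t (cell i) = {e i (v i)} := by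
    ext x
    simp only [t, Set.mem_ofPred_eq, Set.mem_singleton_iff]
    constructor
    · intro h; exact (h i rfl).symm
    · rintro rfl j hj
      obtain rfl := hcell hj
      rfl
  simp only [Function.Embedding.coeFn_mk]
  rw [hti, PMF.toMeasure_apply_singleton _ _ (MeasurableSet.of_discrete), PMF.uniformOfFintype_apply,
    Fintype.card_congr (e i)]

/-- Pushing the tape measure forward to the finite type of outcomes turns the integral into a
uniform average. The instance on the function type is left arbitrary so that the lemma fits
whichever one a later statement carries. -/
theorem lintegral_cells {ι : Type} [Fintype ι] (cell : ι → ℕ × Data)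
    (hcell : Function.Injective cell) {V : ι → Type} [∀ i, Fintype (V i)] [Fintype (∀ i, V i)]
    (e : ∀ i, V i ≃ Fin ((cell i).1 + 1)) (f : (∀ i, V i) → ℝ≥0∞) :
    ∫⁻ ω, f (fun i => (e i).symm (ω (cell i))) ∂tapeMeasure =
      (∑ v, f v) * (Fintype.card (∀ i, V i) : ℝ≥0∞)⁻¹ := by
  classical
  let _ (i : ι) : MeasurableSpace (V i) := ⊤
  have (i : ι) : DiscreteMeasurableSpace (V i) := ⟨fun _ => trivial⟩
  have hm : Measurable fun ω : Tape => (fun i => (e i).symm (ω (cell i))) := by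
    refine measurable_to_countable' fun v => ?_
    have : (fun ω : Tape => (fun i => (e i).symm (ω (cell i)))) ⁻¹' {v} =
        ⋂ i, (fun ω : Tape => ω (cell i)) ⁻¹' {e i (v i)} := by
      ext ω
      simp [funext_iff, Equiv.symm_apply_eq]
    rw [this]
    exact MeasurableSet.iInter fun i => (measurable_pi_apply (cell i)) (MeasurableSet.of_discrete)
  rw [← lintegral_map (f := f) (Measurable.of_discrete) hm, lintegral_fintype, Finset.sum_mul]
  refine Finset.sum_congr rfl fun v _ => ?_
  rw [Measure.map_apply hm (MeasurableSet.of_discrete)]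
  congr 1
  exact map_cells cell hcell e v

open scoped BigOperators in
theorem lintegral_cells_toReal {ι : Type} [Fintype ι] (cell : ι → ℕ × Data)
    (hcell : Function.Injective cell) {V : ι → Type} [∀ i, Fintype (V i)] [Fintype (∀ i, V i)]
    (e : ∀ i, V i ≃ Fin ((cell i).1 + 1)) (f : (∀ i, V i) → ℝ≥0∞) (hf : ∀ v, f v ≤ 1) :
    (∫⁻ ω, f (fun i => (e i).symm (ω (cell i))) ∂tapeMeasure).toReal =
      𝔼 v, (f v).toReal := by
  rw [lintegral_cells cell hcell e f, ENNReal.toReal_mul, ENNReal.toReal_sum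
    (fun v _ => ((hf v).trans_lt ENNReal.one_lt_top).ne), Fintype.expect_eq_sum_div_card]
  simp [div_eq_mul_inv]

end FuzzyPSI

namespace FuzzyPSI

/-! ### Running a program with simulated oracles -/

/-- The program `D`, run next to an environment on inputs `pair env x`: oracle queries are answered
by the program `h`, and the random cells are those of the left part of the tape. -/
def host (h : Code) : Code → Code
  | .const v => .const v
  | .prim p => .seq (.prim .snd) (.prim p)
  | .rand => .seq (.pair (.seq (.prim .snd) (.prim .fst))
      (.pair (.const (.num 0)) (.seq (.prim .snd) (.prim .snd)))) .rand
  | .query => h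
  | .pair f g => .pair (host h f) (host h g)
  | .seq f g => .seq (.pair (.prim .fst) (host h f)) (host h g)
  | .branch c f g => .branch (host h c) (host h f) (host h g)
  | .loop c f => .seq (.loop (host h c) (.pair (.prim .fst) (host h f))) (.prim .snd)

/-- Each unit of time of `D` is paid for by `C` steps of the host, which cover the handling of the
pair with `env` and the answer to one query. The host of a loop carries `env` along and projects it
away only at the very end. The induction through `loop_step` therefore needs the second conclusion,
about the bare loop, whose slack pays for the final projection. -/
theorem Runs.hosted {O O' : Oracles} {ω : Tape} {h D : Code} {env x y : Data} {t T C : ℕ}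
    (hD : Runs O' (leftTape ω) D x y t)
    (hh : ∀ q : Data, q.size ≤ T →
      ∃ t, t ≤ C ∧ Runs O ω h (.pair env q) (O' q.fst.toNat q.snd) t)
    (hC : 20 * (env.size + T + 5) ≤ C) (ht : t ≤ T) :
    (∃ t', Runs O ω (host h D) (.pair env x) y t' ∧ t' ≤ t * C) ∧
      ∀ c f, D = .loop c f → ∃ t', Runs O ω
        (.loop (host h c) (.pair (.prim .fst) (host h f))) (.pair env x) (.pair env y) t' ∧
          t' + (2 * (env.size + T) + 10) ≤ t * C := by
  have hmul : ∀ n, 1 ≤ n → C ≤ n * C := fun n hn => by nlinarith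
  have hs := hD.size_input_le
  have hs' := hD.size_output_le
  induction hD with
  | const v x =>
    refine ⟨⟨_, .const v _, ?_⟩, by simp⟩
    have := hmul (1 + x.size + v.size) (by omega)
    simp only [Data.size]; omega
  | prim p x =>
    refine ⟨⟨_, .seq (.prim .snd _) (.prim p x), ?_⟩, by simp⟩
    have := hmul (1 + x.size + (p.apply x).size) (by omega)
    have e : Prim.snd.apply (.pair env x) = x := rfl
    simp only [Data.size, e]; omega
  | rand x =>
    refine ⟨⟨_, .seq (.pair (.seq (.prim .snd _) (.prim .fst _))
      (.pair (.const _ _) (.seq (.prim .snd _) (.prim .snd _)))) (.rand _), ?_⟩, by simp⟩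
    have h1 := x.size_fst_le
    have h2 := x.size_snd_le
    simp only [Data.size, Prim.apply, Data.snd_pair, Data.fst_pair, leftTape] at hs hs' ⊢
    simp only [Data.size, leftTape] at ht
    refine le_trans ?_ (hmul _ (by omega))
    simp only [Nat.size_zero]
    omega
  | query x =>
    obtain ⟨t, h1, h2⟩ := hh x (by omega)
    exact ⟨⟨t, h2, h1.trans (hmul _ (by omega))⟩, by simp⟩
  | pair f g h1 h2 =>
    rename_i t₁ t₂
    have f1 := f.size_input_le; have f2 := f.size_output_le
    have g1 := g.size_input_le; have g2 := g.size_output_le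
    obtain ⟨t₁', r₁, e₁⟩ := (h1 (by omega) f1 f2).1
    obtain ⟨t₂', r₂, e₂⟩ := (h2 (by omega) g1 g2).1
    refine ⟨⟨_, .pair r₁ r₂, ?_⟩, by simp⟩
    simp only [add_mul]; omega
  | seq f g h1 h2 =>
    have f1 := f.size_input_le; have f2 := f.size_output_le
    have g1 := g.size_input_le; have g2 := g.size_output_le
    obtain ⟨t₁', r₁, e₁⟩ := (h1 (by omega) f1 f2).1
    obtain ⟨t₂', r₂, e₂⟩ := (h2 (by omega) g1 g2).1
    refine ⟨⟨_, .seq (.pair (.prim .fst _) r₁) r₂, ?_⟩, by simp⟩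
    simp only [add_mul, Data.size, Prim.apply, Data.fst_pair]; omega
  | branch_true f hb g h1 h2 =>
    have f1 := f.size_input_le; have f2 := f.size_output_le
    have g1 := g.size_input_le; have g2 := g.size_output_le
    obtain ⟨t₁', r₁, e₁⟩ := (h1 (by omega) f1 f2).1
    obtain ⟨t₂', r₂, e₂⟩ := (h2 (by omega) g1 g2).1
    refine ⟨⟨_, .branch_true r₁ hb r₂, ?_⟩, by simp⟩
    simp only [add_mul]; omega
  | branch_false f g h1 h2 =>
    have f1 := f.size_input_le; have f2 := f.size_output_le
    have g1 := g.size_input_le; have g2 := g.size_output_le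
    obtain ⟨t₁', r₁, e₁⟩ := (h1 (by omega) f1 f2).1
    obtain ⟨t₂', r₂, e₂⟩ := (h2 (by omega) g1 g2).1
    refine ⟨⟨_, .branch_false r₁ r₂, ?_⟩, by simp⟩
    simp only [add_mul]; omega
  | loop_done f h1 =>
    have f1 := f.size_input_le; have f2 := f.size_output_le
    obtain ⟨t₁', r₁, e₁⟩ := (h1 (by omega) f1 f2).1
    refine ⟨⟨_, .seq (.loop_done r₁) (.prim .snd _), ?_⟩, ?_⟩
    · simp only [add_mul, Data.size, Prim.apply, Data.snd_pair]; omega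
    · intro c f h
      cases h
      refine ⟨_, .loop_done r₁, ?_⟩
      simp only [add_mul]; omega
  | loop_step f hb g k h1 h2 h3 =>
    have f1 := f.size_input_le; have f2 := f.size_output_le
    have g1 := g.size_input_le; have g2 := g.size_output_le
    have k1 := k.size_input_le; have k2 := k.size_output_le
    obtain ⟨t₁', r₁, e₁⟩ := (h1 (by omega) f1 f2).1
    obtain ⟨t₂', r₂, e₂⟩ := (h2 (by omega) g1 g2).1
    -- For the remaining rounds the bare loop is used, since its result still contains `env`.
    obtain ⟨t₃', r₃, e₃⟩ := (h3 (by omega) k1 k2).2 _ _ rfl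
    refine ⟨⟨_, .seq (.loop_step r₁ hb (.pair (.prim .fst _) r₂) r₃) (.prim .snd _), ?_⟩, ?_⟩
    · simp only [add_mul, Data.size, Prim.apply, Data.snd_pair, Data.fst_pair] at e₃ ⊢; omega
    · intro c f h
      cases h
      refine ⟨_, .loop_step r₁ hb (.pair (.prim .fst _) r₂) r₃, ?_⟩
      simp only [add_mul, Data.size, Prim.apply, Data.fst_pair] at e₃ ⊢; omega

/-- A randomized algorithm that answers oracle queries `(i, q)` on input `pair env (pair i q)`; its
answers are short, and it reads only cells in the right part of a glued tape. -/
structure IsHandler (h : Tape → Data → Data) : Prop where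
  pt : PT fun _ ω x => h ω x
  bound : ∃ r : Polynomial ℕ, ∀ ω env q, (h ω (.pair env q)).size ≤ r.eval env.size
  right : ∀ ω₁ ω₂ x, h (glue ω₁ ω₂) x = h ω₂ x

/-- The oracles provided by a handler. -/
def handlerOracles (h : Tape → Data → Data) (ω : Tape) (env : Data) : Oracles :=
  fun i q => h ω (.pair env (.pair (.num i) q))

/-- A distinguisher can be run by a polynomial-time program that prepares its input and answers its
oracle queries. -/
theorem exists_hosted {h : Tape → Data → Data} (hh : IsHandler h) {f : Fn} (hf : PT f) {D : Code}
    (hD : PolyTime D) : ∃ B : Code, PolyTime B ∧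
      ∀ O, (∃ b, ∀ i q, (O i q).size ≤ b) → ∀ ω x y, (∃ t, Runs O ω B x y t) ↔
        ∃ t, Runs (handlerOracles h ω (f O ω x).fst) (leftTape ω) D (f O ω x).snd y t := by
  -- The index of a query is normalized to a number, because the semantics of `query` only looks at
  -- its `toNat`.
  have hpt : PT fun _ ω z => h ω (.pair z.fst (.pair
      (.num (z.snd.fst.toNat + (Data.num 0).toNat)) z.snd.snd)) :=
    hh.pt.comp (PT.id.fst.pair ((PT.id.snd.fst.add (PT.const (.num 0))).pair PT.id.snd.snd))
  obtain ⟨c, ph, hc⟩ := hpt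
  obtain ⟨k, pk, hk⟩ := (hf.fst.pair hf.snd)
  obtain ⟨r, hr⟩ := hh.bound
  obtain ⟨p, hp⟩ := hD
  let T : Polynomial ℕ := p.comp (pk + r.comp pk)
  let C : Polynomial ℕ := ph.comp (pk + T + 1 + Polynomial.X) + 20 * (pk + T + 5)
  have main : ∀ b O, (∀ i q, (O i q).size ≤ b) → ∀ ω x, ∃ y t t',
      Runs (handlerOracles h ω (f O ω x).fst) (leftTape ω) D (f O ω x).snd y t ∧
      Runs O ω (.seq k (host c D)) x y t' ∧ t' ≤ (pk + T * C + 1).eval (x.size + b) := by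
    intro b O hO ω x
    obtain ⟨t₀, h1, h2⟩ := hk b O hO ω x
    have h3 := h1.size_output_le
    simp only [Data.size] at h3
    set env := (f O ω x).fst
    set x₀ := (f O ω x).snd
    set W := pk.eval (x.size + b) with hW
    -- The length of the handler's answers is bounded in terms of `env` alone, whatever the query.
    -- Hence the running time of `D` is bounded before any of its queries is known.
    obtain ⟨y, t, h4, h5⟩ := hp (r.eval env.size) (handlerOracles h ω env)
      (fun i q => hr ω env _) (leftTape ω) x₀
    have h6 := eval_mono r (show env.size ≤ W by omega)
    have h7 : t ≤ T.eval (x.size + b) := by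
      refine h5.trans ?_
      simp only [T, Polynomial.eval_comp, Polynomial.eval_add, ← hW]
      exact eval_mono p (by omega)
    obtain ⟨t', h8, h9⟩ := (h4.hosted (O := O) (h := c) (env := env) (T := T.eval (x.size + b))
      (C := C.eval (x.size + b)) (by
        intro q hq
        obtain ⟨t, e1, e2⟩ := hc b O hO ω (.pair env q)
        refine ⟨t, e2.trans ?_, ?_⟩
        · simp only [C, Polynomial.eval_comp, Polynomial.eval_add, Polynomial.eval_mul,
            Polynomial.eval_one, Polynomial.eval_X, Polynomial.eval_ofNat]
          refine (eval_mono ph ?_).trans (Nat.le_add_right _ _)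
          simp only [Data.size]; omega
        · simpa [handlerOracles] using e1) (by
        simp only [C, Polynomial.eval_comp, Polynomial.eval_add, Polynomial.eval_mul,
            Polynomial.eval_one, Polynomial.eval_X, Polynomial.eval_ofNat]
        omega) h7).1
    refine ⟨y, t, _, h4, .seq h1 h8, ?_⟩
    simp only [Polynomial.eval_add, Polynomial.eval_mul, Polynomial.eval_one]
    have := Nat.mul_le_mul_right (C.eval (x.size + b)) h7
    omega
  refine ⟨.seq k (host c D), ⟨pk + T * C + 1, fun b O hO ω x => ?_⟩, ?_⟩
  · obtain ⟨y, t, t', -, h1, h2⟩ := main b O hO ω x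
    exact ⟨y, t', h1, h2⟩
  · rintro O ⟨b, hO⟩ ω x y
    obtain ⟨y', t, t', h0, h1, -⟩ := main b O hO ω x
    constructor
    · rintro ⟨s, hs⟩
      obtain ⟨rfl, -⟩ := hs.deterministic h1
      exact ⟨t, h0⟩
    · rintro ⟨s, hs⟩
      obtain ⟨rfl, -⟩ := hs.deterministic h0
      exact ⟨t', h1⟩

/-- `D` uses the left part of the tape and the handler the right part only. So the two are
independent, and averaging over the left part with the handler's coins fixed gives the inner
acceptance probability. -/
theorem acceptProb_hosted {h : Tape → Data → Data} (hh : IsHandler h) {B D : Code} {O : Oracles}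
    {x env x₀ : Data}
    (hB : ∀ ω, (∃ t, Runs O ω B x (.num 1) t) ↔
      ∃ t, Runs (handlerOracles h ω env) (leftTape ω) D x₀ (.num 1) t) :
    acceptProb O B x = ∫⁻ ω, acceptProb (handlerOracles h ω env) D x₀ ∂tapeMeasure := by
  rw [acceptProb, lintegral_tape_glue (measurableSet_runs _ _ _ _)]
  refine lintegral_congr fun ω₂ => ?_
  rw [acceptProb]
  congr 1
  ext ω₁
  simp only [Set.mem_ofPred_eq]
  rw [hB]
  have : handlerOracles h (glue ω₁ ω₂) env = handlerOracles h ω₂ env := by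
    funext i q; exact hh.right _ _ _
  rw [this, leftTape_glue]

/-! ### The pseudorandom function in a hybrid argument -/

open scoped BigOperators in
theorem distProb_unif_map_toReal {α : Type} {_ : Fintype α} {_ : Nonempty α} (s : ℕ)
    (D : Code) (a : Data) (g : α → Observation) :
    (distProb s D a ((unif α).map g)).toReal =
      𝔼 x, (acceptProb (g x).oracles D (.pair (Data.unary s) (.pair a (g x).data))).toReal := by
  have h1 : distProb s D a ((unif α).map g) = ∑ x, unif α x *
      acceptProb (g x).oracles D (.pair (Data.unary s) (.pair a (g x).data)) := by
    unfold distProb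
    rw [← PMF.bind_pure_comp]
    simp only [PMF.bind_apply, ← ENNReal.tsum_mul_right]
    rw [ENNReal.tsum_comm, tsum_fintype]
    refine Finset.sum_congr rfl fun x _ => ?_
    rw [tsum_eq_single (g x)]
    · simp
    · intro v hv
      simp [hv]
  rw [h1, ENNReal.toReal_sum fun x _ => ENNReal.mul_ne_top (PMF.apply_ne_top _ _)
    ((acceptProb_le_one _ _ _).trans_lt ENNReal.one_lt_top).ne,
    Fintype.expect_eq_sum_div_card, Finset.sum_div]
  refine Finset.sum_congr rfl fun x _ => ?_
  simp [ENNReal.toReal_mul, div_eq_inv_mul]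

theorem encodeBy_injective {α : Type} {N : ℕ} (e : α ≃ Fin N) : Function.Injective (encodeBy e) := by
  intro a b h
  simp only [encodeBy, Data.num.injEq] at h
  exact e.injective (Fin.ext h)

theorem oracleOf_apply {X Y : Type} {encX : X → Data} (hX : Function.Injective encX)
    (encY : Y → Data) (f : X → Y) (x : X) : oracleOf encX encY f (encX x) = encY (f x) := by
  have h : ∃ x', encX x' = encX x := ⟨x, rfl⟩
  rw [oracleOf, dif_pos h, hX h.choose_spec]

theorem oracleOf_of_not {X Y : Type} {encX : X → Data} (encY : Y → Data) (f : X → Y) {q : Data}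
    (hq : ∀ x, encX x ≠ q) : oracleOf encX encY f q = .num 0 := by
  rw [oracleOf, dif_neg]; simpa using hq

/-- The acceptance probability of a distinguisher whose input and oracles are prepared from the data
`pre` and the identifiers `ids`. -/
noncomputable def preparedProb (h : Tape → Data → Data) (setup : Data → Data) (s : ℕ) (D : Code)
    (a pre ids : Data) : ℝ≥0∞ :=
  ∫⁻ ω, acceptProb (handlerOracles h ω (setup (.pair pre ids)).fst) D
    (.pair (Data.unary s) (.pair a (setup (.pair pre ids)).snd)) ∂tapeMeasure

theorem size_encodeBy_le {α : Type} {N : ℕ} (e : α ≃ Fin N) (a : α) :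
    (encodeBy e a).size ≤ Nat.size N + 1 := by
  have := Nat.size_le_size (e a).2.le
  simp only [encodeBy, Data.size]; omega

open scoped BigOperators in
-- The reduction receives `a`, `pre` and the points `G` as advice, asks its oracle for the values at
-- `G`, prepares input and environment from them, and hosts `D`. Since everything that depends on
-- the inputs is advice, one negligible function works for all of them.
theorem prf_hybrid {𝔽 K : ℕ → Type} [∀ s, Field (𝔽 s)] [∀ s, Fintype (𝔽 s)]
    [∀ s, AddCommGroup (K s)] [∀ s, Fintype (K s)] {eF : ∀ s, 𝔽 s ≃ Fin (Fintype.card (𝔽 s))}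
    {F : (s : ℕ) → K s → 𝔽 s → 𝔽 s} (hF : IsPRF 𝔽 eF K F) {h : Tape → Data → Data}
    (hh : IsHandler h) {setup : Data → Data} (hs : PT fun _ _ x => setup x) {D : Code}
    (hD : PolyTime D) (p : Polynomial ℕ) : ∃ ε : ℕ → ℝ, Negligible ε ∧
      ∀ (s : ℕ) [Fintype (𝔽 s → 𝔽 s)] (a pre : Data) (n : ℕ) (G : Fin n → 𝔽 s),
        a.size ≤ p.eval s → pre.size ≤ p.eval s →
        (Data.ofFamily (encodeBy (eF s)) G).size ≤ p.eval s →
        |𝔼 k : K s, (preparedProb h setup s D a pre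
            (Data.ofFamily (encodeBy (eF s)) fun i => F s k (G i))).toReal
          - 𝔼 f : 𝔽 s → 𝔽 s, (preparedProb h setup s D a pre
            (Data.ofFamily (encodeBy (eF s)) fun i => f (G i))).toReal| ≤ ε s := by
  let prep : Fn := fun O ω x => setup (.pair x.snd.fst.snd.fst
    (Data.ofList (x.snd.fst.snd.snd.toList.map fun g => O 0 g)))
  have hprep : PT prep := hs.comp (PT.id.snd.fst.snd.fst.pair
    (PT.map (F := fun O _ _ g => O 0 g) PT.id.snd.fst.snd.snd (PT.query PT.id.snd)))
  have hf : PT fun O ω x => .pair (prep O ω x).fst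
      (.pair x.fst (.pair x.snd.fst.fst (prep O ω x).snd)) :=
    hprep.fst.pair (PT.id.fst.pair (PT.id.snd.fst.fst.pair hprep.snd))
  obtain ⟨B, hB, hB'⟩ := exists_hosted hh hf hD
  -- The advice consists of three parts of size at most `p` and two pair nodes.
  obtain ⟨ε, hε, hε'⟩ := hF B hB (3 * p + 2)
  refine ⟨ε, hε, fun s inst a pre n G ha hpre hG => ?_⟩
  have key : ∀ φ : 𝔽 s → 𝔽 s, acceptProb
      (oneOracle (oracleOf (encodeBy (eF s)) (encodeBy (eF s)) φ)) B
      (.pair (Data.unary s) (.pair (.pair a (.pair pre (Data.ofFamily (encodeBy (eF s)) G)))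
        (.num 0))) = preparedProb h setup s D a pre
            (Data.ofFamily (encodeBy (eF s)) fun i => φ (G i)) := by
    intro φ
    unfold preparedProb
    refine acceptProb_hosted hh fun ω => ?_
    rw [hB' _ ⟨Nat.size (Fintype.card (𝔽 s)) + 1, fun i q => ?_⟩]
    · simp only [prep, Data.fst_pair, Data.snd_pair, Data.ofFamily, Data.toList_ofList,
        List.map_ofFn, Function.comp_def]
      simp only [oneOracle, if_true, oracleOf_apply (encodeBy_injective (eF s))]
    · unfold oneOracle
      split_ifs
      · unfold oracleOf
        split_ifs
        · exact size_encodeBy_le _ _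
        · simp [Data.size]
      · simp [Data.size]
  have h1 := hε' s (.pair a (.pair pre (Data.ofFamily (encodeBy (eF s)) G))) (by
    simp [Data.size]; omega)
  rw [distProb_unif_map_toReal, distProb_unif_map_toReal] at h1
  simp only [key] at h1
  convert h1

end FuzzyPSI

namespace FuzzyPSI

open scoped Classical BigOperators

/-! ### The local mapping -/

section LocalMap

variable {P : Params}

theorem mem_interval {x : Fin P.u} {y : Coord P} : y ∈ interval P x ↔ |(y : ℤ) - (x : ℤ)| ≤ P.δ := by
  simp [interval]

theorem toCoord_mem_interval {x z : Fin P.u} :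
    toCoord P x ∈ interval P z ↔ |(x : ℤ) - (z : ℤ)| ≤ P.δ := by
  rw [mem_interval]; rfl

theorem toCoord_self_mem (x : Fin P.u) : toCoord P x ∈ interval P x := by
  simp [toCoord_mem_interval]

/-- `insertInterval` for labels of an arbitrary type. -/
noncomputable def insertLabel {α : Type} (U : Finset (Coord P)) (r : α)
    (L : List (Finset (Coord P) × α)) : List (Finset (Coord P) × α) :=
  ((L.filter fun e => decide (¬ Disjoint U e.1)).foldl (fun V e => V ∪ e.1) U, r) ::
    L.filter fun e => decide (Disjoint U e.1)

theorem mem_foldl_union {α : Type} (L : List (Finset (Coord P) × α)) (U : Finset (Coord P))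
    (y : Coord P) : y ∈ L.foldl (fun V e => V ∪ e.1) U ↔ y ∈ U ∨ ∃ e ∈ L, y ∈ e.1 := by
  induction L generalizing U with
  | nil => simp
  | cons e L ih => simp [ih, or_assoc]

/-- Merging looks at the intervals only, so it commutes with any relabelling of the values. -/
theorem insertLabel_map {α β : Type} (f : α → β) (U : Finset (Coord P)) (r : α)
    (L : List (Finset (Coord P) × α)) :
    insertLabel U (f r) (L.map fun e => (e.1, f e.2)) =
      (insertLabel U r L).map fun e => (e.1, f e.2) := by
  simp [insertLabel, List.filter_map, List.foldl_map, Function.comp_def]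

/-- The merged intervals, labelled by the indices of the items. -/
noncomputable def labelled {a : ℕ} (x : Fin a → Fin P.u) (l : List (Fin a)) :
    List (Finset (Coord P) × Fin a) :=
  l.foldl (fun L j => insertLabel (interval P (x j)) j L) []

/-- The random values can be replaced by the indices of the items that drew them. The combinatorics
of merging then becomes deterministic, and the dependence on `r` is explicit. -/
theorem intervals_eq_map {𝔽 : Type} [Field 𝔽] [Fintype 𝔽] {a : ℕ} (x : Fin a → Fin P.u)
    (r : Fin a → 𝔽) :
    intervals x r = (labelled x (List.finRange a)).map fun e => (e.1, r e.2) := by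
  have key : ∀ (l : List (Fin a)) (L : List (Finset (Coord P) × Fin a)),
      l.foldl (fun L j => insertInterval (interval P (x j)) (r j) L) (L.map fun e => (e.1, r e.2)) =
        (l.foldl (fun L j => insertLabel (interval P (x j)) j L) L).map fun e => (e.1, r e.2) := by
    intro l
    induction l with
    | nil => simp
    | cons j l ih =>
      intro L
      rw [List.foldl_cons, List.foldl_cons, ← ih, ← insertLabel_map]
      rfl
  exact key _ []

/-- The interval of item `j` is disjoint from those of all other items. -/
def Isolated {a : ℕ} (x : Fin a → Fin P.u) (j : Fin a) : Prop :=
  ∀ i, i ≠ j → Disjoint (interval P (x j)) (interval P (x i))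

/-- Properties of the list of merged intervals. -/
structure LabelInv {a : ℕ} (x : Fin a → Fin P.u) (l : List (Fin a))
    (L : List (Finset (Coord P) × Fin a)) : Prop where
  disjoint : L.Pairwise fun e e' => Disjoint e.1 e'.1
  label : ∀ e ∈ L, interval P (x e.2) ⊆ e.1
  cover : ∀ j ∈ l, ∃ e ∈ L, interval P (x j) ⊆ e.1
  isolated : ∀ j, Isolated x j → ∀ e ∈ L, e.1 = interval P (x j) ∨ Disjoint e.1 (interval P (x j))

theorem labelInv_insert {a : ℕ} {x : Fin a → Fin P.u} {l : List (Fin a)}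
    {L : List (Finset (Coord P) × Fin a)} (h : LabelInv x l L) (j : Fin a) :
    LabelInv x (l ++ [j]) (insertLabel (interval P (x j)) j L) := by
  set U := interval P (x j) with hU
  have hmem := fun y => mem_foldl_union (L.filter fun e => decide (¬ Disjoint U e.1)) U y
  refine ⟨?_, ?_, ?_, ?_⟩
  · refine List.pairwise_cons.2 ⟨?_, h.disjoint.filter _⟩
    intro e he
    simp only [List.mem_filter, decide_eq_true_eq] at he
    rw [Finset.disjoint_left]
    intro y hy hye
    rw [hmem] at hy
    rcases hy with hy | ⟨e', he', hy⟩
    · exact Finset.disjoint_left.1 he.2 hy hye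
    · simp only [List.mem_filter, decide_eq_true_eq] at he'
      -- One of the two old entries meets `U` and the other does not, so they are different and
      -- hence disjoint by the invariant.
      have hne : e' ≠ e := by rintro rfl; exact he'.2 he.2
      have : Std.Symm fun e e' : Finset (Coord P) × Fin a => Disjoint e.1 e'.1 :=
        ⟨fun _ _ h => h.symm⟩
      have := h.disjoint.forall he'.1 he.1 hne
      exact Finset.disjoint_left.1 this hy hye
  · intro e he
    rcases List.mem_cons.1 he with rfl | he
    · intro y hy
      exact (hmem y).2 (.inl hy)
    · exact h.label e (List.mem_filter.1 he).1
  · intro i hi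
    rcases List.mem_append.1 hi with hi | hi
    · obtain ⟨e, he, hie⟩ := h.cover i hi
      by_cases hd : Disjoint U e.1
      · exact ⟨e, List.mem_cons_of_mem _ (List.mem_filter.2 ⟨he, by simpa using hd⟩), hie⟩
      · refine ⟨_, List.mem_cons_self, fun y hy => (hmem y).2 (.inr ⟨e, ?_, hie hy⟩)⟩
        exact List.mem_filter.2 ⟨he, by simpa using hd⟩
    · obtain rfl : i = j := by simpa using hi
      exact ⟨_, List.mem_cons_self, fun y hy => (hmem y).2 (.inl hy)⟩
  -- An isolated interval never takes part in a proper merger: when it is inserted itself, an old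
  -- entry that meets it can only be equal to it; when another item is inserted, neither that item
  -- nor any entry merged with it meets it.
  · intro i hi e he
    rcases List.mem_cons.1 he with rfl | he
    · by_cases hij : i = j
      · subst hij
        left
        ext y
        rw [hmem]
        constructor
        · rintro (hy | ⟨e, he, hy⟩)
          · exact hy
          · simp only [List.mem_filter, decide_eq_true_eq] at he
            rcases h.isolated i hi e he.1 with h' | h'
            · rwa [h'] at hy
            · exact absurd h'.symm he.2
        · exact .inl
      · right
        rw [Finset.disjoint_left]
        intro y hy hyi
        rw [hmem] at hy
        have hUi : Disjoint (interval P (x i)) U := hi j (Ne.symm hij)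
        rcases hy with hy | ⟨e, he, hy⟩
        · exact Finset.disjoint_left.1 hUi hyi hy
        · simp only [List.mem_filter, decide_eq_true_eq] at he
          rcases h.isolated i hi e he.1 with h' | h'
          · rw [h'] at he; exact he.2 hUi.symm
          · exact Finset.disjoint_left.1 h' hy hyi
    · exact h.isolated i hi e (List.mem_filter.1 he).1

theorem labelInv_labelled {a : ℕ} (x : Fin a → Fin P.u) (l : List (Fin a)) :
    LabelInv x l (labelled x l) := by
  induction l using List.reverseRecOn with
  | nil => exact ⟨by simp [labelled], by simp [labelled], by simp, by simp [labelled]⟩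
  | append_singleton l j ih =>
    have := labelInv_insert ih j
    simpa [labelled] using this

/-- The label of the merged interval that contains `y`. -/
noncomputable def labelAt {a : ℕ} (x : Fin a → Fin P.u) (y : Coord P) : Option (Fin a) :=
  ((labelled x (List.finRange a)).find? fun e => decide (y ∈ e.1)).map Prod.snd

theorem find_of_mem {α : Type} {L : List (Finset (Coord P) × α)}
    (hL : L.Pairwise fun e e' => Disjoint e.1 e'.1) {e : Finset (Coord P) × α} (he : e ∈ L)
    {y : Coord P} (hy : y ∈ e.1) : L.find? (fun e => decide (y ∈ e.1)) = some e := by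
  induction L with
  | nil => simp at he
  | cons e' L ih =>
    rw [List.pairwise_cons] at hL
    rcases List.mem_cons.1 he with rfl | he
    · simp [hy]
    · have : y ∉ e'.1 := fun h => Finset.disjoint_left.1 (hL.1 e he) h hy
      simpa [this] using ih hL.2 he

/-- Merging only enlarges intervals, so the full interval of an item ends up inside a single entry.
This is why every coordinate within `δ` of the item sees the same value as the item itself. -/
theorem exists_labelAt {a : ℕ} (x : Fin a → Fin P.u) (j : Fin a) :
    ∃ i, ∀ y ∈ interval P (x j), labelAt x y = some i := by
  have h := labelInv_labelled x (List.finRange a)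
  obtain ⟨e, he, hj⟩ := h.cover j (List.mem_finRange j)
  refine ⟨e.2, fun y hy => ?_⟩
  rw [labelAt, find_of_mem h.disjoint he (hj hy)]
  rfl

/-- The entry around an isolated item is exactly its own interval. A label of another item would put
that item's interval inside it, against isolation. -/
theorem labelAt_isolated {a : ℕ} {x : Fin a → Fin P.u} {j : Fin a} (hj : Isolated x j) :
    labelAt x (toCoord P (x j)) = some j := by
  have h := labelInv_labelled x (List.finRange a)
  obtain ⟨e, he, hje⟩ := h.cover j (List.mem_finRange j)
  have hy := toCoord_self_mem (x j)
  rw [labelAt, find_of_mem h.disjoint he (hje hy)]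
  simp only [Option.map_some, Option.some.injEq]
  by_contra hne
  rcases h.isolated j hj e he with h' | h'
  · have h1 := h.label e he
    rw [h'] at h1
    have := toCoord_self_mem (x e.2)
    exact Finset.disjoint_left.1 (hj e.2 hne) (h1 this) this
  · exact Finset.disjoint_left.1 h' (hje hy) hy

/-- Together with `labelAt_isolated`: in an isolated dimension the value drawn for an item enters
the local identifier of that item and of no other. -/
theorem labelAt_ne_isolated {a : ℕ} {x : Fin a → Fin P.u} {j i : Fin a} (hj : Isolated x j)
    (hij : i ≠ j) : labelAt x (toCoord P (x i)) ≠ some j := by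
  intro hl
  have h := labelInv_labelled x (List.finRange a)
  rw [labelAt, Option.map_eq_some_iff] at hl
  obtain ⟨e, hfind, rfl⟩ := hl
  have he := List.mem_of_find?_eq_some hfind
  have hy := List.find?_some hfind
  simp only [decide_eq_true_eq] at hy
  have hy' := toCoord_self_mem (x i)
  have h1 := h.label e he
  rcases h.isolated e.2 hj e he with h' | h'
  · rw [h'] at hy
    exact Finset.disjoint_left.1 (hj i hij) hy hy'
  · exact Finset.disjoint_left.1 h' (h1 (toCoord_self_mem _)) (toCoord_self_mem _)

/-- Disjointness of the integer intervals implies disjointness of their truncations to `Coord P`. -/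
theorem exists_isolated {a : ℕ} {x : Fin a → Point P} (hx : DisjointProjection x) (i : Fin a) :
    ∃ k, Isolated (fun j => x j k) i := by
  obtain ⟨k, hk⟩ := hx i
  refine ⟨k, fun j hj => Finset.disjoint_left.2 fun y hy hy' => ?_⟩
  have hy := abs_le.1 (mem_interval.1 hy)
  have hy' := abs_le.1 (mem_interval.1 hy')
  have h := Set.disjoint_left.1 (hk j hj)
  exact h (show (y : ℤ) ∈ Set.Icc _ _ from ⟨by linarith, by linarith⟩) ⟨by linarith, by linarith⟩

theorem DisjointProjection.injective {a : ℕ} {x : Fin a → Point P} (hx : DisjointProjection x) :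
    Function.Injective x := by
  intro i j h
  by_contra hne
  obtain ⟨k, hk⟩ := exists_isolated hx i
  have : Disjoint (interval P (x i k)) (interval P (x j k)) := hk j (Ne.symm hne)
  rw [h] at this
  exact Finset.disjoint_left.1 this (toCoord_self_mem _) (toCoord_self_mem _)

theorem DisjointProjection.comp {a : ℕ} {x : Fin a → Point P} (hx : DisjointProjection x)
    (π : Equiv.Perm (Fin a)) : DisjointProjection fun j => x (π j) := by
  intro i
  obtain ⟨k, hk⟩ := hx (π i)
  exact ⟨k, fun j hj => hk (π j) (by simpa using hj)⟩

/-! ### Programmed functions, local identifiers and inputs of the PRF -/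

variable {𝔽 : Type} [Field 𝔽] [Fintype 𝔽]

theorem getD_map_eq_elim {α β γ : Type} (o : Option (α × β)) (f : β → γ) (c : γ) :
    ((o.map fun e => (e.1, f e.2)).map Prod.snd).getD c = (o.map Prod.snd).elim c f := by
  cases o <;> rfl

omit [Field 𝔽] [Fintype 𝔽] in
theorem program_eq {X : Type} [DecidableEq X] (L : List (X × 𝔽)) (ρ : X → 𝔽) (x : X) :
    program L ρ x = ((L.find? fun e => decide (e.1 = x)).map Prod.snd).getD (ρ x) := by
  unfold program
  congr 3
  funext e
  exact decide_eq_decide.2 Iff.rfl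

omit [Field 𝔽] [Fintype 𝔽] in
theorem program_of_mem {X : Type} {L : List (X × 𝔽)} {ρ : X → 𝔽} {x : X} {v : 𝔽}
    (h : ∀ e ∈ L, e.1 = x → e.2 = v) (hx : ∃ e ∈ L, e.1 = x) : program L ρ x = v := by
  unfold program
  rcases hf : L.find? (fun e => decide (e.1 = x)) with _ | e
  · obtain ⟨e, he, hex⟩ := hx
    simpa [hex] using List.find?_eq_none.1 hf e he
  · rw [hf]
    exact h e (List.mem_of_find?_eq_some hf) (by simpa using List.find?_some hf)

omit [Field 𝔽] [Fintype 𝔽] in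
theorem program_of_not_mem {X : Type} {L : List (X × 𝔽)} {ρ : X → 𝔽} {x : X}
    (h : ∀ e ∈ L, e.1 ≠ x) : program L ρ x = ρ x := by
  unfold program
  rw [List.find?_eq_none.2 (by simpa using h)]
  rfl

/-- Shows the local identifier as a sum of one entry of `r` per dimension, selected independently of
`r`. -/
theorem localPid_eq {a : ℕ} (x : Fin a → Point P) (r : Fin a → Fin P.d → 𝔽) (j : Fin a) :
    localPid x r j =
      ∑ k, (labelAt (fun i => x i k) (toCoord P (x j k))).elim 0 fun i => r i k := by
  unfold localPid
  refine Finset.sum_congr rfl fun k _ => ?_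
  rw [intervals_eq_map, labelAt, List.find?_map]
  rw [← getD_map_eq_elim]
  simp only [Option.map_map, Function.comp_def]

theorem findSome?_eq_single {α β : Type} {l : List α} {g : α → Option β} {a : α} (ha : a ∈ l)
    (h : ∀ b ∈ l, b ≠ a → g b = none) : l.findSome? g = g a := by
  induction l with
  | nil => simp at ha
  | cons b l ih =>
    by_cases hb : b = a
    · subst hb
      rw [List.findSome?_cons]
      rcases hg : g b with _ | v
      · rw [List.findSome?_eq_none_iff]
        intro c hc
        by_cases hcb : c = b
        · rw [hcb, hg]
        · exact h c (by simp [hc]) hcb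
      · rfl
    · rw [List.findSome?_cons, h b (by simp) hb]
      exact ih (by simpa [Ne.symm hb] using ha) fun c hc => h c (by simp [hc])

omit [Field 𝔽] [Fintype 𝔽] in
-- A key contains its dimension, so the search only succeeds in the block of that dimension, and
-- there it stops at the first interval that contains the coordinate.
theorem localEntries_find_inl {a : ℕ} (x : Fin a → Point P) (r : Fin a → Fin P.d → 𝔽)
    (k : Fin P.d) (y : Coord P) :
    (localEntries x r).find? (fun e => decide (e.1 = Sum.inl (k, y))) =
      (((intervals (fun i => x i k) fun i => r i k).find? fun e => decide (y ∈ e.1)).map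
        fun e => (Sum.inl (k, y), e.2)) := by
  unfold localEntries
  rw [List.find?_flatMap, findSome?_eq_single (List.mem_finRange k)]
  · rw [List.find?_flatMap]
    induction intervals (fun i => x i k) fun i => r i k with
    | nil => rfl
    | cons e L ih =>
      rw [List.findSome?_cons]
      by_cases hy : y ∈ e.1
      · have : (List.find? (fun e : MapKey P a × 𝔽 => decide (e.1 = Sum.inl (k, y)))
            (List.map (fun y => ((Sum.inl (k, y) : MapKey P a), e.2)) e.1.toList)) =
            some (Sum.inl (k, y), e.2) := by
          rw [List.find?_map]
          simp only [Function.comp_def, Sum.inl.injEq, Prod.mk.injEq, true_and]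
          have : e.1.toList.find? (fun z => decide (z = y)) = some y := by
            rcases h : e.1.toList.find? (fun z => decide (z = y)) with _ | z
            · rw [List.find?_eq_none] at h
              simpa using h y (by simpa using hy)
            · have := List.find?_some h
              simp only [decide_eq_true_eq] at this
              rw [this]
          rw [this]; rfl
        rw [this]
        simp [hy]
      · have : (List.find? (fun e : MapKey P a × 𝔽 => decide (e.1 = Sum.inl (k, y)))
            (List.map (fun y => ((Sum.inl (k, y) : MapKey P a), e.2)) e.1.toList)) = none := by
          rw [List.find?_eq_none]
          simp only [List.mem_map, Finset.mem_toList, decide_eq_true_eq]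
          rintro _ ⟨z, hz, rfl⟩ h
          simp only [Sum.inl.injEq, Prod.mk.injEq, true_and] at h
          exact hy (h ▸ hz)
        rw [this, ih]
        simp [hy]
  · intro k' _ hk
    rw [List.find?_eq_none]
    simp only [List.mem_flatMap, List.mem_map, decide_eq_true_eq]
    rintro _ ⟨e, -, z, -, rfl⟩ h
    simp only [Sum.inl.injEq, Prod.mk.injEq] at h
    exact hk h.1

theorem program_localList_inl {a : ℕ} (x : Fin a → Point P) (r : Fin a → Fin P.d → 𝔽)
    (dummy : Fin (listSize P a) → 𝔽) (ρ : MapKey P a → 𝔽) (k : Fin P.d) (y : Coord P) :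
    program (localList x r dummy) ρ (Sum.inl (k, y)) =
      (labelAt (fun i => x i k) y).elim (ρ (Sum.inl (k, y))) fun i => r i k := by
  rw [program_eq]
  unfold localList
  rw [List.find?_append, localEntries_find_inl, intervals_eq_map, labelAt, List.find?_map]
  have h2 : (List.find? (fun e : MapKey P a × 𝔽 => decide (e.1 = Sum.inl (k, y)))
      (List.map (fun i => ((Sum.inr i : MapKey P a), dummy i))
        ((List.finRange (listSize P a)).filter
          fun i => decide ((localEntries x r).length ≤ i.val)))) = none := by
    rw [List.find?_eq_none]
    simp
  rw [h2]
  rw [Option.or_none, ← getD_map_eq_elim]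
  simp only [Option.map_map, Function.comp_def]

/-- Padding uses exactly the dummy keys whose index is at least the number of real entries; the
earlier ones remain unprogrammed. -/
theorem program_localList_inr {a : ℕ} (x : Fin a → Point P) (r : Fin a → Fin P.d → 𝔽)
    (dummy : Fin (listSize P a) → 𝔽) (ρ : MapKey P a → 𝔽) (i : Fin (listSize P a)) :
    program (localList x r dummy) ρ (Sum.inr i) =
      if (localEntries x r).length ≤ i.val then dummy i else ρ (Sum.inr i) := by
  rw [program_eq]
  unfold localList
  have h1 : (localEntries x r).find? (fun e => decide (e.1 = Sum.inr i)) = none := by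
    rw [List.find?_eq_none]
    simp only [localEntries, List.mem_flatMap, List.mem_map, decide_eq_true_eq]
    rintro _ ⟨k, -, e, -, z, -, rfl⟩ h
    simp at h
  rw [List.find?_append, h1, Option.none_or, List.find?_map]
  simp only [Function.comp_def, Sum.inr.injEq]
  split_ifs with h
  · have : ((List.finRange (listSize P a)).filter
        fun i => decide ((localEntries x r).length ≤ i.val)).find? (fun j => decide (j = i)) = some i := by
      rcases h' : ((List.finRange (listSize P a)).filter fun i =>
        decide ((localEntries x r).length ≤ i.val)).find? (fun j => decide (j = i)) with _ | z
      · rw [List.find?_eq_none] at h'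
        simpa using h' i (List.mem_filter.2 ⟨List.mem_finRange i, by simpa using h⟩)
      · have := List.find?_some h'
        simp only [decide_eq_true_eq] at this
        rw [h', this]
    rw [this]; rfl
  · have : ((List.finRange (listSize P a)).filter
        fun i => decide ((localEntries x r).length ≤ i.val)).find? (fun j => decide (j = i)) = none := by
      rw [List.find?_eq_none]
      rintro j hj hji
      simp only [List.mem_filter, decide_eq_true_eq] at hj hji
      exact h (hji ▸ hj.2)
    rw [this]; rfl

/-- All programmed values are zero, so repeated keys cannot conflict and no injectivity of the
identifiers is needed. -/
theorem program_filterList (w : Fin P.n → Point P) (ident : Fin P.n → 𝔽)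
    (ρ : FilterKey P 𝔽 → 𝔽) (c : 𝔽) (k : Fin P.d) (y : Coord P) :
    program (filterList w ident) ρ (c, k, y) =
      if ∃ i, ident i = c ∧ y ∈ interval P (w i k) then 0 else ρ (c, k, y) := by
  split_ifs with h
  · obtain ⟨i, hi, hy⟩ := h
    refine program_of_mem ?_ ⟨((c, k, y), 0), ?_, rfl⟩
    · simp only [filterList, List.mem_flatMap, List.mem_map]
      rintro _ ⟨i, -, k, -, y, -, rfl⟩ -
      rfl
    · simp only [filterList, List.mem_flatMap, List.mem_map]
      exact ⟨i, List.mem_finRange _, k, List.mem_finRange _, y, by simpa using hy, by rw [hi]⟩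
  · refine program_of_not_mem ?_
    simp only [filterList, List.mem_flatMap, List.mem_map]
    rintro _ ⟨i, -, k', -, y', hy', rfl⟩ h2
    simp only [Prod.mk.injEq] at h2
    obtain ⟨rfl, rfl, rfl⟩ := h2
    exact h ⟨i, rfl, by simpa using hy'⟩

/-- The argument of the pseudorandom function in the identifier of an item. -/
noncomputable def prfInput {a b : ℕ} (f : MapKey P b → 𝔽) (x : Fin a → Point P)
    (r : Fin a → Fin P.d → 𝔽) (i : Fin a) : 𝔽 :=
  (∑ k, f (Sum.inl (k, toCoord P (x i k)))) + localPid x r i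

theorem natAbs_le_of_distInf_le {q w : Point P} (h : distInf q w ≤ P.δ) (k : Fin P.d) :
    |(q k : ℤ) - (w k : ℤ)| ≤ P.δ := by
  have := (Finset.sup_le_iff.1 h) k (Finset.mem_univ k)
  rw [Int.abs_eq_natAbs]
  exact_mod_cast this

theorem sum_program_localList {a : ℕ} (x : Fin a → Point P) (r : Fin a → Fin P.d → 𝔽)
    (dummy : Fin (listSize P a) → 𝔽) (ρ : MapKey P a → 𝔽) (q : Point P) (i : Fin a)
    (h : ∀ k, |(q k : ℤ) - (x i k : ℤ)| ≤ P.δ) :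
    ∑ k, program (localList x r dummy) ρ (Sum.inl (k, toCoord P (q k))) = localPid x r i := by
  rw [localPid_eq]
  refine Finset.sum_congr rfl fun k _ => ?_
  obtain ⟨l, hl⟩ := exists_labelAt (fun j => x j k) i
  rw [program_localList_inl, hl _ (toCoord_mem_interval.2 (h k)), hl _ (toCoord_self_mem _)]
  rfl

/-- Close items of the two parties get the same identifier. -/
theorem prfInput_eq_of_close {a b : ℕ} (x : Fin a → Point P) (r : Fin a → Fin P.d → 𝔽)
    (dummy : Fin (listSize P a) → 𝔽) (ρ : MapKey P a → 𝔽) (x' : Fin b → Point P)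
    (r' : Fin b → Fin P.d → 𝔽) (dummy' : Fin (listSize P b) → 𝔽) (ρ' : MapKey P b → 𝔽)
    {i : Fin a} {j : Fin b} (h : distInf (x i) (x' j) ≤ P.δ) :
    prfInput (program (localList x' r' dummy') ρ') x r i =
      prfInput (program (localList x r dummy) ρ) x' r' j := by
  have h1 := natAbs_le_of_distInf_le h
  unfold prfInput
  -- Both sides become the sum of the two local identifiers, in opposite order.
  rw [sum_program_localList x' r' dummy' ρ' (x i) j h1,
    sum_program_localList x r dummy ρ (x' j) i (fun k => by rw [abs_sub_comm]; exact h1 k),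
    add_comm]

/-- Add `v` to the random value of item `j` in dimension `k`. -/
def shiftAt {a d : ℕ} (j : Fin a) (k : Fin d) (v : 𝔽) : (Fin a → Fin d → 𝔽) ≃ (Fin a → Fin d → 𝔽) where
  toFun r i l := if i = j ∧ l = k then r i l + v else r i l
  invFun r i l := if i = j ∧ l = k then r i l - v else r i l
  left_inv r := by funext i l; dsimp only; split_ifs <;> simp
  right_inv r := by funext i l; dsimp only; split_ifs <;> simp

/-- The shifted value occurs exactly once in the sum, namely in the isolated dimension `k`; the
programmed function `f` of the partner is untouched. -/
theorem prfInput_shift_self {a b : ℕ} (f : MapKey P b → 𝔽) {x : Fin a → Point P} {j : Fin a}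
    {k : Fin P.d} (hj : Isolated (fun i => x i k) j) (r : Fin a → Fin P.d → 𝔽) (v : 𝔽) :
    prfInput f x (shiftAt j k v r) j = prfInput f x r j + v := by
  unfold prfInput
  rw [add_assoc]
  congr 1
  rw [localPid_eq, localPid_eq, ← Finset.add_sum_erase _ _ (Finset.mem_univ k),
    ← Finset.add_sum_erase (a := k) _ (fun k => (labelAt (fun i => x i k) (toCoord P (x j k))).elim 0
      fun i => r i k) (Finset.mem_univ k), labelAt_isolated hj]
  have : ∀ l ∈ Finset.univ.erase k, (labelAt (fun i => x i l) (toCoord P (x j l))).elim 0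
      (fun i => shiftAt j k v r i l) =
      (labelAt (fun i => x i l) (toCoord P (x j l))).elim 0 fun i => r i l := by
    intro l hl
    have hl' := (Finset.mem_erase.1 hl).1
    simp [shiftAt, hl']
  rw [Finset.sum_congr rfl this]
  simp [shiftAt]
  ring

theorem prfInput_shift_ne {a b : ℕ} (f : MapKey P b → 𝔽) {x : Fin a → Point P} {j i : Fin a}
    {k : Fin P.d} (hj : Isolated (fun i => x i k) j) (hij : i ≠ j) (r : Fin a → Fin P.d → 𝔽)
    (v : 𝔽) : prfInput f x (shiftAt j k v r) i = prfInput f x r i := by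
  unfold prfInput
  congr 1
  rw [localPid_eq, localPid_eq]
  refine Finset.sum_congr rfl fun l _ => ?_
  by_cases hl : l = k
  · subst hl
    have h := labelAt_ne_isolated hj hij
    rcases hlab : labelAt (fun i => x i l) (toCoord P (x i l)) with _ | i'
    · rfl
    · have : i' ≠ j := by rintro rfl; exact h hlab
      simp [shiftAt, this]
  · simp [shiftAt, hl]

end LocalMap

/-! ### Probabilities of collisions -/

section Probability

/-- The probability of an event, for the uniform distribution. -/
noncomputable def prob {Ω : Type} [Fintype Ω] (E : Ω → Prop) : ℝ := 𝔼 ω, if E ω then (1 : ℝ) else 0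

variable {Ω : Type} [Fintype Ω]

theorem prob_mono {E E' : Ω → Prop} (h : ∀ ω, E ω → E' ω) : prob E ≤ prob E' := by
  refine Finset.expect_le_expect fun ω _ => ?_
  split_ifs with h1 h2
  · exact le_rfl
  · exact absurd (h _ h1) h2
  · exact zero_le_one
  · exact le_rfl

theorem prob_nonneg (E : Ω → Prop) : 0 ≤ prob E :=
  Finset.expect_nonneg fun ω _ => by split_ifs <;> simp

/-- Only the union bound is needed below: no independence between bad events is ever used. -/
theorem prob_or_le (E E' : Ω → Prop) : prob (fun ω => E ω ∨ E' ω) ≤ prob E + prob E' := by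
  unfold prob
  rw [← Finset.expect_add_distrib]
  refine Finset.expect_le_expect fun ω _ => ?_
  by_cases h : E ω <;> by_cases h' : E' ω <;> simp [h, h']

theorem prob_exists_le {ι : Type} [Fintype ι] (E : ι → Ω → Prop) :
    prob (fun ω => ∃ i, E i ω) ≤ ∑ i, prob (E i) := by
  unfold prob
  rw [← Finset.expect_sum_comm]
  refine Finset.expect_le_expect fun ω _ => ?_
  split_ifs with h
  · obtain ⟨i, hi⟩ := h
    have := Finset.single_le_sum (f := fun i => if E i ω then (1 : ℝ) else 0)
      (fun j _ => by split_ifs <;> simp) (Finset.mem_univ i)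
    simpa [hi] using this
  · exact Finset.sum_nonneg fun j _ => by split_ifs <;> simp

/-- A field-valued random variable that every shift of which has the same distribution is uniform. -/
theorem prob_eq_zero_of_shift {𝔽 : Type} [Field 𝔽] [Fintype 𝔽] [Nonempty Ω] (f : Ω → 𝔽)
    (T : 𝔽 → Ω ≃ Ω) (hT : ∀ v ω, f (T v ω) = f ω + v) :
    prob (fun ω => f ω = 0) = 1 / Fintype.card 𝔽 := by
  -- The shift by `v` is a bijection between two fibres of `f`. So all fibres have the same
  -- probability, and these sum to one.
  have h1 : ∀ v, prob (fun ω => f ω = v) = prob (fun ω => f ω = 0) := by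
    intro v
    unfold prob
    refine (Fintype.expect_equiv (T v) _ _ fun ω => ?_).symm
    simp [hT]
  have h2 : ∑ v : 𝔽, prob (fun ω => f ω = v) = 1 := by
    unfold prob
    rw [← Finset.expect_sum_comm]
    simp
  rw [Finset.sum_congr rfl fun v _ => h1 v] at h2
  simp only [Finset.sum_const, Finset.card_univ, nsmul_eq_mul] at h2
  have h3 : (Fintype.card 𝔽 : ℝ) ≠ 0 := by simp
  field_simp
  linarith

variable {P : Params} {𝔽 : Type} [Field 𝔽] [Fintype 𝔽]

/-- For `i ≠ j`, shifting the random value of `i` in its isolated dimension shifts the difference of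
the two inputs, which is therefore uniform. The union bound runs over all ordered pairs. -/
theorem prob_prfInput_not_injective_le {a b : ℕ} (f : MapKey P b → 𝔽) {x : Fin a → Point P}
    (hx : DisjointProjection x) :
    prob (fun r : Fin a → Fin P.d → 𝔽 => ¬ Function.Injective (prfInput f x r)) ≤
      (a : ℝ) ^ 2 * (1 / Fintype.card 𝔽) := by
  have h1 : ∀ i j : Fin a, prob (fun r : Fin a → Fin P.d → 𝔽 =>
      i ≠ j ∧ prfInput f x r i = prfInput f x r j) ≤ 1 / Fintype.card 𝔽 := by
    intro i j
    by_cases hij : i = j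
    · simp [hij, prob]
    · obtain ⟨k, hk⟩ := exists_isolated hx i
      rw [← prob_eq_zero_of_shift (fun r : Fin a → Fin P.d → 𝔽 => prfInput f x r i - prfInput f x r j)
        (shiftAt i k) (fun v r => by
          rw [prfInput_shift_self f hk, prfInput_shift_ne f hk (Ne.symm hij)]; ring)]
      exact prob_mono fun r h => sub_eq_zero.2 h.2
  calc _ ≤ prob (fun r : Fin a → Fin P.d → 𝔽 =>
        ∃ p : Fin a × Fin a, p.1 ≠ p.2 ∧ prfInput f x r p.1 = prfInput f x r p.2) := by
        refine prob_mono fun r h => ?_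
        simp only [Function.Injective, not_forall] at h
        obtain ⟨i, j, h1, h2⟩ := h
        exact ⟨(i, j), h2, h1⟩
    _ ≤ ∑ p : Fin a × Fin a, 1 / (Fintype.card 𝔽 : ℝ) :=
        (prob_exists_le _).trans (Finset.sum_le_sum fun p _ => h1 p.1 p.2)
    _ = _ := by simp; ring

/-- The same argument, with the value of the random function at the single point `G i` shifted. -/
theorem prob_random_function_not_injective_le {a : ℕ} {G : Fin a → 𝔽} (hG : Function.Injective G) :
    prob (fun f : 𝔽 → 𝔽 => ¬ Function.Injective fun i => f (G i)) ≤
      (a : ℝ) ^ 2 * (1 / Fintype.card 𝔽) := by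
  let T : 𝔽 → 𝔽 → (𝔽 → 𝔽) ≃ (𝔽 → 𝔽) := fun c v =>
    { toFun := fun f y => if y = c then f y + v else f y
      invFun := fun f y => if y = c then f y - v else f y
      left_inv := fun f => by funext y; dsimp only; split_ifs <;> simp
      right_inv := fun f => by funext y; dsimp only; split_ifs <;> simp }
  have h1 : ∀ i j : Fin a, prob (fun f : 𝔽 → 𝔽 => i ≠ j ∧ f (G i) = f (G j)) ≤
      1 / Fintype.card 𝔽 := by
    intro i j
    by_cases hij : i = j
    · simp [hij, prob]
    · rw [← prob_eq_zero_of_shift (fun f : 𝔽 → 𝔽 => f (G i) - f (G j)) (T (G i)) (fun v f => by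
          have : G j ≠ G i := fun h => hij (hG h).symm
          simp [T, this]; ring)]
      exact prob_mono fun r h => sub_eq_zero.2 h.2
  calc _ ≤ prob (fun f : 𝔽 → 𝔽 => ∃ p : Fin a × Fin a, p.1 ≠ p.2 ∧ f (G p.1) = f (G p.2)) := by
        refine prob_mono fun r h => ?_
        simp only [Function.Injective, not_forall] at h
        obtain ⟨i, j, h1, h2⟩ := h
        exact ⟨(i, j), h2, h1⟩
    _ ≤ ∑ p : Fin a × Fin a, 1 / (Fintype.card 𝔽 : ℝ) :=
        (prob_exists_le _).trans (Finset.sum_le_sum fun p _ => h1 p.1 p.2)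
    _ = _ := by simp; ring

/-- An item that is not close to any item of the receiver passes the equality test only with small
probability, if the identifiers of the receiver are different. -/
theorem prob_false_positive_le (w : Fin P.n → Point P) {idW : Fin P.n → 𝔽}
    (hid : Function.Injective idW) (c : 𝔽) (q : Point P) (hd : 0 < P.d)
    (hq : ∀ i, ¬ distInf q (w i) ≤ P.δ) :
    prob (fun ρ : FilterKey P 𝔽 → 𝔽 =>
      ∑ k, program (filterList w idW) ρ (c, k, toCoord P (q k)) = 0) ≤ 1 / Fintype.card 𝔽 := by
  -- An unprogrammed key among the queries. If `c` is the identifier of an item, injectivity makes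
  -- that item unique, and it misses `q` in some coordinate. Otherwise nothing is programmed under
  -- `c`, and any dimension will do; this is where `0 < d` enters.
  obtain ⟨k₀, hk₀⟩ : ∃ k₀, ¬ ∃ i, idW i = c ∧ toCoord P (q k₀) ∈ interval P (w i k₀) := by
    by_cases hc : ∃ i, idW i = c
    · obtain ⟨i, rfl⟩ := hc
      by_contra! h
      refine hq i (Finset.sup_le fun k _ => ?_)
      obtain ⟨i', hi', hk⟩ := h k
      rw [hid hi', toCoord_mem_interval, Int.abs_eq_natAbs] at hk
      exact_mod_cast hk
    · exact ⟨⟨0, hd⟩, fun ⟨i, hi, _⟩ => hc ⟨i, hi⟩⟩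
  -- Shifting the random function at this one key shifts the whole sum, because the other queries
  -- carry a different dimension.
  let y₀ : FilterKey P 𝔽 := (c, k₀, toCoord P (q k₀))
  let T : 𝔽 → (FilterKey P 𝔽 → 𝔽) ≃ (FilterKey P 𝔽 → 𝔽) := fun v =>
    { toFun := fun f y => if y = y₀ then f y + v else f y
      invFun := fun f y => if y = y₀ then f y - v else f y
      left_inv := fun f => by funext y; dsimp only; split_ifs <;> simp
      right_inv := fun f => by funext y; dsimp only; split_ifs <;> simp }
  refine (prob_eq_zero_of_shift _ T fun v ρ => ?_).le
  rw [← Finset.add_sum_erase _ _ (Finset.mem_univ k₀),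
    ← Finset.add_sum_erase _ (fun k => program (filterList w idW) ρ (c, k, toCoord P (q k)))
      (Finset.mem_univ k₀)]
  have : ∀ k ∈ Finset.univ.erase k₀,
      program (filterList w idW) (T v ρ) (c, k, toCoord P (q k)) =
        program (filterList w idW) ρ (c, k, toCoord P (q k)) := by
    intro k hk
    have hk' := (Finset.mem_erase.1 hk).1
    rw [program_filterList, program_filterList]
    simp [T, y₀, hk']
  rw [Finset.sum_congr rfl this, program_filterList, program_filterList, if_neg hk₀, if_neg hk₀]
  simp [T, y₀]
  ring

end Probability

end FuzzyPSI

namespace FuzzyPSI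

open scoped Classical BigOperators

/-! ### Uniform distributions and expectations -/

section Expect

/-- The laws for `get` and `set` say that `Ω` is a product with factor `X`, and `hH` says that `H`
does not otherwise depend on that factor. The exchange of the coordinate of `ω` with a fresh `x` is
an involution of `Ω × X`, so the coordinate may be replaced by an independent one. -/
theorem resample {Ω X : Type} [Fintype Ω] [Fintype X] [Nonempty X] (get : Ω → X) (set : X → Ω → Ω)
    (h1 : ∀ x ω, get (set x ω) = x) (h2 : ∀ ω, set (get ω) ω = ω)
    (h3 : ∀ x y ω, set x (set y ω) = set x ω) (H : Ω → X → ℝ)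
    (hH : ∀ x y ω, H (set x ω) y = H ω y) :
    𝔼 ω, H ω (get ω) = 𝔼 ω, 𝔼 x, H ω x := by
  have e : Function.Involutive fun p : Ω × X => (set p.2 p.1, get p.1) := by
    rintro ⟨ω, x⟩
    simp [h1, h2, h3]
  calc 𝔼 ω, H ω (get ω) = 𝔼 ω, 𝔼 _x : X, H ω (get ω) := by
        refine Finset.expect_congr rfl fun ω _ => ?_
        rw [Fintype.expect_const]
    _ = 𝔼 p : Ω × X, H p.1 (get p.1) := by
        rw [← Finset.univ_product_univ, Finset.expect_product]
    _ = 𝔼 p : Ω × X, H p.1 p.2 :=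
        Fintype.expect_equiv e.toPerm _ _ fun p => (hH _ _ _).symm
    _ = 𝔼 ω, 𝔼 x, H ω x := by
        rw [← Finset.univ_product_univ, Finset.expect_product]

theorem expect_get {Ω X : Type} [Fintype Ω] [Nonempty Ω] [Fintype X] [Nonempty X] (get : Ω → X)
    (set : X → Ω → Ω) (h1 : ∀ x ω, get (set x ω) = x) (h2 : ∀ ω, set (get ω) ω = ω)
    (h3 : ∀ x y ω, set x (set y ω) = set x ω) (f : X → ℝ) :
    𝔼 ω, f (get ω) = 𝔼 x, f x := by
  rw [resample get set h1 h2 h3 (fun _ x => f x) (fun _ _ _ => rfl), Fintype.expect_const]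

/-- The restriction of a uniform function to different points is a uniform vector. `Function.extend`
overwrites the function at these points. -/
theorem expect_comp_injective {n : ℕ} {𝔽 : Type} [Fintype 𝔽] [Nonempty 𝔽] {G : Fin n → 𝔽}
    (hG : Function.Injective G) (h : (Fin n → 𝔽) → ℝ) :
    𝔼 f : 𝔽 → 𝔽, h (fun i => f (G i)) = 𝔼 v, h v := by
  refine expect_get (fun (f : 𝔽 → 𝔽) i => f (G i)) (fun v f => Function.extend G v f) ?_ ?_ ?_ h
  · intro v f
    funext i
    exact hG.extend_apply v f i
  · intro f
    funext y
    by_cases hy : ∃ i, G i = y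
    · obtain ⟨i, rfl⟩ := hy
      rw [hG.extend_apply]
    · rw [Function.extend_apply' _ _ _ hy]
  · intro v w f
    funext y
    by_cases hy : ∃ i, G i = y
    · obtain ⟨i, rfl⟩ := hy
      rw [hG.extend_apply, hG.extend_apply]
    · rw [Function.extend_apply' _ _ _ hy, Function.extend_apply' _ _ _ hy,
        Function.extend_apply' _ _ _ hy]

theorem abs_expect_sub_le {Ω : Type} [Fintype Ω] [Nonempty Ω] (f g : Ω → ℝ) {ε : ℝ}
    (h : ∀ ω, |f ω - g ω| ≤ ε) : |𝔼 ω, f ω - 𝔼 ω, g ω| ≤ ε := by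
  rw [← Finset.expect_sub_distrib]
  refine (Finset.abs_expect_le _ _).trans ?_
  refine (Finset.expect_le_expect fun ω _ => h ω).trans ?_
  rw [Fintype.expect_const]

/-- Two games that agree outside a bad event differ at most by its probability. -/
theorem abs_expect_sub_le_prob {Ω : Type} [Fintype Ω] (f g : Ω → ℝ) (E : Ω → Prop)
    (hf : ∀ ω, 0 ≤ f ω ∧ f ω ≤ 1) (hg : ∀ ω, 0 ≤ g ω ∧ g ω ≤ 1)
    (h : ∀ ω, ¬ E ω → f ω = g ω) : |𝔼 ω, f ω - 𝔼 ω, g ω| ≤ prob E := by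
  rw [← Finset.expect_sub_distrib]
  refine (Finset.abs_expect_le _ _).trans (Finset.expect_le_expect fun ω _ => ?_)
  split_ifs with hE
  · rw [abs_le]
    have := hf ω; have := hg ω
    constructor <;> linarith
  · simp [h ω hE]

/-- A bound that holds for every value of the remaining coins also holds on average. -/
theorem prob_get {Ω X : Type} [Fintype Ω] [Nonempty Ω] [Fintype X] [Nonempty X] (get : Ω → X)
    (set : X → Ω → Ω) (h1 : ∀ x ω, get (set x ω) = x) (h2 : ∀ ω, set (get ω) ω = ω)
    (h3 : ∀ x y ω, set x (set y ω) = set x ω) (E : Ω → X → Prop)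
    (hE : ∀ x y ω, E (set x ω) y = E ω y) {c : ℝ} (hc : ∀ ω, prob (E ω) ≤ c) :
    prob (fun ω => E ω (get ω)) ≤ c := by
  unfold prob
  rw [resample get set h1 h2 h3 (fun ω x => if E ω x then (1 : ℝ) else 0)
    (fun x y ω => by simp only [hE])]
  refine (Finset.expect_le_expect fun ω _ => hc ω).trans ?_
  rw [Fintype.expect_const]

theorem unif_prod_bind {A B C : Type} {iA : Fintype A} {nA : Nonempty A} {iB : Fintype B}
    {nB : Nonempty B} (f : A → B → PMF C) :
    (unif A).bind (fun a => (unif B).bind (f a)) = (unif (A × B)).bind fun p => f p.1 p.2 := by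
  ext c
  simp only [PMF.bind_apply, PMF.uniformOfFintype_apply, tsum_fintype, Fintype.sum_prod_type,
    Fintype.card_prod, Nat.cast_mul]
  refine Finset.sum_congr rfl fun a _ => ?_
  rw [Finset.mul_sum]
  refine Finset.sum_congr rfl fun b _ => ?_
  rw [ENNReal.mul_inv (by simp) (by simp), mul_assoc]

theorem unif_bind_equiv {A B C : Type} {iA : Fintype A} {nA : Nonempty A} {iB : Fintype B}
    {nB : Nonempty B} (e : A ≃ B) (f : B → PMF C) :
    (unif A).bind (fun a => f (e a)) = (unif B).bind f := by
  ext c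
  simp only [PMF.bind_apply, PMF.uniformOfFintype_apply, tsum_fintype, Fintype.card_congr e]
  exact Fintype.sum_equiv e _ _ fun _ => rfl

theorem toOuterMeasure_unif_map {Ω α : Type} {iΩ : Fintype Ω} {nΩ : Nonempty Ω} (g : Ω → α)
    (S : Set α) : ((unif Ω).map g).toOuterMeasure S = ENNReal.ofReal (prob fun ω => g ω ∈ S) := by
  rw [PMF.toOuterMeasure_map_apply, PMF.toOuterMeasure_uniformOfFintype_apply, prob,
    Fintype.expect_eq_sum_div_card, ENNReal.ofReal_div_of_pos (by simp [Fintype.card_pos])]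
  simp [Fintype.card_subtype]

end Expect

/-! ### Executions of the protocol as functions of all random choices -/

/-- All random choices of an execution. -/
structure Coins (P : Params) (𝔽 K : Type) where
  order : Equiv.Perm (Fin P.m)
  rS : Fin P.m → Fin P.d → 𝔽
  dummyS : Fin (listSize P P.m) → 𝔽
  rR : Fin P.n → Fin P.d → 𝔽
  dummyR : Fin (listSize P P.n) → 𝔽
  keyS : K
  keyR : K
  fnS : MapKey P P.m → 𝔽
  yS : Fin P.n × Fin P.d → 𝔽
  fnR : MapKey P P.n → 𝔽
  yR : Fin P.m × Fin P.d → 𝔽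
  fnF : FilterKey P 𝔽 → 𝔽
  yF : Fin P.m × Fin P.d → 𝔽

section Coins

variable {P : Params} {𝔽 K : Type}

/-- The random choices as a tuple, in the order in which the protocol makes them. -/
def coinsEquiv : (Equiv.Perm (Fin P.m) × (Fin P.m → Fin P.d → 𝔽) × (Fin (listSize P P.m) → 𝔽) ×
    (Fin P.n → Fin P.d → 𝔽) × (Fin (listSize P P.n) → 𝔽) × K × K × (MapKey P P.m → 𝔽) ×
    (Fin P.n × Fin P.d → 𝔽) × (MapKey P P.n → 𝔽) × (Fin P.m × Fin P.d → 𝔽) ×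
    (FilterKey P 𝔽 → 𝔽) × (Fin P.m × Fin P.d → 𝔽)) ≃ Coins P 𝔽 K where
  toFun x := ⟨x.1, x.2.1, x.2.2.1, x.2.2.2.1, x.2.2.2.2.1, x.2.2.2.2.2.1, x.2.2.2.2.2.2.1,
    x.2.2.2.2.2.2.2.1, x.2.2.2.2.2.2.2.2.1, x.2.2.2.2.2.2.2.2.2.1, x.2.2.2.2.2.2.2.2.2.2.1,
    x.2.2.2.2.2.2.2.2.2.2.2.1, x.2.2.2.2.2.2.2.2.2.2.2.2⟩
  invFun c := (c.order, c.rS, c.dummyS, c.rR, c.dummyR, c.keyS, c.keyR, c.fnS, c.yS, c.fnR, c.yR,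
    c.fnF, c.yF)
  left_inv _ := rfl
  right_inv _ := rfl

variable [Field 𝔽] [Fintype 𝔽] [AddCommGroup K] [Fintype K]

set_option synthInstance.maxHeartbeats 400000
set_option synthInstance.maxSize 2000

noncomputable instance : Fintype (Coins P 𝔽 K) := Fintype.ofEquiv _ coinsEquiv

instance : Nonempty (Coins P 𝔽 K) := ⟨coinsEquiv (Classical.arbitrary _)⟩

variable (F : K → 𝔽 → 𝔽) (Q : Fin P.m → Point P) (W : Fin P.n → Point P) (c : Coins P 𝔽 K)

namespace Coins

/-- The sender's items in random order. -/
def q (j : Fin P.m) : Point P := Q (c.order j)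

noncomputable def progS : MapKey P P.m → 𝔽 := program (localList (c.q Q) c.rS c.dummyS) c.fnS

noncomputable def progR : MapKey P P.n → 𝔽 := program (localList W c.rR c.dummyR) c.fnR

noncomputable def inputW : Fin P.n → 𝔽 := prfInput (c.progS Q) W c.rR

noncomputable def inputQ : Fin P.m → 𝔽 := prfInput (c.progR W) (c.q Q) c.rS

noncomputable def identW (i : Fin P.n) : 𝔽 := F (c.keyS + c.keyR) (c.inputW Q W i)

noncomputable def identQ (j : Fin P.m) : 𝔽 := F (c.keyS + c.keyR) (c.inputQ Q W j)

noncomputable def progF : FilterKey P 𝔽 → 𝔽 := program (filterList W (c.identW F Q W)) c.fnF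

/-- The value of the filter function at the `k`-th query for item `j`. -/
noncomputable def filterValue (j : Fin P.m) (k : Fin P.d) : 𝔽 :=
  c.progF F Q W (c.identQ F Q W j, k, toCoord P (c.q Q j k))

noncomputable def bits (j : Fin P.m) : Bool := decide (∑ k, c.filterValue F Q W j k = 0)

noncomputable def senderView : SenderView P 𝔽 K where
  input := Q
  order := c.order
  fmap :=
    { r := c.rS, dummy := c.dummyS, key := c.keyS, partnerShare := fun i k => c.yS (i, k),
      fn := c.progS Q,
      ownShare := fun j k => c.progR W (Sum.inl (k, toCoord P (c.q Q j k))) - c.yR (j, k),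
      ident := c.identQ F Q W }
  share := fun j k => c.filterValue F Q W j k - c.yF (j, k)

noncomputable def receiverView : ReceiverView P 𝔽 K where
  input := W
  fmap :=
    { r := c.rR, dummy := c.dummyR, key := c.keyR, partnerShare := fun j k => c.yR (j, k),
      fn := c.progR W,
      ownShare := fun i k => c.progS Q (Sum.inl (k, toCoord P (W i k))) - c.yS (i, k),
      ident := c.identW F Q W }
  share := fun j k => c.yF (j, k)
  fn := c.progF F Q W
  bits := c.bits F Q W
  items := fun j => if c.bits F Q W j then some (c.q Q j) else none

noncomputable def exec : Execution P 𝔽 K where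
  sender := c.senderView F Q W
  receiver := c.receiverView F Q W
  output := Finset.univ.filter fun p => ∃ j, c.bits F Q W j = true ∧ c.q Q j = p

end Coins

/-- All draws can be made in advance, since none of their domains depends on earlier results. The
proof collects them in one tuple and checks that the additive masks cancel. -/
theorem fuzzyPSI_eq_map : fuzzyPSI P F Q W = (unif (Coins P 𝔽 K)).map (Coins.exec F Q W) := by
  rw [← PMF.bind_pure_comp]
  have hn := (coinsEquiv (P := P) (𝔽 := 𝔽) (K := K)).nonempty
  rw [← unif_bind_equiv coinsEquiv (nA := hn)]
  unfold fuzzyPSI fuzzyMapping soOPPRF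
  simp only [Bind.bind, PMF.bind_bind, PMF.pure_bind, Pure.pure]
  simp only [unif_prod_bind]
  congr 1
  funext x
  simp only [Function.comp]
  generalize hc : coinsEquiv x = c
  obtain ⟨x1, x2, x3, x4, x5, x6, x7, x8, x9, x10, x11, x12, x13⟩ := x
  subst hc
  simp only
  congr 1
  -- The shares `y` and `f - y` add up to the programmed value, so the masks disappear from the
  -- input of the PRF.
  have hW : siOPRF F x6 x7 (fun i => ∑ k, x9 (i, k)) (fun i => (∑ k, (program (localList (fun j => Q (x1 j)) x2 x3) x8
      (Sum.inl (k, toCoord P (W i k))) - x9 (i, k))) + localPid W x4 i) =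
      Coins.identW F Q W (coinsEquiv (x1, x2, x3, x4, x5, x6, x7, x8, x9, x10, x11, x12, x13)) := by
    funext i
    simp only [siOPRF, Coins.identW, Coins.inputW, prfInput, Coins.progS, coinsEquiv, Equiv.coe_fn_mk, Finset.sum_sub_distrib]
    congr 1
    unfold Coins.q
    ring
  have hQ : siOPRF F x7 x6 (fun j => ∑ k, x11 (j, k)) (fun j => (∑ k, (program (localList W x4 x5) x10
      (Sum.inl (k, toCoord P (Q (x1 j) k))) - x11 (j, k))) + localPid (fun j => Q (x1 j)) x2 j) =
      Coins.identQ F Q W (coinsEquiv (x1, x2, x3, x4, x5, x6, x7, x8, x9, x10, x11, x12, x13)) := by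
    funext i
    simp only [siOPRF, Coins.identQ, Coins.inputQ, prfInput, Coins.progR, coinsEquiv, Equiv.coe_fn_mk, Finset.sum_sub_distrib]
    -- In the second run the parties change roles, so the key shares are added in the other order.
    rw [add_comm x7 x6]
    congr 1
    unfold Coins.q
    ring
  rw [hW, hQ]
  -- The test compares `∑ (f - y)` with `-∑ y`, which are equal exactly if `∑ f = 0`.
  have hb : (peqt (fun j => ∑ k, (program (filterList W (Coins.identW F Q W (coinsEquiv (x1, x2, x3, x4, x5, x6, x7, x8, x9, x10, x11, x12, x13)))) x12
      (Coins.identQ F Q W (coinsEquiv (x1, x2, x3, x4, x5, x6, x7, x8, x9, x10, x11, x12, x13)) j, k, toCoord P (Q (x1 j) k)) - x13 (j, k))) (fun j => -∑ k, x13 (j, k)))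
      = Coins.bits F Q W (coinsEquiv (x1, x2, x3, x4, x5, x6, x7, x8, x9, x10, x11, x12, x13)) := by
    funext j
    simp only [peqt, Coins.bits, Finset.sum_sub_distrib]
    congr 1
    rw [sub_eq_neg_self]
    rfl
  rw [hb]
  unfold Coins.exec Coins.senderView Coins.receiverView
  congr 1
  congr 1
  funext p
  refine propext (exists_congr fun j => and_congr_right fun h => ?_)
  rw [ot, if_pos h, Option.some_inj]
  rfl

end Coins

end FuzzyPSI

namespace FuzzyPSI

open scoped Classical BigOperators

/-! ### Correctness of the protocol -/

section Correctness

variable {P : Params} {𝔽 K : Type} [Field 𝔽] [Fintype 𝔽] [AddCommGroup K] [Fintype K]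
  (F : K → 𝔽 → 𝔽) {Q : Fin P.m → Point P} {W : Fin P.n → Point P} (c : Coins P 𝔽 K)

/-- The `j`-th item of the sender is close to an item of the receiver. -/
def Coins.Close (Q : Fin P.m → Point P) (W : Fin P.n → Point P) (c : Coins P 𝔽 K) (j : Fin P.m) :
    Prop := ∃ i, distInf (c.q Q j) (W i) ≤ P.δ

omit [Field 𝔽] [Fintype 𝔽] [AddCommGroup K] [Fintype K] in
theorem Coins.mem_ideal_iff (j : Fin P.m) : c.q Q j ∈ idealFPSI Q W ↔ c.Close Q W j := by
  simp only [idealFPSI, Finset.mem_filter, Finset.mem_image, Finset.mem_univ, true_and]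
  exact and_iff_right ⟨_, rfl⟩

/-- Close items have the same identifier, so each of the queries meets a programmed zero. This holds
for all coins, hence there are no false negatives. -/
theorem Coins.bits_of_close {j : Fin P.m} (h : c.Close Q W j) : c.bits F Q W j = true := by
  obtain ⟨i, hi⟩ := h
  have hid : c.identW F Q W i = c.identQ F Q W j := by
    unfold Coins.identW Coins.identQ
    congr 1
    exact (prfInput_eq_of_close _ c.rS c.dummyS c.fnS W c.rR c.dummyR c.fnR hi).symm
  rw [Coins.bits, decide_eq_true_eq]
  refine Finset.sum_eq_zero fun k _ => ?_
  rw [Coins.filterValue, Coins.progF, program_filterList, if_pos]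
  exact ⟨i, hid, toCoord_mem_interval.2 (natAbs_le_of_distInf_le hi k)⟩

theorem Coins.ideal_subset_output : idealFPSI Q W ⊆ (c.exec F Q W).output := by
  intro p hp
  obtain ⟨hp, i, hi⟩ := Finset.mem_filter.1 hp
  obtain ⟨j, -, rfl⟩ := Finset.mem_image.1 hp
  have hj : c.q Q (c.order.symm j) = Q j := by simp [Coins.q]
  refine Finset.mem_filter.2 ⟨Finset.mem_univ _, c.order.symm j, c.bits_of_close F ⟨i, ?_⟩, hj⟩
  rwa [hj]

/-- Some item of the sender that is not close to any item of the receiver passes the test. -/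
def Coins.Bad (Q : Fin P.m → Point P) (W : Fin P.n → Point P) (c : Coins P 𝔽 K) : Prop :=
  ∃ j, ¬ c.Close Q W j ∧ c.bits F Q W j = true

variable {F} {c}

theorem Coins.bits_iff (h : ¬ c.Bad F Q W) (j : Fin P.m) :
    c.bits F Q W j = true ↔ c.q Q j ∈ idealFPSI Q W := by
  rw [c.mem_ideal_iff]
  refine ⟨fun hb => ?_, c.bits_of_close F⟩
  by_contra hj
  exact h ⟨j, hj, hb⟩

theorem Coins.output_eq (h : ¬ c.Bad F Q W) : (c.exec F Q W).output = idealFPSI Q W := by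
  refine Finset.Subset.antisymm (fun p hp => ?_) (c.ideal_subset_output F)
  obtain ⟨-, j, hj, rfl⟩ := Finset.mem_filter.1 hp
  exact (c.bits_iff h j).1 hj

variable (F)

/-- The identifiers do not depend on the random function `fnF` of the filter. So all other coins may
be fixed and `fnF` averaged first, followed by a union bound over the sender's items. -/
theorem prob_bad_le (hQ : DisjointProjection Q) :
    prob (fun c : Coins P 𝔽 K => Function.Injective (c.identW F Q W) ∧ c.Bad F Q W) ≤
      P.m * (1 / Fintype.card 𝔽) := by
  have h1 : ∀ j, prob (fun c : Coins P 𝔽 K => Function.Injective (c.identW F Q W) ∧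
      ¬ c.Close Q W j ∧ c.bits F Q W j = true) ≤ 1 / Fintype.card 𝔽 := by
    intro j
    -- The existence of an item and its separating dimension shows that `d` is positive.
    obtain ⟨k, -⟩ := hQ j
    refine prob_get (fun c : Coins P 𝔽 K => c.fnF) (fun f c => { c with fnF := f }) (fun _ _ => rfl)
      (fun _ => rfl) (fun _ _ _ => rfl) (fun c f => Function.Injective (c.identW F Q W) ∧
        ¬ c.Close Q W j ∧ ∑ k, program (filterList W (c.identW F Q W)) f
          (c.identQ F Q W j, k, toCoord P (c.q Q j k)) = 0) (fun _ _ _ => rfl) (fun c => ?_) |>.trans' ?_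
    · by_cases h : Function.Injective (c.identW F Q W) ∧ ¬ c.Close Q W j
      · refine (prob_mono fun f hf => hf.2.2).trans
          (prob_false_positive_le W h.1 _ _ (Fin.pos k) fun i hi => h.2 ⟨i, hi⟩)
      · refine (le_of_eq ?_).trans (by positivity : (0 : ℝ) ≤ _)
        simp only [← and_assoc, h, false_and, prob, if_false]
        exact Finset.expect_const_zero _
    · refine prob_mono fun c hc => ⟨hc.1, hc.2.1, ?_⟩
      exact of_decide_eq_true hc.2.2
  calc _ ≤ prob (fun c : Coins P 𝔽 K => ∃ j, Function.Injective (c.identW F Q W) ∧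
        ¬ c.Close Q W j ∧ c.bits F Q W j = true) :=
        prob_mono fun c ⟨hi, j, hj⟩ => ⟨j, hi, hj⟩
    _ ≤ _ := (prob_exists_le _).trans ((Finset.sum_le_sum fun j _ => h1 j).trans (by simp))

/-- The partner's programmed function does not involve `rS`, so `rS` can be averaged with the other
coins fixed. -/
theorem prob_inputQ_le (hQ : DisjointProjection Q) (W : Fin P.n → Point P) :
    prob (fun c : Coins P 𝔽 K => ¬ Function.Injective (c.inputQ Q W)) ≤
      (P.m : ℝ) ^ 2 * (1 / Fintype.card 𝔽) :=
  prob_get (fun c : Coins P 𝔽 K => c.rS) (fun r c => { c with rS := r }) (fun _ _ => rfl)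
    (fun _ => rfl) (fun _ _ _ => rfl)
    (fun c r => ¬ Function.Injective (prfInput (c.progR W) (c.q Q) r)) (fun _ _ _ => rfl)
    fun c => prob_prfInput_not_injective_le _ (hQ.comp c.order)

theorem prob_inputW_le (Q : Fin P.m → Point P) (hW : DisjointProjection W) :
    prob (fun c : Coins P 𝔽 K => ¬ Function.Injective (c.inputW Q W)) ≤
      (P.n : ℝ) ^ 2 * (1 / Fintype.card 𝔽) :=
  prob_get (fun c : Coins P 𝔽 K => c.rR) (fun r c => { c with rR := r }) (fun _ _ => rfl)
    (fun _ => rfl) (fun _ _ _ => rfl)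
    (fun c r => ¬ Function.Injective (prfInput (c.progS Q) W r)) (fun _ _ _ => rfl)
    fun _ => prob_prfInput_not_injective_le _ hW

theorem subset_of_mem_support (Q : Fin P.m → Point P) (W : Fin P.n → Point P) {e : Execution P 𝔽 K}
    (he : e ∈ (fuzzyPSI P F Q W).support) : idealFPSI Q W ⊆ e.output := by
  rw [fuzzyPSI_eq_map, PMF.support_map] at he
  obtain ⟨c, -, rfl⟩ := he
  exact c.ideal_subset_output F

theorem toOuterMeasure_wrong_output_le (hQ : DisjointProjection Q) (W : Fin P.n → Point P) :
    (fuzzyPSI P F Q W).toOuterMeasure {e | Function.Injective e.receiver.fmap.ident ∧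
      e.output ≠ idealFPSI Q W} ≤ (P.m : ℝ≥0∞) / (Fintype.card 𝔽 : ℝ≥0∞) := by
  rw [fuzzyPSI_eq_map, toOuterMeasure_unif_map]
  have h : prob (fun c : Coins P 𝔽 K => c.exec F Q W ∈ {e : Execution P 𝔽 K |
      Function.Injective e.receiver.fmap.ident ∧ e.output ≠ idealFPSI Q W}) ≤ _ :=
    (prob_mono fun c hc => ⟨hc.1, not_imp_comm.1 Coins.output_eq hc.2⟩).trans
      (prob_bad_le F (W := W) hQ)
  refine (ENNReal.ofReal_le_ofReal h).trans (le_of_eq ?_)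
  · rw [mul_one_div, ENNReal.ofReal_div_of_pos (by simp [Fintype.card_pos]), ENNReal.ofReal_natCast,
      ENNReal.ofReal_natCast]

end Correctness

end FuzzyPSI

namespace FuzzyPSI

open scoped Classical BigOperators

/-! ### Programs for lists of intervals -/

section Programs

/-- The `k`-th component of a list with a known number of entries. -/
def Data.item : ℕ → Data → Data
  | 0, x => x.fst
  | k + 1, x => x.snd.item k

@[simp] theorem Data.item_zero (a : Data) (l : List Data) : (Data.ofList (a :: l)).item 0 = a := rfl

@[simp] theorem Data.item_succ (k : ℕ) (a : Data) (l : List Data) :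
    (Data.ofList (a :: l)).item (k + 1) = (Data.ofList l).item k := rfl

theorem Data.size_item_le (k : ℕ) (x : Data) : (x.item k).size ≤ x.size := by
  induction k generalizing x with
  | zero => exact x.size_fst_le
  | succ k ih => exact (ih _).trans x.size_snd_le

theorem PT.item (k : ℕ) {f : Fn} (hf : PT f) : PT fun O ω x => (f O ω x).item k := by
  induction k generalizing f with
  | zero => exact hf.fst
  | succ k ih => exact ih hf.snd

/-- The `i`-th entry of a list. -/
def Data.nth (l : Data) (i : ℕ) : Data := l.toList.getD i (.num 0)

theorem PT.nth_toNat {l i : Fn} (hl : PT l) (hi : PT i) :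
    PT fun O ω x => (l O ω x).nth (i O ω x).toNat := PT.nth hl hi

theorem Data.nth_ofFamily {n : ℕ} {α : Type} (enc : α → Data) (f : Fin n → α) (i : Fin n) :
    (Data.ofFamily enc f).nth i = enc (f i) := by
  simp [Data.nth, Data.ofFamily]

theorem Data.size_nth_le (l : Data) (i : ℕ) : (l.nth i).size ≤ l.size := by
  unfold Data.nth
  rw [List.getD_eq_getElem?_getD]
  rcases h : l.toList[i]? with _ | e
  · simpa [Data.size] using l.one_le_size
  · exact Data.size_le_of_mem (List.mem_of_getElem? h)

theorem Data.length_ofFamily {n : ℕ} {α : Type} (enc : α → Data) (f : Fin n → α) :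
    (Data.ofFamily enc f).toList.length = n := by
  simp [Data.ofFamily]

theorem PT.num {f : Fn} (hf : PT f) : PT fun O ω x => .num (f O ω x).toNat := by
  simpa using hf.add (PT.const (.num 0))

theorem PT.min {f g : Fn} (hf : PT f) (hg : PT g) :
    PT fun O ω x => .num (min (f O ω x).toNat (g O ω x).toNat) := by
  convert PT.ite (dec := fun _ _ _ => Classical.propDecidable _) (hf.le hg) hf.num hg.num using 4
  split_ifs with h
  · rw [min_eq_left h]
  · rw [min_eq_right (le_of_not_ge h)]

theorem PT.max {f g : Fn} (hf : PT f) (hg : PT g) :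
    PT fun O ω x => .num (max (f O ω x).toNat (g O ω x).toNat) := by
  convert PT.ite (dec := fun _ _ _ => Classical.propDecidable _) (hf.le hg) hg.num hf.num using 4
  split_ifs with h
  · rw [max_eq_right h]
  · rw [max_eq_left (le_of_not_ge h)]

/-- Intervals are coded as `(lo, (hi, value))`. -/
def Data.Touches (lo hi : ℕ) (e : Data) : Prop := lo ≤ e.snd.fst.toNat ∧ e.fst.toNat ≤ hi

/-- Insert an interval into a list of intervals; all numbers are truncated to `U`. -/
noncomputable def Data.insertIv (U lo hi : ℕ) (r l : Data) : Data :=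
  .pair
    (.pair ((l.toList.filter fun e => decide (e.Touches lo hi)).foldl
        (fun acc e => .num (min acc.toNat e.fst.toNat)) (.num lo))
      (.pair (.num (min U ((l.toList.filter fun e => decide (e.Touches lo hi)).foldl
        (fun acc e => Data.num (max acc.toNat e.snd.fst.toNat)) (.num hi)).toNat)) r))
    (.ofList (l.toList.filter fun e => decide (¬ e.Touches lo hi)))

theorem PT.touches {f g h : Fn} (hf : PT f) (hg : PT g) (hh : PT h) :
    PT fun O ω x => bit ((h O ω x).Touches (f O ω x).toNat (g O ω x).toNat) :=
  (hf.le hh.snd.fst).and (hh.fst.le hg)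

theorem PT.insertIv {u f g r l : Fn} (hu : PT u) (hf : PT f) (hg : PT g) (hr : PT r) (hl : PT l) :
    PT fun O ω x => Data.insertIv (u O ω x).toNat (f O ω x).toNat (g O ω x).toNat (r O ω x)
      (l O ω x) := by
  have ht : PT fun O ω y => bit (y.snd.Touches (f O ω y.fst).toNat (g O ω y.fst).toNat) :=
    PT.touches (hf.comp PT.id.fst) (hg.comp PT.id.fst) PT.id.snd
  have hT := PT.filter (dec := fun _ _ _ _ => Classical.propDecidable _)
    (p := fun O ω x e => e.Touches (f O ω x).toNat (g O ω x).toNat) hl ht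
  have hN := PT.filter (dec := fun _ _ _ _ => instDecidableNot)
    (p := fun O ω x e => ¬ e.Touches (f O ω x).toNat (g O ω x).toNat) hl ht.not
  have h1 := PT.foldl_additive (G := fun _ _ _ acc e => .num (Min.min acc.toNat e.fst.toNat)) hT
    hf.num (PT.id.snd.fst.min PT.id.snd.snd.fst) (by
      refine ⟨Polynomial.X, fun b O hO ω x acc e => ?_⟩
      have h1 := Nat.size_le_size (min_le_left acc.toNat e.fst.toNat)
      have h2 := acc.size_toNat_le
      have h3 := x.one_le_size
      simp only [Data.size, Polynomial.eval_X]; omega)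
  have h2 := PT.foldl_additive (G := fun _ _ _ acc e => .num (Max.max acc.toNat e.snd.fst.toNat)) hT
    hg.num (PT.id.snd.fst.max PT.id.snd.snd.snd.fst) (by
      refine ⟨Polynomial.X, fun b O hO ω x acc e => ?_⟩
      have h2 := acc.size_toNat_le
      have h3 := x.one_le_size
      have h4 := e.snd.fst.size_toNat_le
      have h5 := e.snd.size_fst_le
      have h6 := e.size_snd_le
      simp only [Data.size, Polynomial.eval_X]
      rcases max_choice acc.toNat e.snd.fst.toNat with h | h <;> rw [h] <;> omega)
  simp only [Data.toList_ofList] at h1 h2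
  exact (h1.pair ((hu.min h2).pair hr)).pair hN

/-- Keeps the lower end of a merged interval below the lower end that was inserted, whatever the
list contains. -/
theorem Data.toNat_foldl_min_le (l : List Data) (a : Data) :
    (l.foldl (fun acc e => Data.num (min acc.toNat e.fst.toNat)) a).toNat ≤ a.toNat := by
  induction l generalizing a with
  | nil => simp
  | cons e l ih => exact (ih _).trans (by simp)

theorem Data.foldl_min_eq_num (l : List Data) (a : ℕ) :
    l.foldl (fun acc e => Data.num (min acc.toNat e.fst.toNat)) (.num a) =
      .num (l.foldl (fun acc e => Data.num (min acc.toNat e.fst.toNat)) (.num a)).toNat := by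
  induction l generalizing a with
  | nil => simp
  | cons e l ih => exact ih _

/-- The new lower end is at most `lo` and the new upper end is cut off at `U`. So an insertion adds
an amount that does not depend on the list, as iterated insertion in polynomial time requires. -/
theorem Data.size_insertIv_le (U lo hi : ℕ) (r l : Data) :
    (Data.insertIv U lo hi r l).size ≤ l.size + (Nat.size lo + Nat.size U + r.size + 5) := by
  unfold Data.insertIv
  rw [Data.foldl_min_eq_num]
  have h1 := Nat.size_le_size (Data.toNat_foldl_min_le
    (l.toList.filter fun e => decide (e.Touches lo hi)) (.num lo))
  have h2 := (Data.size_ofList_sublist (List.filter_sublist (l := l.toList)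
    (p := fun e => decide (¬ e.Touches lo hi)))).trans l.size_ofList_toList
  have h3 := Nat.size_le_size (min_le_left U ((l.toList.filter fun e =>
    decide (e.Touches lo hi)).foldl
        (fun acc e => Data.num (max acc.toNat e.snd.fst.toNat)) (.num hi)).toNat)
  simp only [Data.toNat_num] at h1
  simp only [Data.size]
  omega

/-- The intervals of one dimension `k`, for the table `x` of items, the table `r` of values, the
length `D` of an interval and the bound `U` for coordinates. -/
noncomputable def Data.column (D U : ℕ) (x r : Data) (k : ℕ) : Data :=
  ((List.range x.toList.length).map Data.num).foldl
    (fun acc j => Data.insertIv U ((x.nth j.toNat).nth k).toNat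
      (((x.nth j.toNat).nth k).toNat + D) ((r.nth j.toNat).nth k) acc) (.num 0)

theorem PT.column {D u x r k : Fn} (hD : PT D) (hu : PT u) (hx : PT x) (hr : PT r) (hk : PT k) :
    PT fun O ω y => Data.column (D O ω y).toNat (u O ω y).toNat (x O ω y) (r O ω y)
      (k O ω y).toNat := by
  have hlo : PT fun O ω z => ((x O ω z.fst).nth z.snd.snd.toNat).nth (k O ω z.fst).toNat :=
    ((hx.comp PT.id.fst).nth_toNat PT.id.snd.snd).nth_toNat (hk.comp PT.id.fst)
  have hv : PT fun O ω z => ((r O ω z.fst).nth z.snd.snd.toNat).nth (k O ω z.fst).toNat :=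
    ((hr.comp PT.id.fst).nth_toNat PT.id.snd.snd).nth_toNat (hk.comp PT.id.fst)
  have := PT.foldl_additive (G := fun O ω y acc j => Data.insertIv (u O ω y).toNat
      (((x O ω y).nth j.toNat).nth (k O ω y).toNat).toNat
      ((((x O ω y).nth j.toNat).nth (k O ω y).toNat).toNat + (D O ω y).toNat)
      (((r O ω y).nth j.toNat).nth (k O ω y).toNat) acc) hx.range (PT.const (.num 0))
    (PT.insertIv (hu.comp PT.id.fst) hlo (hlo.add (hD.comp PT.id.fst)) hv PT.id.snd.fst) (by
      obtain ⟨px, hpx⟩ := hx.size_le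
      obtain ⟨pr, hpr⟩ := hr.size_le
      obtain ⟨pu, hpu⟩ := hu.size_le
      refine ⟨(px + pr + pu + 5), fun b O hO ω y acc e => ?_⟩
      refine (Data.size_insertIv_le _ _ _ _ _).trans ?_
      have h1 := (hpx b O hO ω y)
      have h2 := (hpr b O hO ω y)
      have h3 := (hpu b O hO ω y)
      have h4 := ((x O ω y).nth e.toNat).size_nth_le (k O ω y).toNat
      have h5 := (x O ω y).size_nth_le e.toNat
      have h6 := ((r O ω y).nth e.toNat).size_nth_le (k O ω y).toNat
      have h7 := (r O ω y).size_nth_le e.toNat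
      have h8 := (((x O ω y).nth e.toNat).nth (k O ω y).toNat).size_toNat_le
      have h9 := (u O ω y).size_toNat_le
      have hm : y.size + b ≤ y.size + e.size + b := by omega
      have m1 := eval_mono px hm
      have m2 := eval_mono pr hm
      have m3 := eval_mono pu hm
      simp only [Polynomial.eval_add, Polynomial.eval_ofNat]
      omega)
  simp only [Data.toList_ofList] at this
  exact this

end Programs

end FuzzyPSI

namespace FuzzyPSI

open scoped Classical BigOperators

/-! ### Answering oracle queries -/

section Handler

theorem Data.isPair_ofOption {o : Option Data} : (∃ a b, Data.ofOption o = .pair a b) ↔ o.isSome := by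
  cases o <;> simp [Data.ofOption]

theorem PT.any {l : Fn} {p : Oracles → Tape → Data → Data → Prop} (hl : PT l)
    (hp : PT fun O ω y => bit (p O ω y.fst y.snd)) :
    PT fun O ω x => bit (∃ e ∈ (l O ω x).toList, p O ω x e) := by
  have := (PT.find (dec := fun _ _ _ _ => Classical.propDecidable _) hl hp).isPair
  convert this using 5 with O ω x
  rw [Data.isPair_ofOption, List.find?_isSome]
  simp

namespace Handler

/-- The length of an interval. -/
def width (env : Data) : Data := .num ((Data.num 2).toNat *
  (Data.num ((env.item 0).item 4).toList.length).toNat)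

/-- A strict bound for shifted coordinates. -/
def bound (env : Data) : Data := .num (((env.item 0).item 5).toNat + (width env).toNat)

/-- The intervals in all dimensions. -/
noncomputable def columns (env : Data) : Data :=
  .ofList (((List.range ((env.item 0).item 3).toList.length).map Data.num).map fun k =>
    Data.column (width env).toNat (bound env).toNat (env.item 1) (env.item 2) k.toNat)

/-- The number of points in the list of the local mapping. -/
noncomputable def count (env : Data) : Data :=
  ((columns env).toList.flatMap Data.toList).foldl
    (fun acc e => .num (acc.toNat + (e.snd.fst.toNat + 1 - e.fst.toNat))) (.num 0)

/-- The size of the padded list. -/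
def paddedSize (env : Data) : Data :=
  .num ((Data.num (env.item 1).toList.length).toNat *
    (Data.num ((Data.num ((env.item 0).item 3).toList.length).toNat *
      (Data.num ((width env).toNat + (Data.num 1).toNat)).toNat)).toNat)

/-- A random value for the query `q` to the function with the given tag. -/
def fresh (tag : ℕ) (ω : Tape) (env q : Data) : Data :=
  .num (ω ((Data.num (((env.item 0).item 6).toNat - (Data.num 1).toNat)).toNat,
    .pair (.num tag) q))

/-- The interval that contains a coordinate. -/
noncomputable def lookup (env q : Data) : Option Data :=
  ((columns env).nth q.snd.fst.toNat).toList.find? fun e =>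
    decide (e.Touches q.snd.snd.toNat q.snd.snd.toNat)

/-- The pair `q.snd` codes a dimension and a coordinate. -/
def ValidCoord (env q : Data) : Prop :=
  q = .pair q.fst (.pair (.num q.snd.fst.toNat) (.num q.snd.snd.toNat)) ∧
    ((Data.num (q.snd.fst.toNat + (Data.num 1).toNat)).toNat ≤
      (Data.num ((env.item 0).item 3).toList.length).toNat ∧
    (Data.num (q.snd.snd.toNat + (Data.num 1).toNat)).toNat ≤ (bound env).toNat)

/-- The answer of the programmed function of the fuzzy mapping. -/
noncomputable def mapAnswer (ω : Tape) (env q : Data) : Data :=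
  if q.fst = .num 0 ∧ ValidCoord env q then
    if ∃ a b, Data.ofOption (lookup env q) = .pair a b then
      (Data.ofOption (lookup env q)).snd.snd.snd
    else fresh 1 ω env q
  else if q = .pair (.num 1) (.num q.snd.toNat) ∧
      (Data.num (q.snd.toNat + (Data.num 1).toNat)).toNat ≤ (paddedSize env).toNat then
    if (count env).toNat ≤ q.snd.toNat then (env.item 3).nth q.snd.toNat else fresh 1 ω env q
  else .num 0

/-- The `j`-th item has the identifier and is close to the coordinate in the query. -/
def Programmed (env q j : Data) : Prop :=
  (env.item 6).nth j.toNat = q.fst ∧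
    ((((env.item 1).nth j.toNat).nth q.snd.fst.toNat).toNat ≤ q.snd.snd.toNat ∧
    q.snd.snd.toNat ≤ (Data.num ((((env.item 1).nth j.toNat).nth q.snd.fst.toNat).toNat +
      (width env).toNat)).toNat)

/-- The answer of the programmed function of the filtering phase. -/
noncomputable def filterAnswer (ω : Tape) (env q : Data) : Data :=
  if (q.fst = .num q.fst.toNat ∧ (Data.num (q.fst.toNat + (Data.num 1).toNat)).toNat ≤
      ((env.item 0).item 6).toNat) ∧ ValidCoord env q then
    if ∃ j ∈ (Data.ofList ((List.range (env.item 1).toList.length).map Data.num)).toList,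
      Programmed env q j then env.item 4
    else fresh 2 ω env q
  else .num 0

/-- The handler for both oracles; the input consists of the environment, the index of the oracle
and the query. -/
noncomputable def answer (ω : Tape) (z : Data) : Data :=
  if z.snd.fst = .num 0 then mapAnswer ω z.fst z.snd.snd
  else if z.snd.fst = .num 1 ∧ z.fst.item 5 = .num 1 then filterAnswer ω z.fst z.snd.snd
  else .num 0

variable {f g : Fn}

/-- The definitions of this namespace keep expressions such as `(Data.num n).toNat`, so that they
match the results of the combinators `PT.add`, `PT.le` and so on literally, and the programs below
are plain terms. -/
theorem pt_width (hf : PT f) : PT fun O ω x => width (f O ω x) :=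
  (PT.const (.num 2)).mul ((hf.item 0).item 4).length

theorem pt_bound (hf : PT f) : PT fun O ω x => bound (f O ω x) :=
  ((hf.item 0).item 5).add (pt_width hf)

theorem pt_columns (hf : PT f) : PT fun O ω x => columns (f O ω x) := by
  have := PT.map (F := fun O ω x k => Data.column (width (f O ω x)).toNat
    (bound (f O ω x)).toNat ((f O ω x).item 1) ((f O ω x).item 2) k.toNat)
    ((hf.item 0).item 3).range (PT.column (pt_width (hf.comp PT.id.fst))
      (pt_bound (hf.comp PT.id.fst)) ((hf.comp PT.id.fst).item 1) ((hf.comp PT.id.fst).item 2)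
      PT.id.snd)
  simp only [Data.toList_ofList] at this
  exact this

theorem pt_count (hf : PT f) : PT fun O ω x => count (f O ω x) := by
  have := PT.foldl_additive (G := fun O ω x acc e => .num (acc.toNat +
      (Data.num ((Data.num (e.snd.fst.toNat + (Data.num 1).toNat)).toNat - e.fst.toNat)).toNat))
    (PT.flatMap (F := fun _ _ _ e => e) (pt_columns hf) PT.id.snd) (PT.const (.num 0))
    (PT.id.snd.fst.add ((PT.id.snd.snd.snd.fst.add (PT.const (.num 1))).sub PT.id.snd.snd.fst)) (by
      refine ⟨Polynomial.X + 4, fun b O hO ω x acc e => ?_⟩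
      have h1 := Data.size_num_add_le acc.toNat (e.snd.fst.toNat + 1 - e.fst.toNat)
      have h2 := Nat.size_le_size (Nat.sub_le (e.snd.fst.toNat + 1) e.fst.toNat)
      have h3 := Data.size_num_add_le e.snd.fst.toNat 1
      have h4 := acc.size_toNat_le
      have h5 := e.snd.fst.size_toNat_le
      have h6 := e.snd.size_fst_le
      have h7 := e.size_snd_le
      simp only [Nat.size_one] at h3
      simp only [Data.size, Data.toNat_num, Polynomial.eval_add, Polynomial.eval_X,
        Polynomial.eval_ofNat]
      omega)
  simp only [Data.toList_ofList] at this
  exact this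

theorem pt_paddedSize (hf : PT f) : PT fun O ω x => paddedSize (f O ω x) :=
  (hf.item 1).length.mul (((hf.item 0).item 3).length.mul ((pt_width hf).add (PT.const (.num 1))))

theorem pt_fresh (tag : ℕ) (hf : PT f) (hg : PT g) :
    PT fun O ω x => fresh tag ω (f O ω x) (g O ω x) :=
  PT.rand (((hf.item 0).item 6).sub (PT.const (.num 1))) ((PT.const (.num tag)).pair hg)

theorem pt_lookup (hf : PT f) (hg : PT g) :
    PT fun O ω x => Data.ofOption (lookup (f O ω x) (g O ω x)) :=
  PT.find (dec := fun _ _ _ _ => Classical.propDecidable _)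
    (p := fun O ω x e => e.Touches (g O ω x).snd.snd.toNat (g O ω x).snd.snd.toNat)
    ((pt_columns hf).nth_toNat hg.snd.fst)
    (PT.touches (hg.comp PT.id.fst).snd.snd (hg.comp PT.id.fst).snd.snd PT.id.snd)

theorem pt_validCoord (hf : PT f) (hg : PT g) :
    PT fun O ω x => bit (ValidCoord (f O ω x) (g O ω x)) :=
  (hg.eq (hg.fst.pair (hg.snd.fst.num.pair hg.snd.snd.num))).and
    (((hg.snd.fst.add (PT.const (.num 1))).le ((hf.item 0).item 3).length).and
      ((hg.snd.snd.add (PT.const (.num 1))).le (pt_bound hf)))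

theorem pt_mapAnswer (hf : PT f) (hg : PT g) :
    PT fun O ω x => mapAnswer ω (f O ω x) (g O ω x) :=
  PT.ite ((hg.fst.eq (PT.const (.num 0))).and (pt_validCoord hf hg))
    (PT.ite (pt_lookup hf hg).isPair (pt_lookup hf hg).snd.snd.snd (pt_fresh 1 hf hg))
    (PT.ite ((hg.eq ((PT.const (.num 1)).pair hg.snd.num)).and
        ((hg.snd.add (PT.const (.num 1))).le (pt_paddedSize hf)))
      (PT.ite ((pt_count hf).le hg.snd) ((hf.item 3).nth_toNat hg.snd) (pt_fresh 1 hf hg))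
      (PT.const (.num 0)))

theorem pt_programmed {j : Fn} (hf : PT f) (hg : PT g) (hj : PT j) :
    PT fun O ω x => bit (Programmed (f O ω x) (g O ω x) (j O ω x)) :=
  (((hf.item 6).nth_toNat hj).eq hg.fst).and
    (((((hf.item 1).nth_toNat hj).nth_toNat hg.snd.fst).le hg.snd.snd).and
    (hg.snd.snd.le ((((hf.item 1).nth_toNat hj).nth_toNat hg.snd.fst).add (pt_width hf))))

theorem pt_filterAnswer (hf : PT f) (hg : PT g) :
    PT fun O ω x => filterAnswer ω (f O ω x) (g O ω x) :=
  PT.ite (((hg.fst.eq hg.fst.num).and ((hg.fst.add (PT.const (.num 1))).le ((hf.item 0).item 6))).and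
      (pt_validCoord hf hg))
    (PT.ite (PT.any (p := fun O ω x j => Programmed (f O ω x) (g O ω x) j) (hf.item 1).range
        (pt_programmed (hf.comp PT.id.fst) (hg.comp PT.id.fst) PT.id.snd))
      (hf.item 4) (pt_fresh 2 hf hg))
    (PT.const (.num 0))

theorem pt_answer : PT fun _ ω x => answer ω x :=
  PT.ite (PT.id.snd.fst.eq (PT.const (.num 0))) (pt_mapAnswer PT.id.fst PT.id.snd.snd)
    (PT.ite ((PT.id.snd.fst.eq (PT.const (.num 1))).and
      ((PT.id.fst.item 5).eq (PT.const (.num 1)))) (pt_filterAnswer PT.id.fst PT.id.snd.snd)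
      (PT.const (.num 0)))

/-- Cells with a nonzero tag are never read by a hosted distinguisher, whose cells all carry the tag
`0`. -/
theorem isRight_fresh {n : ℕ} {tag : ℕ} {q : Data} (ht : tag ≠ 0) :
    IsRight (n, .pair (.num tag) q) := by
  intro a h
  simp only [Data.pair.injEq, Data.num.injEq] at h
  exact ht h.1

theorem fresh_glue {tag : ℕ} (ht : tag ≠ 0) (ω₁ ω₂ : Tape) (env q : Data) :
    fresh tag (glue ω₁ ω₂) env q = fresh tag ω₂ env q := by
  unfold fresh
  rw [glue_of_isRight (isRight_fresh ht)]

theorem size_fresh_le (tag : ℕ) (ω : Tape) (env q : Data) :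
    (fresh tag ω env q).size ≤ env.size + 1 := by
  unfold fresh
  set c : ℕ × Data := ((Data.num (((env.item 0).item 6).toNat - (Data.num 1).toNat)).toNat,
    .pair (.num tag) q)
  have h1 : (ω c : ℕ) ≤ ((env.item 0).item 6).toNat :=
    (Nat.lt_succ_iff.1 (ω c).2).trans (Nat.sub_le _ _)
  have h2 := Nat.size_le_size h1
  have h3 := ((env.item 0).item 6).size_toNat_le
  have h4 := (env.item 0).size_item_le 6
  have h5 := env.size_item_le 0
  simp only [Data.size]
  omega

/-- Every answer is a part of the environment, a part of the computed columns, or a cell with fewer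
than `|𝔽|` values. Its size is therefore bounded in terms of the environment, however long the query
is. -/
theorem isHandler_answer : IsHandler answer where
  pt := pt_answer
  bound := by
    obtain ⟨p, hp⟩ := (pt_columns PT.id).size_le
    refine ⟨p.comp (Polynomial.X + 1) + Polynomial.X + 1, fun ω env q => ?_⟩
    have hcol : (columns env).size ≤ p.eval (env.size + 1) :=
      hp 1 noOracles (fun _ _ => by simp [noOracles, Data.size]) ω env
    have h0 := env.one_le_size
    have hf := fun tag q => size_fresh_le tag ω env q
    have hz : (Data.num 0).size = 1 := rfl
    have hd := fun i => ((env.item 3).size_nth_le i).trans (env.size_item_le 3)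
    have h4 := env.size_item_le 4
    have hl : ∀ q : Data, (Data.ofOption (lookup env q)).snd.snd.snd.size ≤
        (columns env).size := by
      intro q
      rcases h : lookup env q with _ | e
      · simpa [Data.ofOption, Data.snd, Data.size] using (columns env).one_le_size
      · have h1 := Data.size_le_of_mem (List.mem_of_find?_eq_some h)
        have h2 := (columns env).size_nth_le q.snd.fst.toNat
        have h3 := e.snd.size_snd_le
        have h4 := e.size_snd_le
        simp only [Data.ofOption, Data.snd_pair]
        omega
    simp only [Polynomial.eval_add, Polynomial.eval_comp, Polynomial.eval_X, Polynomial.eval_one]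
    simp only [answer, mapAnswer, filterAnswer, Data.fst_pair, Data.snd_pair]
    have hf1 := hf 1 q.snd
    have hf2 := hf 2 q.snd
    have hd1 := hd q.snd.snd.toNat
    have hl1 := hl q.snd
    have key : ∀ (c : Prop) [Decidable c] (a b : Data) (B : ℕ), a.size ≤ B → b.size ≤ B →
        (if c then a else b).size ≤ B := fun c _ a b B ha hb => by split_ifs <;> assumption
    repeat' apply key
    all_goals omega
  right ω₁ ω₂ x := by
    simp only [answer, mapAnswer, filterAnswer, fresh_glue one_ne_zero, fresh_glue two_ne_zero]

end Handler

end Handler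

end FuzzyPSI

namespace FuzzyPSI

open scoped Classical BigOperators

/-! ### The programs represent the local mapping -/

section Representation

variable {P : Params} {𝔽 : Type}

/-- A coordinate, shifted to a natural number. -/
def shifted (y : Coord P) : ℕ := ((y : ℤ) + P.δ).toNat

theorem shifted_lt (y : Coord P) : shifted y < P.u + 2 * P.δ := by
  have := Finset.mem_Ico.1 y.2
  unfold shifted; omega

theorem exists_shifted {t : ℕ} (h : t < P.u + 2 * P.δ) : ∃ y : Coord P, shifted y = t :=
  ⟨⟨(t : ℤ) - P.δ, Finset.mem_Ico.2 (by omega)⟩, by simp [shifted]⟩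

theorem shifted_injective : Function.Injective (shifted (P := P)) := by
  intro y z h
  have h1 := Finset.mem_Ico.1 y.2
  have h2 := Finset.mem_Ico.1 z.2
  unfold shifted at h
  exact Subtype.ext (by omega)

theorem mem_interval_shifted {x : Fin P.u} {y : Coord P} :
    y ∈ interval P x ↔ (x : ℕ) ≤ shifted y ∧ shifted y ≤ x + 2 * P.δ := by
  have := Finset.mem_Ico.1 y.2
  rw [mem_interval, abs_le]
  unfold shifted
  omega

/-- The set `A` consists of the coordinates in an interval. -/
def IsIv (A : Finset (Coord P)) (lo hi : ℕ) : Prop :=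
  lo ≤ hi ∧ hi < P.u + 2 * P.δ ∧ ∀ y, y ∈ A ↔ lo ≤ shifted y ∧ shifted y ≤ hi

theorem isIv_interval (x : Fin P.u) : IsIv (interval P x) x (x + 2 * P.δ) :=
  ⟨by omega, by omega, fun _ => mem_interval_shifted⟩

/-- Reduces the test on finite sets to a comparison of end points, which is what the program does.
-/
theorem IsIv.not_disjoint_iff {A B : Finset (Coord P)} {lo hi lo' hi' : ℕ} (hA : IsIv A lo hi)
    (hB : IsIv B lo' hi') : ¬ Disjoint A B ↔ lo ≤ hi' ∧ lo' ≤ hi := by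
  obtain ⟨a1, a2, a3⟩ := hA
  obtain ⟨b1, b2, b3⟩ := hB
  rw [Finset.not_disjoint_iff]
  constructor
  · rintro ⟨y, hy, hy'⟩
    have := (a3 y).1 hy; have := (b3 y).1 hy'
    omega
  · intro h
    obtain ⟨y, hy⟩ := exists_shifted (P := P) (t := max lo lo') (by omega)
    exact ⟨y, (a3 y).2 (by omega), (b3 y).2 (by omega)⟩

theorem IsIv.union {A B : Finset (Coord P)} {lo hi lo' hi' : ℕ} (hA : IsIv A lo hi)
    (hB : IsIv B lo' hi') (h : lo ≤ hi' ∧ lo' ≤ hi) :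
    IsIv (A ∪ B) (min lo lo') (max hi hi') := by
  obtain ⟨a1, a2, a3⟩ := hA
  obtain ⟨b1, b2, b3⟩ := hB
  refine ⟨by omega, by omega, fun y => ?_⟩
  rw [Finset.mem_union, a3, b3]
  omega

theorem IsIv.card {A : Finset (Coord P)} {lo hi : ℕ} (h : IsIv A lo hi) :
    A.card = hi + 1 - lo := by
  rw [← Nat.card_Icc, ← Finset.card_image_of_injective A shifted_injective]
  congr 1
  ext t
  simp only [Finset.mem_image, Finset.mem_Icc]
  constructor
  · rintro ⟨y, hy, rfl⟩
    exact (h.2.2 y).1 hy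
  · intro ht
    obtain ⟨y, rfl⟩ := exists_shifted (P := P) (t := t) (by have := h.2.1; omega)
    exact ⟨y, (h.2.2 y).2 ht, rfl⟩

/-- The datum `d` represents an interval with its value. -/
def IvRep (enc : 𝔽 → Data) (e : Finset (Coord P) × 𝔽) (d : Data) : Prop :=
  IsIv e.1 d.fst.toNat d.snd.fst.toNat ∧ d.snd.snd = enc e.2

variable {enc : 𝔽 → Data}

/-- The running interval always contains the window from `x` to `y`, and each interval of the list
touches that window. So every union along the way is again an interval. -/
theorem ivRep_foldl {T : List (Finset (Coord P) × 𝔽)} {t : List Data} (h : List.Forall₂ (IvRep enc) T t)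
    {x y : ℕ} (ht : ∀ e ∈ t, e.Touches x y) :
    ∀ {A : Finset (Coord P)} {lo hi : Data}, IsIv A lo.toNat hi.toNat → lo.toNat ≤ x → y ≤ hi.toNat →
      IsIv (T.foldl (fun V e => V ∪ e.1) A)
        (t.foldl (fun acc e => Data.num (min acc.toNat e.fst.toNat)) lo).toNat
        (t.foldl (fun acc e => Data.num (max acc.toNat e.snd.fst.toNat)) hi).toNat := by
  induction h with
  | nil => exact fun hA _ _ => hA
  | @cons e d T t hed _ ih =>
    intro A lo hi hA hx hy
    have h1 := ht d (by simp)
    refine ih (fun e he => ht e (by simp [he])) (A := A ∪ e.1) ?_ ?_ ?_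
    · refine hA.union hed.1 ⟨?_, ?_⟩
      · exact hx.trans h1.1
      · exact h1.2.trans hy
    · simp only [Data.toNat_num]; omega
    · simp only [Data.toNat_num]; omega

variable [Field 𝔽] [Fintype 𝔽]

theorem ivRep_insert {L : List (Finset (Coord P) × 𝔽)} {l : Data}
    (h : List.Forall₂ (IvRep enc) L l.toList) (x : Fin P.u) (r : 𝔽) :
    List.Forall₂ (IvRep enc) (insertInterval (interval P x) r L)
      (Data.insertIv (P.u + 2 * P.δ) x (x + 2 * P.δ) (enc r) l).toList := by
  have htouch : ∀ {e : Finset (Coord P) × 𝔽} {d : Data}, IvRep enc e d →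
      (¬ Disjoint (interval P x) e.1 ↔ d.Touches x (x + 2 * P.δ)) := fun hed =>
    (isIv_interval x).not_disjoint_iff hed.1
  have hT : List.Forall₂ (IvRep enc) (L.filter fun e => decide (¬ Disjoint (interval P x) e.1))
      (l.toList.filter fun e => decide (e.Touches x (x + 2 * P.δ))) :=
    List.rel_filter (fun e d hed => by simpa using htouch hed) h
  have hN : List.Forall₂ (IvRep enc) (L.filter fun e => decide (Disjoint (interval P x) e.1))
      (l.toList.filter fun e => decide (¬ e.Touches x (x + 2 * P.δ))) :=
    List.rel_filter (fun e d hed => by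
      simp only [decide_eq_true_eq]; rw [← htouch hed, not_not]) h
  have hI := ivRep_foldl hT (x := x) (y := x + 2 * P.δ) (fun e he => by
    simpa using (List.mem_filter.1 he).2) (A := interval P x) (lo := .num x)
    (hi := .num (x + 2 * P.δ)) (isIv_interval x) le_rfl le_rfl
  unfold insertInterval Data.insertIv
  simp only [Data.toList, Data.toList_ofList]
  refine List.Forall₂.cons ⟨?_, rfl⟩ hN
  simp only [Data.fst_pair, Data.snd_pair, Data.toNat_num]
  -- On genuine inputs the upper end is below the bound, so the truncation has no effect.
  rw [min_eq_right hI.2.1.le]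
  exact hI

theorem ivRep_column {a : ℕ} (x : Fin a → Point P) (r : Fin a → Fin P.d → 𝔽) (k : Fin P.d) :
    List.Forall₂ (IvRep enc) (intervals (fun i => x i k) fun i => r i k)
      (Data.column (2 * P.δ) (P.u + 2 * P.δ) (Data.ofFamily encodePoint x) (Data.ofMatrix enc r)
        k).toList := by
  unfold intervals Data.column
  rw [Data.length_ofFamily, ← List.map_coe_finRange_eq_range, List.map_map, List.foldl_map]
  have : ∀ (l : List (Fin a)) (L : List (Finset (Coord P) × 𝔽)) (d : Data),
      List.Forall₂ (IvRep enc) L d.toList → List.Forall₂ (IvRep enc)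
      (l.foldl (fun L j => insertInterval (interval P (x j k)) (r j k) L) L)
      (l.foldl (fun acc j => Data.insertIv (P.u + 2 * P.δ) ((((Data.ofFamily encodePoint x).nth
        ((Data.num ∘ Fin.val) j).toNat).nth k).toNat) ((((Data.ofFamily encodePoint x).nth
        ((Data.num ∘ Fin.val) j).toNat).nth k).toNat + 2 * P.δ) (((Data.ofMatrix enc r).nth
        ((Data.num ∘ Fin.val) j).toNat).nth k) acc) d).toList := by
    intro l
    induction l with
    | nil => exact fun _ _ h => h
    | cons j l ih =>
      intro L d h
      refine ih _ _ ?_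
      simp only [Function.comp_apply, Data.toNat_num, Data.ofMatrix, Data.nth_ofFamily, encodePoint,
        encodeFin]
      exact ivRep_insert h (x j k) (r j k)
  exact this _ _ _ List.Forall₂.nil

omit [Field 𝔽] [Fintype 𝔽] in
theorem ivRep_find {L : List (Finset (Coord P) × 𝔽)} {l : List Data}
    (h : List.Forall₂ (IvRep enc) L l) (y : Coord P) :
    (l.find? fun e => decide (e.Touches (shifted y) (shifted y))).map (fun d => d.snd.snd) =
      (L.find? fun e => decide (y ∈ e.1)).map fun e => enc e.2 := by
  induction h with
  | nil => rfl
  | @cons e d L l hed _ ih =>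
    have : d.Touches (shifted y) (shifted y) ↔ y ∈ e.1 := by
      rw [hed.1.2.2, and_comm]; rfl
    by_cases hy : y ∈ e.1
    · rw [List.find?_cons_of_pos (by simpa using this.2 hy),
        List.find?_cons_of_pos (by simpa using hy)]
      simp [hed.2]
    · rw [List.find?_cons_of_neg (by simpa using mt this.1 hy),
        List.find?_cons_of_neg (by simpa using hy), ih]

omit [Field 𝔽] [Fintype 𝔽] in
-- An interval from `lo` to `hi` has `hi + 1 - lo` points, so the program finds the number of real
-- entries, and with it the start of the padding, without listing them.
theorem ivRep_count {L : List (Finset (Coord P) × 𝔽)} {l : List Data}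
    (h : List.Forall₂ (IvRep enc) L l) (n : ℕ) :
    l.foldl (fun acc e => Data.num (acc.toNat + (e.snd.fst.toNat + 1 - e.fst.toNat))) (.num n) =
      .num (n + (L.map fun e => e.1.card).sum) := by
  induction h generalizing n with
  | nil => rfl
  | @cons e d L l hed _ ih =>
    rw [List.foldl_cons, Data.toNat_num, ih, List.map_cons, List.sum_cons, hed.1.card, add_assoc]

theorem length_localEntries {a : ℕ} (x : Fin a → Point P) (r : Fin a → Fin P.d → 𝔽) :
    (localEntries x r).length = (((List.finRange P.d).flatMap fun k =>
      intervals (fun i => x i k) fun i => r i k).map fun e => e.1.card).sum := by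
  unfold localEntries
  rw [List.length_flatMap, List.map_flatMap, List.flatMap_def, List.sum_flatten, List.map_map]
  congr 2
  funext k
  simp [List.length_flatMap]

end Representation

end FuzzyPSI

namespace FuzzyPSI

open scoped Classical BigOperators

/-! ### The handler provides the oracles of a party -/

section HandlerSpec

variable {P : Params} {𝔽 : Type} {N : ℕ}

@[simp] theorem Data.length_unary (n : ℕ) : (Data.unary n).toList.length = n := by
  simp [Data.unary]

theorem encodeMapKey_inl {a : ℕ} (k : Fin P.d) (y : Coord P) :
    encodeMapKey (Sum.inl (k, y) : MapKey P a) =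
      .pair (.num 0) (.pair (.num k) (.num (shifted y))) := rfl

theorem encodeMapKey_inr {a : ℕ} (i : Fin (listSize P a)) :
    encodeMapKey (Sum.inr i : MapKey P a) = .pair (.num 1) (.num i) := rfl

theorem encodeMapKey_injective {a : ℕ} : Function.Injective (encodeMapKey : MapKey P a → Data) := by
  rintro (⟨k, y⟩ | i) (⟨k', y'⟩ | i') h
  · simp only [encodeMapKey_inl, Data.pair.injEq, Data.num.injEq, true_and] at h
    rw [Fin.ext h.1, shifted_injective h.2]
  · simp [encodeMapKey_inl, encodeMapKey_inr] at h
  · simp [encodeMapKey_inl, encodeMapKey_inr] at h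
  · simp only [encodeMapKey_inr, Data.pair.injEq, Data.num.injEq, true_and] at h
    rw [Fin.ext h]

theorem encodeFilterKey_eq (e : 𝔽 ≃ Fin N) (c : 𝔽) (k : Fin P.d) (y : Coord P) :
    encodeFilterKey e (c, k, y) = .pair (.num (e c)) (.pair (.num k) (.num (shifted y))) := rfl

theorem encodeFilterKey_injective (e : 𝔽 ≃ Fin N) :
    Function.Injective (encodeFilterKey e : FilterKey P 𝔽 → Data) := by
  rintro ⟨c, k, y⟩ ⟨c', k', y'⟩ h
  simp only [encodeFilterKey_eq, Data.pair.injEq, Data.num.injEq] at h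
  rw [Fin.ext h.2.1, shifted_injective h.2.2, e.injective (Fin.ext h.1)]

variable [Field 𝔽]

/-- The environment for the handler of a party with items `x` and random values `r`, `dummy`;
`flag = 1` provides the function programmed with the identifiers `ids`. -/
def handlerEnv (e : 𝔽 ≃ Fin N) (inp : Data) {a : ℕ} (x : Fin a → Point P)
    (r : Fin a → Fin P.d → 𝔽) (dummy : Fin (listSize P a) → 𝔽) (flag : ℕ) (ids : Data) : Data :=
  .ofList [inp, Data.ofFamily encodePoint x, Data.ofMatrix (encodeBy e) r,
    Data.ofFamily (encodeBy e) dummy, encodeBy e 0, .num flag, ids]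

namespace Handler

variable {e : 𝔽 ≃ Fin N} {s M : ℕ} {inp out : Data} {a : ℕ} {x : Fin a → Point P}
  {r : Fin a → Fin P.d → 𝔽} {dummy : Fin (listSize P a) → 𝔽} {flag : ℕ} {ids : Data}

local notation "environment" => handlerEnv e (simulatorInput s P N M inp out) x r dummy flag ids

theorem width_env : width (environment) = .num (2 * P.δ) := by
  simp [width, handlerEnv, simulatorInput]

theorem bound_env : bound (environment) = .num (P.u + 2 * P.δ) := by
  rw [bound, width_env]
  simp [handlerEnv, simulatorInput]

theorem columns_env : columns (environment) = Data.ofFamily (fun k : Fin P.d =>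
    Data.column (2 * P.δ) (P.u + 2 * P.δ) (Data.ofFamily encodePoint x)
      (Data.ofMatrix (encodeBy e) r) k) id := by
  rw [columns, width_env, bound_env, Data.ofFamily, List.ofFn_eq_map]
  simp only [handlerEnv, simulatorInput, Data.item_zero, Data.item_succ, Data.length_unary,
    Data.toNat_num, List.map_map, ← List.map_coe_finRange_eq_range]
  rfl

theorem paddedSize_env : paddedSize (environment) = .num (listSize P a) := by
  rw [paddedSize, width_env]
  simp [handlerEnv, simulatorInput, Data.length_ofFamily, listSize, mul_assoc]

/-- The program must reject exactly the queries that code no key, because `oracleOf` answers those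
by `0`. -/
theorem validCoord_env {q : Data} : ValidCoord (environment) q ↔
    ∃ (k : Fin P.d) (y : Coord P), q = .pair q.fst (.pair (.num k) (.num (shifted y))) := by
  rw [ValidCoord, bound_env]
  simp only [handlerEnv, simulatorInput, Data.item_zero, Data.item_succ, Data.length_unary,
    Data.toNat_num]
  constructor
  · rintro ⟨h1, h2, h3⟩
    obtain ⟨y, hy⟩ := exists_shifted (P := P) (t := q.snd.snd.toNat) h3
    exact ⟨⟨_, h2⟩, y, by rw [hy]; exact h1⟩
  · rintro ⟨k, y, h⟩
    have h1 : q.snd.fst.toNat = k := by rw [h]; rfl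
    have h2 : q.snd.snd.toNat = shifted y := by rw [h]; rfl
    rw [h1, h2]
    exact ⟨h, k.2, shifted_lt y⟩

theorem program_inl [Fintype 𝔽] (ρ : MapKey P a → 𝔽) (k : Fin P.d) (y : Coord P) :
    program (localList x r dummy) ρ (Sum.inl (k, y)) =
      (((intervals (fun i => x i k) fun i => r i k).find? fun e => decide (y ∈ e.1)).map
        Prod.snd).getD (ρ (Sum.inl (k, y))) := by
  rw [program_localList_inl, intervals_eq_map, List.find?_map]
  unfold labelAt
  exact (getD_map_eq_elim _ _ _).symm

theorem count_env [Fintype 𝔽] : count (environment) = .num (localEntries x r).length := by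
  rw [count, columns_env]
  have : List.Forall₂ (IvRep (encodeBy e)) ((List.finRange P.d).flatMap fun k =>
      intervals (fun i => x i k) fun i => r i k) ((List.finRange P.d).flatMap fun k : Fin P.d =>
      (Data.column (2 * P.δ) (P.u + 2 * P.δ) (Data.ofFamily encodePoint x)
      (Data.ofMatrix (encodeBy e) r) k).toList) := by
    induction List.finRange P.d with
    | nil => exact List.Forall₂.nil
    | cons k l ih => exact List.rel_append (ivRep_column x r k) ih
  have h2 := ivRep_count this 0
  rw [length_localEntries, ← zero_add (List.sum _), ← h2]
  congr 1
  simp only [Data.ofFamily, Data.toList_ofList, List.ofFn_eq_map, List.flatMap_map, id]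

variable [Fintype 𝔽] {ω : Tape}

/-- The hypothesis identifies `ρ` with the cells of tag `1`. Lazy sampling then gives the same
oracle as the function sampled all at once. -/
theorem mapAnswer_env {ρ : MapKey P a → 𝔽}
    (hρ : ∀ key, encodeBy e (ρ key) = .num (ω (N - 1, .pair (.num 1) (encodeMapKey key)))) (q : Data) :
    mapAnswer ω (environment) q =
      oracleOf encodeMapKey (encodeBy e) (program (localList x r dummy) ρ) q := by
  have hfresh : ∀ key : MapKey P a, fresh 1 ω (environment) (encodeMapKey key) =
      encodeBy e (ρ key) := fun key => (hρ key).symm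
  by_cases hq : ∃ key : MapKey P a, encodeMapKey key = q
  · obtain ⟨key, rfl⟩ := hq
    rw [oracleOf_apply encodeMapKey_injective]
    rcases key with ⟨k, y⟩ | i
    · rw [mapAnswer, if_pos ⟨rfl, validCoord_env.2 ⟨k, y, rfl⟩⟩, program_inl, hfresh]
      have hf := ivRep_find (ivRep_column (enc := encodeBy e) x r k) y
      have hl : lookup (environment) (encodeMapKey (Sum.inl (k, y) : MapKey P a)) =
          (Data.column (2 * P.δ) (P.u + 2 * P.δ) (Data.ofFamily encodePoint x)
            (Data.ofMatrix (encodeBy e) r) k).toList.find? fun e =>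
              decide (e.Touches (shifted y) (shifted y)) := by
        rw [lookup, columns_env, encodeMapKey_inl]
        simp only [Data.snd_pair, Data.fst_pair, Data.toNat_num]
        rw [Data.nth_ofFamily]
        rfl
      rw [hl]
      revert hf
      rcases List.find? _ _ with _ | d <;> rcases List.find? _ _ with _ | v <;> intro hf
      · simp [Data.ofOption]
      · simp at hf
      · simp at hf
      · simp only [Option.map_some, Option.some_inj] at hf
        simp [Data.ofOption, hf]
    · rw [mapAnswer, if_neg (by simp [encodeMapKey_inr]), if_pos, count_env, program_localList_inr,
        hfresh]
      · by_cases hle : (localEntries x r).length ≤ i.val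
        · exact (if_pos hle).trans ((Data.nth_ofFamily _ dummy i).trans
            (congrArg _ (if_pos hle).symm))
        · exact (if_neg hle).trans (congrArg _ (if_neg hle).symm)
      · rw [paddedSize_env]
        exact ⟨rfl, i.2⟩
  · rw [oracleOf_of_not _ _ (by simpa using hq), mapAnswer, if_neg, if_neg]
    · rw [paddedSize_env]
      rintro ⟨h1, h2⟩
      exact hq ⟨Sum.inr ⟨_, h2⟩, h1.symm⟩
    · rw [validCoord_env]
      rintro ⟨h1, k, y, h⟩
      rw [h1] at h
      exact hq ⟨Sum.inl (k, y), h.symm⟩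

end Handler

end HandlerSpec

/-! ### The oracle of the filtering phase and the joint oracles of both parties -/

section FilterSpec

variable {P : Params} {𝔽 : Type} {N : ℕ} [Field 𝔽] [Fintype 𝔽] {e : 𝔽 ≃ Fin N} {s M : ℕ}
  {inp out : Data} {w : Fin P.n → Point P} {r : Fin P.n → Fin P.d → 𝔽}
  {dummy : Fin (listSize P P.n) → 𝔽} {flag : ℕ} {ident : Fin P.n → 𝔽} {ω : Tape}

namespace Handler

local notation "environment" => handlerEnv e (simulatorInput s P N M inp out) w r dummy flag
  (Data.ofFamily (encodeBy e) ident)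

theorem programmed_env {c : 𝔽} {k : Fin P.d} {y : Coord P} {j : Fin P.n} :
    Programmed (environment) (encodeFilterKey e (c, k, y)) (.num j) ↔
      ident j = c ∧ y ∈ interval P (w j k) := by
  rw [Programmed, width_env, mem_interval_shifted, ← (encodeBy_injective e).eq_iff]
  simp only [handlerEnv, simulatorInput, Data.item_zero, Data.item_succ, encodeFilterKey_eq,
    Data.snd_pair, Data.fst_pair, Data.toNat_num, Data.nth_ofFamily, encodePoint, encodeFin]
  rfl

theorem filterAnswer_env {ρ : FilterKey P 𝔽 → 𝔽}
    (hρ : ∀ key, encodeBy e (ρ key) = .num (ω (N - 1, .pair (.num 2) (encodeFilterKey e key))))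
    (q : Data) : filterAnswer ω (environment) q =
      oracleOf (encodeFilterKey e) (encodeBy e) (program (filterList w ident) ρ) q := by
  by_cases hq : ∃ key : FilterKey P 𝔽, encodeFilterKey e key = q
  · obtain ⟨⟨c, k, y⟩, rfl⟩ := hq
    rw [oracleOf_apply (encodeFilterKey_injective e), program_filterList, filterAnswer, if_pos]
    · have h : (∃ j ∈ (Data.ofList ((List.range ((environment).item 1).toList.length).map
          Data.num)).toList, Programmed (environment) (encodeFilterKey e (c, k, y)) j) ↔
          ∃ i, ident i = c ∧ y ∈ interval P (w i k) := by
        have hlen : ((environment).item 1).toList.length = P.n := Data.length_ofFamily _ _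
        rw [hlen]
        simp only [Data.toList_ofList, List.mem_map, List.mem_range]
        constructor
        · rintro ⟨_, ⟨j, hj, rfl⟩, h⟩
          exact ⟨⟨j, hj⟩, programmed_env.1 h⟩
        · rintro ⟨j, h⟩
          exact ⟨_, ⟨j, j.2, rfl⟩, programmed_env.2 h⟩
      simp only [h]
      split_ifs
      · rfl
      · exact (hρ _).symm
    · exact ⟨⟨rfl, (e c).2⟩, validCoord_env.2 ⟨k, y, rfl⟩⟩
  · rw [oracleOf_of_not _ _ (by simpa using hq), filterAnswer, if_neg]
    rw [validCoord_env]
    rintro ⟨⟨h1, h2⟩, k, y, h⟩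
    obtain ⟨c, hc⟩ := e.surjective ⟨_, h2⟩
    refine hq ⟨(c, k, y), ?_⟩
    rw [encodeFilterKey_eq, hc]
    exact (congrArg (fun z => Data.pair z _) h1.symm).trans h.symm

/-- With flag `0` the second oracle is switched off; the sender has only one programmed function. -/
theorem oracles_sender {a : ℕ} {x : Fin a → Point P} {r : Fin a → Fin P.d → 𝔽}
    {dummy : Fin (listSize P a) → 𝔽} {ids : Data} {ρ : MapKey P a → 𝔽}
    (hρ : ∀ key, encodeBy e (ρ key) = .num (ω (N - 1, .pair (.num 1) (encodeMapKey key)))) :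
    handlerOracles answer ω (handlerEnv e (simulatorInput s P N M inp out) x r dummy 0 ids) =
      oneOracle (oracleOf encodeMapKey (encodeBy e) (program (localList x r dummy) ρ)) := by
  funext i q
  simp only [handlerOracles, answer, oneOracle, Data.snd_pair, Data.fst_pair, Data.num.injEq,
    mapAnswer_env hρ]
  split_ifs with h1 h2
  · rfl
  · exact absurd h2.2 (by simp [handlerEnv])
  · rfl

theorem oracles_receiver {ρ₁ : MapKey P P.n → 𝔽}
    (hρ₁ : ∀ key, encodeBy e (ρ₁ key) = .num (ω (N - 1, .pair (.num 1) (encodeMapKey key))))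
    {ρ₂ : FilterKey P 𝔽 → 𝔽}
    (hρ₂ : ∀ key, encodeBy e (ρ₂ key) = .num (ω (N - 1, .pair (.num 2) (encodeFilterKey e key)))) :
    handlerOracles answer ω (handlerEnv e (simulatorInput s P N M inp out) w r dummy 1
      (Data.ofFamily (encodeBy e) ident)) =
      twoOracles (oracleOf encodeMapKey (encodeBy e) (program (localList w r dummy) ρ₁))
        (oracleOf (encodeFilterKey e) (encodeBy e) (program (filterList w ident) ρ₂)) := by
  funext i q
  simp only [handlerOracles, answer, twoOracles, Data.snd_pair, Data.fst_pair, Data.num.injEq,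
    mapAnswer_env hρ₁, filterAnswer_env hρ₂]
  split_ifs with h1 h2 h3 h4
  · rfl
  · rfl
  · exact absurd h2.1 h3
  · exact absurd ⟨h4, by simp [handlerEnv]⟩ h2
  · rfl

end Handler

end FilterSpec

end FuzzyPSI

namespace FuzzyPSI

open scoped Classical BigOperators

/-! ### Sampling from the tape -/

section Sampling

/-- Permutations as sequences of independent choices. -/
def permEquiv : (n : ℕ) → (∀ i : Fin n, Fin (i.val + 1)) ≃ Equiv.Perm (Fin n)
  | 0 => Equiv.ofUnique _ _
  | n + 1 => (Fin.snocEquiv fun i : Fin (n + 1) => Fin (i.val + 1)).symm.trans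
      ((Equiv.prodCongr (Equiv.refl (Fin (n + 1))) (permEquiv n)).trans
        Equiv.Perm.decomposeFin.symm)

theorem permEquiv_succ_zero {n : ℕ} (c : ∀ i : Fin (n + 1), Fin (i.val + 1)) :
    permEquiv (n + 1) c 0 = c (Fin.last n) := by
  simp [permEquiv, Fin.snocEquiv]

theorem permEquiv_succ_succ {n : ℕ} (c : ∀ i : Fin (n + 1), Fin (i.val + 1)) (j : Fin n) :
    permEquiv (n + 1) c j.succ = Equiv.swap 0 (c (Fin.last n))
      (permEquiv n (fun i => c i.castSucc) j).succ := by
  simp [permEquiv, Fin.snocEquiv]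
  rfl

/-- One step in the construction of a random permutation. -/
noncomputable def permStep (ω : Tape) (acc j : Data) : Data :=
  .pair (.num (ω (j.toNat, .pair (.num 10) j)))
    (.ofList (acc.toList.map fun x =>
      if Data.num (x.toNat + (Data.num 1).toNat) = .num (ω (j.toNat, .pair (.num 10) j)) then
        .num 0 else .num (x.toNat + (Data.num 1).toNat)))

/-- A step prepends the new image of `0`, moves the old images up by one, and sends the one that
hits the new image to `0`. This is the transposition in the decomposition of a permutation of `n +
1` points. -/
theorem foldl_permStep (ω : Tape) (n : ℕ) :
    ((List.range n).map Data.num).foldl (permStep ω) (.num 0) =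
      Data.ofFamily encodeFin (permEquiv n fun i => ω (i, .pair (.num 10) (.num i))) := by
  induction n with
  | zero => rfl
  | succ n ih =>
    rw [List.range_succ, List.map_append, List.foldl_append, ih]
    simp only [List.map_cons, List.map_nil, List.foldl_cons, List.foldl_nil, permStep,
      Data.toNat_num]
    rw [Data.ofFamily, Data.ofFamily, List.ofFn_succ, Data.toList_ofList]
    simp only [permEquiv_succ_zero, permEquiv_succ_succ, List.map_ofFn]
    rw [Data.ofList]
    congr 3
    funext j
    simp only [Function.comp_apply, encodeFin, Data.toNat_num, Fin.val_castSucc, Fin.val_last]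
    set p := permEquiv n (fun i => ω (i, .pair (.num 10) (.num i))) j
    set q : Fin (n + 1) := ω (n, .pair (.num 10) (.num n))
    by_cases h : (p : ℕ) + 1 = q
    · have : p.succ = q := Fin.ext h
      rw [this, Equiv.swap_apply_right]
      exact if_pos (congrArg Data.num h)
    · have : p.succ ≠ q := fun h' => h (congrArg Fin.val h')
      rw [Equiv.swap_apply_of_ne_of_ne (Fin.succ_ne_zero p) this]
      exact if_neg fun h' => h (Data.num.inj h')

theorem Data.size_ofFamily_le {n : ℕ} {α : Type} (enc : α → Data) (f : Fin n → α) {b : ℕ}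
    (h : ∀ i, (enc (f i)).size ≤ b) : (Data.ofFamily enc f).size ≤ n * (b + 1) + 1 := by
  rw [Data.ofFamily, Data.size_ofList]
  have := List.sum_le_card_nsmul ((List.ofFn fun i => enc (f i)).map fun e => e.size + 1) (b + 1)
    (by simp only [List.mem_map, List.mem_ofFn]; rintro _ ⟨_, ⟨i, rfl⟩, rfl⟩; have := h i; omega)
  simp only [List.length_map, List.length_ofFn, smul_eq_mul] at this
  omega

/-- A random permutation. -/
noncomputable def samplePerm (ω : Tape) (l : Data) : Data :=
  ((List.range l.toList.length).map Data.num).foldl (permStep ω) (.num 0)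

theorem PT.samplePerm {l : Fn} (hl : PT l) : PT fun O ω x => samplePerm ω (l O ω x) := by
  have hcode : PT fun _ ω y => .num (ω (y.toNat, .pair (.num 10) y)) :=
    PT.rand PT.id ((PT.const (.num 10)).pair PT.id)
  have hstep : PT fun _ ω y => permStep ω y.snd.fst y.snd.snd :=
    (hcode.comp PT.id.snd.snd).pair (PT.map (F := fun _ ω y x =>
      if Data.num (x.toNat + (Data.num 1).toNat) =
        .num (ω (y.snd.snd.toNat, .pair (.num 10) y.snd.snd)) then
        .num 0 else .num (x.toNat + (Data.num 1).toNat)) PT.id.snd.fst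
      (PT.ite ((PT.id.snd.add (PT.const (.num 1))).eq (hcode.comp PT.id.fst.snd.snd))
        (PT.const (.num 0)) (PT.id.snd.add (PT.const (.num 1)))))
  have := PT.foldl_of_bound (G := fun _ ω _ acc j => permStep ω acc j) hl.range (PT.const (.num 0))
    hstep (by
      obtain ⟨p, hp⟩ := hl.size_le
      refine ⟨p * (p + 2) + 1, fun b O hO ω x l' hl' => ?_⟩
      simp only [Data.toList_ofList] at hl'
      -- A prefix of a range is a range, so the closed form describes the intermediate results as
      -- well and bounds their sizes.
      have h1 : l' = (List.range (Min.min l'.length (l O ω x).toList.length)).map Data.num := by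
        conv_lhs => rw [List.prefix_iff_eq_take.1 hl']
        rw [← List.map_take, List.take_range]
      rw [h1, foldl_permStep]
      have h2 := (l O ω x).length_toList_le
      have h3 := hp b O hO ω x
      have h4 : Min.min l'.length (l O ω x).toList.length ≤ p.eval (x.size + b) := by omega
      refine (Data.size_ofFamily_le encodeFin _ (b := p.eval (x.size + b) + 1) fun i => ?_).trans ?_
      · have h5 := Nat.size_le_self'
          (permEquiv _ (fun i : Fin (Min.min l'.length (l O ω x).toList.length) =>
            ω (i, .pair (.num 10) (.num i))) i : ℕ)
        have h6 := (permEquiv _ (fun i : Fin (Min.min l'.length (l O ω x).toList.length) =>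
            ω (i, .pair (.num 10) (.num i))) i).2
        simp only [encodeFin, Data.size]
        omega
      · simp only [Polynomial.eval_add, Polynomial.eval_mul, Polynomial.eval_ofNat,
          Polynomial.eval_one]
        exact Nat.add_le_add_right (Nat.mul_le_mul_right _ h4) 1)
  simp only [Data.toList_ofList] at this
  exact this

/-- A random vector. -/
def sampleVec (ω : Tape) (n tag : ℕ) (l : Data) : Data :=
  .ofList (((List.range l.toList.length).map Data.num).map fun i =>
    .num (ω (n, .pair (.num tag) i)))

/-- A random matrix. -/
def sampleMat (ω : Tape) (n tag : ℕ) (l l' : Data) : Data :=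
  .ofList (((List.range l.toList.length).map Data.num).map fun i =>
    .ofList (((List.range l'.toList.length).map Data.num).map fun k =>
      .num (ω (n, .pair (.num tag) (.pair i k)))))

theorem PT.sampleVec {n l : Fn} (hn : PT n) (tag : ℕ) (hl : PT l) :
    PT fun O ω x => sampleVec ω (n O ω x).toNat tag (l O ω x) := by
  have := PT.map (F := fun O ω x i => .num (ω ((n O ω x).toNat, .pair (.num tag) i))) hl.range
    (PT.rand (hn.comp PT.id.fst) ((PT.const (.num tag)).pair PT.id.snd))
  simp only [Data.toList_ofList] at this
  exact this

theorem PT.sampleMat {n l l' : Fn} (hn : PT n) (tag : ℕ) (hl : PT l) (hl' : PT l') :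
    PT fun O ω x => sampleMat ω (n O ω x).toNat tag (l O ω x) (l' O ω x) := by
  have := PT.map (F := fun O ω x i => .ofList (((Data.ofList ((List.range
      (l' O ω x).toList.length).map Data.num)).toList).map fun k =>
      .num (ω ((n O ω x).toNat, .pair (.num tag) (.pair i k))))) hl.range
    (PT.map (F := fun O ω x k => .num (ω ((n O ω x.fst).toNat, .pair (.num tag) (.pair x.snd k))))
      (hl'.comp PT.id.fst).range (PT.rand (hn.comp PT.id.fst.fst)
        ((PT.const (.num tag)).pair (PT.id.fst.snd.pair PT.id.snd))))
  simp only [Data.toList_ofList] at this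
  exact this

theorem sampleVec_eq {ω : Tape} {n tag a : ℕ} {l : Data} (hl : l.toList.length = a) {α : Type}
    {enc : α → Data} {f : Fin a → α} (h : ∀ i, enc (f i) = .num (ω (n, .pair (.num tag) (.num i)))) :
    sampleVec ω n tag l = Data.ofFamily enc f := by
  rw [sampleVec, hl, Data.ofFamily, ← List.map_coe_finRange_eq_range, List.map_map, List.map_map,
    List.ofFn_eq_map]
  simp [Function.comp_def, h]

theorem sampleMat_eq {ω : Tape} {n tag a b : ℕ} {l l' : Data} (hl : l.toList.length = a)
    (hl' : l'.toList.length = b) {α : Type} {enc : α → Data} {f : Fin a → Fin b → α}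
    (h : ∀ i k, enc (f i k) = .num (ω (n, .pair (.num tag) (.pair (.num i) (.num k))))) :
    sampleMat ω n tag l l' = Data.ofMatrix enc f := by
  rw [sampleMat, hl, hl', Data.ofMatrix, Data.ofFamily, ← List.map_coe_finRange_eq_range,
    ← List.map_coe_finRange_eq_range, List.map_map, List.map_map, List.ofFn_eq_map]
  simp only [Function.comp_def, h, Data.ofFamily, List.ofFn_eq_map, List.map_map]

end Sampling

end FuzzyPSI

namespace FuzzyPSI

open scoped Classical BigOperators

/-! ### Programs of the simulators -/

section SimulatorPrograms

theorem PT.result {c : Code} (hc : PolyTime c) {f : Fn} (hf : PT f) :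
    PT fun O ω x => result O ω c (f O ω x) := by
  refine PT.comp (g := fun O ω x => FuzzyPSI.result O ω c x) ?_ hf
  obtain ⟨p, hp⟩ := hc
  refine ⟨c, p, fun b O hO ω x => ?_⟩
  obtain ⟨y, t, h1, h2⟩ := hp b O hO ω x
  refine ⟨t, ?_, h2⟩
  have h3 : FuzzyPSI.result O ω c x = y := result_eq h1
  rw [← h3] at h1
  exact h1

/-- The code of zero can be computed. -/
theorem exists_zeroProgram {𝔽 : ℕ → Type} [∀ s, Field (𝔽 s)] [∀ s, Fintype (𝔽 s)]
    {eF : ∀ s, 𝔽 s ≃ Fin (Fintype.card (𝔽 s))} (h : EfficientField 𝔽 eF) :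
    ∃ Z : Fn, PT Z ∧ ∀ s P M inp out ω, Z noOracles ω
      (simulatorInput s P (Fintype.card (𝔽 s)) M inp out) = encodeBy (eF s) 0 := by
  obtain ⟨⟨cadd, hadd, hadd'⟩, ⟨cneg, hneg, hneg'⟩⟩ := h
  refine ⟨fun O ω x => result O ω cadd (.pair (x.item 0) (.pair (x.item 6) (.pair (.num 0)
      (result O ω cneg (.pair (x.item 0) (.pair (x.item 6) (.num 0))))))),
    PT.result hadd ((PT.id.item 0).pair ((PT.id.item 6).pair ((PT.const _).pair
      (PT.result hneg ((PT.id.item 0).pair ((PT.id.item 6).pair (PT.const _))))))), ?_⟩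
  intro s P M inp out ω
  -- The numbering need not send zero to `0`. But some element `z` has the code `0`, and `z + (-z)`
  -- can be computed from it.
  obtain ⟨z, hz⟩ := (eF s).surjective ⟨0, Fintype.card_pos⟩
  have h0 : encodeBy (eF s) z = .num 0 := by rw [encodeBy, hz]
  obtain ⟨t, ht⟩ := hneg' s z ω
  obtain ⟨t', ht'⟩ := hadd' s z (-z) ω
  rw [h0] at ht ht'
  rw [add_neg_cancel] at ht'
  simp only [simulatorInput, Data.item_zero, Data.item_succ]
  rw [result_eq ht, result_eq ht']

/-- The state of a simulator, or of a hybrid, before the identifiers are chosen, is the list of: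
simulator input, items, `r`, `dummy`, zero, flag, key, shares of the partner, own shares, input of
the party, shares of the filtering phase, two further parts of the view, and the output. From it
and the identifiers we obtain the environment of the oracles. -/
def setupEnv (pre ids : Data) : Data :=
  .ofList [pre.item 0, pre.item 1, pre.item 2, pre.item 3, pre.item 4, pre.item 5, ids]

/-- The view in the fuzzy mapping. -/
def setupFMap (pre ids : Data) : Data :=
  .ofList [pre.item 2, pre.item 3, pre.item 6, pre.item 7, pre.item 8, ids]

/-- Environment, view and output for the sender. -/
def setupSender (z : Data) : Data :=
  .pair (setupEnv z.fst z.snd) (.pair (.ofList [z.fst.item 9, z.fst.item 11,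
    setupFMap z.fst z.snd, z.fst.item 10]) (z.fst.item 13))

/-- Environment, view and output for the receiver. -/
def setupReceiver (z : Data) : Data :=
  .pair (setupEnv z.fst z.snd) (.pair (.ofList [z.fst.item 9, setupFMap z.fst z.snd,
    z.fst.item 10, z.fst.item 11, z.fst.item 12]) (z.fst.item 13))

theorem PT.nil : PT fun _ _ _ => Data.ofList [] := PT.const _

theorem pt_setupEnv {f g : Fn} (hf : PT f) (hg : PT g) :
    PT fun O ω x => setupEnv (f O ω x) (g O ω x) :=
  (hf.item 0).pair ((hf.item 1).pair ((hf.item 2).pair ((hf.item 3).pair ((hf.item 4).pair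
    ((hf.item 5).pair (hg.pair PT.nil))))))

theorem pt_setupFMap {f g : Fn} (hf : PT f) (hg : PT g) :
    PT fun O ω x => setupFMap (f O ω x) (g O ω x) :=
  (hf.item 2).pair ((hf.item 3).pair ((hf.item 6).pair ((hf.item 7).pair ((hf.item 8).pair
    (hg.pair PT.nil)))))

theorem pt_setupSender : PT fun _ _ x => setupSender x :=
  (pt_setupEnv PT.id.fst PT.id.snd).pair (((PT.id.fst.item 9).pair ((PT.id.fst.item 11).pair
    ((pt_setupFMap PT.id.fst PT.id.snd).pair ((PT.id.fst.item 10).pair PT.nil)))).pair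
      (PT.id.fst.item 13))

theorem pt_setupReceiver : PT fun _ _ x => setupReceiver x :=
  (pt_setupEnv PT.id.fst PT.id.snd).pair (((PT.id.fst.item 9).pair
    ((pt_setupFMap PT.id.fst PT.id.snd).pair ((PT.id.fst.item 10).pair ((PT.id.fst.item 11).pair
      ((PT.id.fst.item 12).pair PT.nil))))).pair (PT.id.fst.item 13))

/-- The oracle program recomputes state and identifiers from the common tape, so its answers are
consistent with the view printed by the main program. -/
theorem exists_simulator {setup : Data → Data} (hs : PT fun _ _ x => setup x) {pre ids : Fn}
    (hpre : PT pre) (hids : PT ids) : ∃ S : Simulator, S.IsPPT ∧ ∀ x z ω, S.observation x z ω =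
      ⟨.pair (setup (.pair (pre noOracles ω x) (ids noOracles ω x))).snd.fst z,
        handlerOracles Handler.answer ω
          (setup (.pair (pre noOracles ω x) (ids noOracles ω x))).fst⟩ := by
  have h1 : PT fun O ω x => setup (.pair (pre O ω x) (ids O ω x)) := hs.comp (hpre.pair hids)
  obtain ⟨c, hc, hc'⟩ := h1.snd.fst.polyTime
  obtain ⟨c₂, hc₂, hc₂'⟩ := (Handler.pt_answer.comp
    ((h1.fst.comp PT.id.fst).pair PT.id.snd)).polyTime
  have hO : ∃ b, ∀ i q, (noOracles i q).size ≤ b := ⟨_, fun _ _ => le_rfl⟩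
  refine ⟨⟨c, c₂⟩, ⟨hc, hc₂⟩, fun x z ω => ?_⟩
  unfold Simulator.observation
  obtain ⟨t, ht⟩ := hc' noOracles hO ω x
  congr 1
  · rw [result_eq ht]
  · funext i q
    obtain ⟨t, ht⟩ := hc₂' noOracles hO ω (.pair x (.pair (.num i) q))
    rw [result_eq ht]
    rfl

/-- A list of the length to which the list of the local mapping is padded, for the set size that is
the length of the `iA`-th component. -/
def paddedList (iA : ℕ) (x : Data) : Data :=
  .ofList ((x.item iA).toList.flatMap fun _ => (Data.ofList ((x.item 3).toList.flatMap fun _ =>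
    (Data.pair (.num 0) (.ofList ((x.item 4).toList ++ (x.item 4).toList))).toList)).toList)

theorem pt_paddedList (iA : ℕ) : PT fun _ _ x => paddedList iA x :=
  PT.flatMap (F := fun _ _ x _ => Data.ofList ((x.item 3).toList.flatMap fun _ =>
    (Data.pair (.num 0) (.ofList ((x.item 4).toList ++ (x.item 4).toList))).toList)) (PT.id.item iA)
    (PT.flatMap (F := fun _ _ y _ =>
      (Data.pair (.num 0) (.ofList ((y.fst.item 4).toList ++ (y.fst.item 4).toList))))
      (PT.id.fst.item 3) ((PT.const _).pair ((PT.id.fst.fst.item 4).append (PT.id.fst.fst.item 4))))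

/-- The size of the field minus one, for an input of a simulator. -/
def fieldBound (x : Data) : Data := .num ((x.item 6).toNat - (Data.num 1).toNat)

/-- The number of keys minus one, for an input of a simulator. -/
def keyBound (x : Data) : Data := .num ((x.item 7).toNat - (Data.num 1).toNat)

theorem pt_fieldBound : PT fun _ _ x => fieldBound x := (PT.id.item 6).sub (PT.const (.num 1))

theorem pt_keyBound : PT fun _ _ x => keyBound x := (PT.id.item 7).sub (PT.const (.num 1))

/-- The state of a simulator before the identifiers are chosen. -/
def simulatedPre (Z : Fn) (iA iB flag : ℕ) (items ex₁ ex₂ : Tape → Data → Data) : Fn := fun O ω x =>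
  .ofList [x, items ω x, sampleMat ω (fieldBound x).toNat 11 (x.item iA) (x.item 3),
    sampleVec ω (fieldBound x).toNat 12 (paddedList iA x), Z O ω x, .num flag,
    .num (ω ((keyBound x).toNat, .pair (.num 13) (.num 0))),
    sampleMat ω (fieldBound x).toNat 14 (x.item iB) (x.item 3),
    sampleMat ω (fieldBound x).toNat 15 (x.item iA) (x.item 3), x.item 8,
    sampleMat ω (fieldBound x).toNat 16 (x.item 1) (x.item 3), ex₁ ω x, ex₂ ω x, .num 0]

/-- Random identifiers. -/
def simulatedIds (iA : ℕ) : Fn := fun _ ω x =>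
  sampleVec ω (fieldBound x).toNat 17 (x.item iA)

theorem pt_simulatedPre {Z : Fn} (hZ : PT Z) (iA iB flag : ℕ) {items ex₁ ex₂ : Tape → Data → Data}
    (hi : PT fun _ ω x => items ω x) (h₁ : PT fun _ ω x => ex₁ ω x) (h₂ : PT fun _ ω x => ex₂ ω x) :
    PT (simulatedPre Z iA iB flag items ex₁ ex₂) :=
  PT.id.pair (hi.pair ((PT.sampleMat pt_fieldBound 11 (PT.id.item iA) (PT.id.item 3)).pair
    ((PT.sampleVec pt_fieldBound 12 (pt_paddedList iA)).pair (hZ.pair ((PT.const _).pair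
    ((PT.rand pt_keyBound (PT.const _)).pair
    ((PT.sampleMat pt_fieldBound 14 (PT.id.item iB) (PT.id.item 3)).pair
    ((PT.sampleMat pt_fieldBound 15 (PT.id.item iA) (PT.id.item 3)).pair ((PT.id.item 8).pair
    ((PT.sampleMat pt_fieldBound 16 (PT.id.item 1) (PT.id.item 3)).pair
    (h₁.pair (h₂.pair ((PT.const _).pair PT.nil)))))))))))))

theorem pt_simulatedIds (iA : ℕ) : PT (simulatedIds iA) :=
  PT.sampleVec pt_fieldBound 17 (PT.id.item iA)

/-- The items of the sender in random order. -/
noncomputable def simulatedItems (ω : Tape) (x : Data) : Data :=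
  .ofList ((samplePerm ω (x.item 1)).toList.map fun j => (x.item 8).nth j.toNat)

theorem pt_simulatedItems : PT fun _ ω x => simulatedItems ω x :=
  PT.map (F := fun _ _ x j => (x.item 8).nth j.toNat) (PT.samplePerm (PT.id.item 1))
    ((PT.id.fst.item 8).nth_toNat PT.id.snd)

/-- The messages that the receiver obtains from the oblivious transfers. -/
noncomputable def simulatedMessages (ω : Tape) (x : Data) : Data :=
  .ofList ((samplePerm ω (x.item 1)).toList.map fun j =>
    (Data.ofList ((x.item 9).toList.map fun p => Data.pair (.num 1) p)).nth j.toNat)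

theorem pt_simulatedMessages : PT fun _ ω x => simulatedMessages ω x :=
  PT.map (F := fun _ _ x j =>
    (Data.ofList ((x.item 9).toList.map fun p => Data.pair (.num 1) p)).nth j.toNat)
    (PT.samplePerm (PT.id.item 1))
    ((PT.map (F := fun _ _ _ p => Data.pair (.num 1) p) (PT.id.fst.item 9)
      ((PT.const (.num 1)).pair PT.id.snd)).nth_toNat PT.id.snd)

/-- The results of the equality tests. -/
noncomputable def simulatedBits (ω : Tape) (x : Data) : Data :=
  .ofList ((simulatedMessages ω x).toList.map fun p => bit (¬ p = .num 0))

theorem pt_simulatedBits : PT fun _ ω x => simulatedBits ω x :=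
  PT.map (F := fun _ _ _ p => bit (¬ p = .num 0)) pt_simulatedMessages
    (PT.not (p := fun _ _ y => y.snd = .num 0) (PT.id.snd.eq (PT.const (.num 0))))

end SimulatorPrograms

end FuzzyPSI

namespace FuzzyPSI

open scoped Classical BigOperators

/-! ### The random choices of a simulator -/

/-- Random choices of the simulator of a party with `a` items and a partner with `b` items. -/
inductive Cell (P : Params) (a b : ℕ) (𝔽 : Type) : Type
  | code (i : Fin P.m)
  | key
  | r (i : Fin a) (k : Fin P.d)
  | dummy (i : Fin (listSize P a))
  | partner (j : Fin b) (k : Fin P.d)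
  | own (i : Fin a) (k : Fin P.d)
  | share (j : Fin P.m) (k : Fin P.d)
  | ident (i : Fin a)
  | map (x : MapKey P a)
  | filter (x : FilterKey P 𝔽)

section Cells

variable {P : Params} {a b : ℕ} {𝔽 K : Type}

/-- The type of the value of a random choice. -/
def Cell.Val (K : Type) : Cell P a b 𝔽 → Type
  | .code i => Fin (i.val + 1)
  | .key => K
  | _ => 𝔽

noncomputable instance [Fintype 𝔽] : Fintype (Cell P a b 𝔽) :=
  Fintype.ofSurjective (α := Fin P.m ⊕ Unit ⊕ (Fin a × Fin P.d) ⊕ Fin (listSize P a) ⊕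
      (Fin b × Fin P.d) ⊕ (Fin a × Fin P.d) ⊕ (Fin P.m × Fin P.d) ⊕ Fin a ⊕ MapKey P a ⊕
      FilterKey P 𝔽)
    (Sum.elim .code <| Sum.elim (fun _ => .key) <| Sum.elim (fun p => .r p.1 p.2) <|
      Sum.elim .dummy <| Sum.elim (fun p => .partner p.1 p.2) <| Sum.elim (fun p => .own p.1 p.2) <|
      Sum.elim (fun p => .share p.1 p.2) <| Sum.elim .ident <| Sum.elim .map .filter) (by
    intro c
    cases c with
    | code i => exact ⟨.inl i, rfl⟩
    | key => exact ⟨.inr (.inl ()), rfl⟩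
    | r i k => exact ⟨.inr (.inr (.inl (i, k))), rfl⟩
    | dummy i => exact ⟨.inr (.inr (.inr (.inl i))), rfl⟩
    | partner j k => exact ⟨.inr (.inr (.inr (.inr (.inl (j, k))))), rfl⟩
    | own i k => exact ⟨.inr (.inr (.inr (.inr (.inr (.inl (i, k)))))), rfl⟩
    | share j k => exact ⟨.inr (.inr (.inr (.inr (.inr (.inr (.inl (j, k))))))), rfl⟩
    | ident i => exact ⟨.inr (.inr (.inr (.inr (.inr (.inr (.inr (.inl i))))))), rfl⟩
    | map x => exact ⟨.inr (.inr (.inr (.inr (.inr (.inr (.inr (.inr (.inl x)))))))), rfl⟩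
    | filter x => exact ⟨.inr (.inr (.inr (.inr (.inr (.inr (.inr (.inr (.inr x)))))))), rfl⟩)

noncomputable instance [Fintype 𝔽] [Fintype K] : (c : Cell P a b 𝔽) → Fintype (c.Val K)
  | .code i => inferInstanceAs (Fintype (Fin (i.val + 1)))
  | .key => inferInstanceAs (Fintype K)
  | .r .. | .dummy .. | .partner .. | .own .. | .share .. | .ident .. | .map .. | .filter .. =>
    inferInstanceAs (Fintype 𝔽)

instance [Nonempty 𝔽] [Nonempty K] : (c : Cell P a b 𝔽) → Nonempty (c.Val K)
  | .code i => inferInstanceAs (Nonempty (Fin (i.val + 1)))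
  | .key => inferInstanceAs (Nonempty K)
  | .r .. | .dummy .. | .partner .. | .own .. | .share .. | .ident .. | .map .. | .filter .. =>
    inferInstanceAs (Nonempty 𝔽)

/-- The address on the random tape. -/
def Cell.address {N : ℕ} (e : 𝔽 ≃ Fin N) (M : ℕ) : Cell P a b 𝔽 → ℕ × Data
  | .code i => (i, .pair (.num 10) (.num i))
  | .key => (M - 1, .pair (.num 13) (.num 0))
  | .r i k => (N - 1, .pair (.num 11) (.pair (.num i) (.num k)))
  | .dummy i => (N - 1, .pair (.num 12) (.num i))
  | .partner j k => (N - 1, .pair (.num 14) (.pair (.num j) (.num k)))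
  | .own i k => (N - 1, .pair (.num 15) (.pair (.num i) (.num k)))
  | .share j k => (N - 1, .pair (.num 16) (.pair (.num j) (.num k)))
  | .ident i => (N - 1, .pair (.num 17) (.num i))
  | .map x => (N - 1, .pair (.num 1) (encodeMapKey x))
  | .filter x => (N - 1, .pair (.num 2) (encodeFilterKey e x))

/-- Different kinds of random choices have different tags, and within a kind the address contains
the index. Hence the cells are independent. -/
theorem Cell.address_injective {N : ℕ} (e : 𝔽 ≃ Fin N) (M : ℕ) :
    Function.Injective (Cell.address e M : Cell P a b 𝔽 → ℕ × Data) := by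
  intro c c' h
  have h2 := congrArg Prod.snd h
  clear h
  cases c <;> cases c' <;>
    simp only [Cell.address, Data.pair.injEq, Data.num.injEq, Nat.reduceEqDiff, false_and,
      true_and, OfNat.ofNat_ne_one, OfNat.one_ne_ofNat, ← Fin.ext_iff, encodeMapKey_injective.eq_iff,
      (encodeFilterKey_injective e).eq_iff] at h2 <;>
    first | rfl | (obtain ⟨rfl, rfl⟩ := h2; rfl)

theorem sub_one_add_one_of_equiv {α : Type} [Nonempty α] {N : ℕ} (e : α ≃ Fin N) : N = N - 1 + 1 := by
  have := (e (Classical.arbitrary α)).pos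
  omega

/-- Values correspond to the contents of the tape. -/
noncomputable def Cell.valEquiv [Nonempty 𝔽] [Nonempty K] {N M : ℕ} (e : 𝔽 ≃ Fin N) (eK : K ≃ Fin M) :
    (c : Cell P a b 𝔽) → c.Val K ≃ Fin ((c.address e M).1 + 1)
  | .code i => Equiv.refl (Fin (i.val + 1))
  | .key => eK.trans (finCongr (sub_one_add_one_of_equiv eK))
  | .r .. | .dummy .. | .partner .. | .own .. | .share .. | .ident .. | .map .. | .filter .. =>
    e.trans (finCongr (sub_one_add_one_of_equiv e))

/-- A joint outcome of all random choices. -/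
abbrev Sample (P : Params) (a b : ℕ) (𝔽 K : Type) : Type := (c : Cell P a b 𝔽) → c.Val K

/-- The outcome that is written on the tape. -/
noncomputable def readSample [Nonempty 𝔽] [Nonempty K] {N M : ℕ} (e : 𝔽 ≃ Fin N) (eK : K ≃ Fin M)
    (ω : Tape) : Sample P a b 𝔽 K := fun c => (Cell.valEquiv e eK c).symm (ω (c.address e M))

theorem encodeBy_symm {α : Type} [Nonempty α] {N : ℕ} (e : α ≃ Fin N) (t : Fin (N - 1 + 1)) :
    encodeBy e ((e.trans (finCongr (sub_one_add_one_of_equiv e))).symm t) = .num t := by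
  simp [encodeBy]

namespace Sample

variable (v : Sample P a b 𝔽 K)

def r (i : Fin a) (k : Fin P.d) : 𝔽 := v (.r i k)
def dummy (i : Fin (listSize P a)) : 𝔽 := v (.dummy i)
def key : K := v .key
def partner (j : Fin b) (k : Fin P.d) : 𝔽 := v (.partner j k)
def own (i : Fin a) (k : Fin P.d) : 𝔽 := v (.own i k)
def share (j : Fin P.m) (k : Fin P.d) : 𝔽 := v (.share j k)
def ident (i : Fin a) : 𝔽 := v (.ident i)
def map (x : MapKey P a) : 𝔽 := v (.map x)
def filter (x : FilterKey P 𝔽) : 𝔽 := v (.filter x)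
def order : Equiv.Perm (Fin P.m) := permEquiv P.m fun i => v (.code i)

/-- The view in the fuzzy mapping. -/
noncomputable def fmap [Field 𝔽] [Fintype 𝔽] (x : Fin a → Point P) : FMapView P a b 𝔽 K where
  r := v.r
  dummy := v.dummy
  key := v.key
  partnerShare := v.partner
  fn := program (localList x v.r v.dummy) v.map
  ownShare := v.own
  ident := v.ident

end Sample

/-- The data of a party before the identifiers are chosen, in the form that `setupEnv` and
`setupFMap` expect. -/
def preData [Field 𝔽] {N M : ℕ} (e : 𝔽 ≃ Fin N) (eK : K ≃ Fin M) (inp : Data) (x : Fin a → Point P)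
    (flag : ℕ) (r : Fin a → Fin P.d → 𝔽) (dummy : Fin (listSize P a) → 𝔽) (key : K)
    (partner : Fin b → Fin P.d → 𝔽) (own : Fin a → Fin P.d → 𝔽) (input : Data)
    (share : Fin P.m → Fin P.d → 𝔽) (ex₁ ex₂ z : Data) : Data :=
  .ofList [inp, Data.ofFamily encodePoint x, Data.ofMatrix (encodeBy e) r,
    Data.ofFamily (encodeBy e) dummy, encodeBy e 0, .num flag, encodeBy eK key,
    Data.ofMatrix (encodeBy e) partner, Data.ofMatrix (encodeBy e) own, input,
    Data.ofMatrix (encodeBy e) share, ex₁, ex₂, z]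

theorem length_paddedList {iA : ℕ} {x : Data} (ha : (x.item iA).toList.length = a)
    (hd : (x.item 3).toList.length = P.d) (hδ : (x.item 4).toList.length = P.δ) :
    (paddedList iA x).toList.length = listSize P a := by
  simp only [paddedList, Data.toList_ofList, Data.toList, List.length_flatMap, List.map_const',
    List.sum_replicate, smul_eq_mul, List.length_cons, List.length_append, ha, hd, hδ]
  rw [listSize, mul_assoc, two_mul]

theorem samplePerm_eq [Nonempty 𝔽] [Nonempty K] {N M : ℕ} (e : 𝔽 ≃ Fin N) (eK : K ≃ Fin M) (ω : Tape)
    {l : Data} (hl : l.toList.length = P.m) :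
    samplePerm ω l = Data.ofFamily encodeFin (readSample e eK ω : Sample P a b 𝔽 K).order := by
  rw [samplePerm, hl, foldl_permStep]
  rfl

theorem simulatedIds_eq [Nonempty 𝔽] [Nonempty K] {N M : ℕ} (e : 𝔽 ≃ Fin N) (eK : K ≃ Fin M) (ω : Tape)
    {s : ℕ} {inp out : Data} {iA : ℕ}
    (ha : ((simulatorInput s P N M inp out).item iA).toList.length = a) :
    simulatedIds iA noOracles ω (simulatorInput s P N M inp out) =
      Data.ofFamily (encodeBy e) (readSample e eK ω : Sample P a b 𝔽 K).ident :=
  sampleVec_eq ha fun _ => encodeBy_symm e _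

theorem simulatedPre_eq [Field 𝔽] [Nonempty K] {N M : ℕ} (e : 𝔽 ≃ Fin N) (eK : K ≃ Fin M) (ω : Tape)
    {s : ℕ} {inp out : Data} {iA iB flag : ℕ} {Z : Fn} {items ex₁ ex₂ : Tape → Data → Data}
    (ha : ((simulatorInput s P N M inp out).item iA).toList.length = a)
    (hb : ((simulatorInput s P N M inp out).item iB).toList.length = b)
    (hZ : Z noOracles ω (simulatorInput s P N M inp out) = encodeBy e 0)
    {x : Fin a → Point P}
    (hx : items ω (simulatorInput s P N M inp out) = Data.ofFamily encodePoint x) :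
    simulatedPre Z iA iB flag items ex₁ ex₂ noOracles ω (simulatorInput s P N M inp out) =
      preData e eK (simulatorInput s P N M inp out) x flag
        (readSample e eK ω : Sample P a b 𝔽 K).r (readSample e eK ω : Sample P a b 𝔽 K).dummy
        (readSample e eK ω : Sample P a b 𝔽 K).key (readSample e eK ω : Sample P a b 𝔽 K).partner
        (readSample e eK ω : Sample P a b 𝔽 K).own inp
        (readSample e eK ω : Sample P a b 𝔽 K).share
        (ex₁ ω (simulatorInput s P N M inp out)) (ex₂ ω (simulatorInput s P N M inp out))
        (.num 0) := by
  have hm : ((simulatorInput s P N M inp out).item 1).toList.length = P.m := Data.length_unary _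
  have hd : ((simulatorInput s P N M inp out).item 3).toList.length = P.d := Data.length_unary _
  have hδ : ((simulatorInput s P N M inp out).item 4).toList.length = P.δ := Data.length_unary _
  have hN : (fieldBound (simulatorInput s P N M inp out)).toNat = N - 1 := rfl
  have hM : (keyBound (simulatorInput s P N M inp out)).toNat = M - 1 := rfl
  let v : Sample P a b 𝔽 K := readSample e eK ω
  unfold simulatedPre preData
  rw [hZ, hx, hN, hM, sampleMat_eq (enc := encodeBy e) (f := v.r) ha hd fun _ _ => encodeBy_symm e _,
    sampleMat_eq (enc := encodeBy e) (f := v.partner) hb hd fun _ _ => encodeBy_symm e _,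
    sampleMat_eq (enc := encodeBy e) (f := v.own) ha hd fun _ _ => encodeBy_symm e _,
    sampleMat_eq (enc := encodeBy e) (f := v.share) hm hd fun _ _ => encodeBy_symm e _,
    sampleVec_eq (enc := encodeBy e) (f := v.dummy) (length_paddedList ha hd hδ)
      fun _ => encodeBy_symm e _,
    show Data.num (ω (M - 1, .pair (.num 13) (.num 0))) = encodeBy eK v.key from
      (encodeBy_symm eK _).symm]
  rfl

/-- The simulator's coins are replaced by a uniform element of a finite product, the form in which
they are compared with `Coins`. -/
theorem integral_readSample [Fintype 𝔽] [Fintype K] [Nonempty 𝔽] [Nonempty K] {N M : ℕ} (e : 𝔽 ≃ Fin N)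
    (eK : K ≃ Fin M) (f : Sample P a b 𝔽 K → ℝ≥0∞) (hf : ∀ v, f v ≤ 1) :
    (∫⁻ ω, f (readSample e eK ω) ∂tapeMeasure).toReal = 𝔼 v, (f v).toReal :=
  lintegral_cells_toReal (Cell.address e M) (Cell.address_injective e M) (Cell.valEquiv e eK) f hf

end Cells

end FuzzyPSI

namespace FuzzyPSI

open scoped Classical BigOperators

/-! ### The simulators -/

/-- The probability that `D` with advice `a` accepts an observation. -/
noncomputable def accept (s : ℕ) (D : Code) (a : Data) (o : Observation) : ℝ≥0∞ :=
  acceptProb o.oracles D (.pair (Data.unary s) (.pair a o.data))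

theorem accept_le_one (s : ℕ) (D : Code) (a : Data) (o : Observation) : accept s D a o ≤ 1 :=
  acceptProb_le_one _ _ _

theorem accept_toReal_mem (s : ℕ) (D : Code) (a : Data) (o : Observation) :
    0 ≤ (accept s D a o).toReal ∧ (accept s D a o).toReal ≤ 1 :=
  ⟨ENNReal.toReal_nonneg, ENNReal.toReal_le_of_le_ofReal zero_le_one
    (by simpa using accept_le_one s D a o)⟩

/-! ### Views as observations, and the values computed by the simulators -/

section Views

variable {P : Params} {𝔽 K : Type} {N M : ℕ}

/-- What a distinguisher sees for a view of the sender and a set of points. -/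
noncomputable def obsSender (e : 𝔽 ≃ Fin N) (eK : K ≃ Fin M) (v : SenderView P 𝔽 K)
    (Z : Finset (Point P)) : Observation where
  data := .pair
    (.ofList [Data.ofFamily encodePoint v.input, Data.ofFamily encodeFin v.order,
      encodeFMapView e eK v.fmap, Data.ofMatrix (encodeBy e) v.share])
    (encodeSet Z)
  oracles := oneOracle (oracleOf encodeMapKey (encodeBy e) v.fmap.fn)

/-- What a distinguisher sees for a view of the receiver and a set of points. -/
noncomputable def obsReceiver (e : 𝔽 ≃ Fin N) (eK : K ≃ Fin M) (v : ReceiverView P 𝔽 K)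
    (Z : Finset (Point P)) : Observation where
  data := .pair
    (.ofList [Data.ofFamily encodePoint v.input, encodeFMapView e eK v.fmap,
      Data.ofMatrix (encodeBy e) v.share,
      Data.ofFamily (fun b : Bool => Data.ofProp (b = true)) v.bits,
      Data.ofFamily
        (fun z : Option (Point P) => z.elim (.num 0) fun x => .pair (.num 1) (encodePoint x))
        v.items])
    (encodeSet Z)
  oracles := twoOracles (oracleOf encodeMapKey (encodeBy e) v.fmap.fn)
    (oracleOf (encodeFilterKey e) (encodeBy e) v.fn)

/-- The encoding is transparent: it lists each point of the set once, so a simulator can read the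
points off its input. -/
theorem exists_list_of_encodeSet (Z : Finset (Point P)) : ∃ l : List (Point P), l.Nodup ∧
    (∀ p, p ∈ l ↔ p ∈ Z) ∧ encodeSet Z = .ofList (l.map encodePoint) := by
  set L := (Z.image fun x => List.ofFn x).sort (· ≤ ·) with hL
  have h1 : L ∈ Set.range (List.map fun x : Point P => List.ofFn x) := by
    rw [Set.range_list_map]
    intro l hl
    rw [hL, Finset.mem_sort] at hl
    obtain ⟨x, -, hx⟩ := Finset.mem_image.1 hl
    exact ⟨x, hx⟩
  obtain ⟨l, hl⟩ := h1
  refine ⟨l, List.Nodup.of_map (fun x : Point P => List.ofFn x) (hl ▸ Finset.sort_nodup _ _),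
    fun p => ?_, ?_⟩
  · have : List.ofFn p ∈ L ↔ p ∈ Z := by
      rw [hL, Finset.mem_sort, Finset.mem_image]
      constructor
      · rintro ⟨x, hx, h⟩
        rwa [← List.ofFn_injective h]
      · exact fun h => ⟨p, h, rfl⟩
    rw [← this, ← hl, List.mem_map]
    constructor
    · exact fun h => ⟨p, h, rfl⟩
    · rintro ⟨x, hx, h⟩
      rwa [← List.ofFn_injective h]
  · rw [encodeSet, ← hL, ← hl, List.map_map]
    congr 2
    funext x
    simp only [Function.comp_apply, encodePoint, Data.ofFamily, List.map_ofFn]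
    rfl

/-- The points of a set, in the order of its encoding. -/
noncomputable def pointList (Z : Finset (Point P)) : List (Point P) :=
  (exists_list_of_encodeSet Z).choose

theorem nodup_pointList (Z : Finset (Point P)) : (pointList Z).Nodup :=
  (exists_list_of_encodeSet Z).choose_spec.1

theorem mem_pointList (Z : Finset (Point P)) (p : Point P) : p ∈ pointList Z ↔ p ∈ Z :=
  (exists_list_of_encodeSet Z).choose_spec.2.1 p

theorem encodeSet_eq (Z : Finset (Point P)) : encodeSet Z = .ofList ((pointList Z).map encodePoint) :=
  (exists_list_of_encodeSet Z).choose_spec.2.2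

namespace Sample

variable [Field 𝔽] [Fintype 𝔽]

/-- The simulated view of the sender. -/
noncomputable def senderView (v : Sample P P.m P.n 𝔽 K) (Q : Fin P.m → Point P) : SenderView P 𝔽 K where
  input := Q
  order := v.order
  fmap := v.fmap fun j => Q (v.order j)
  share := v.share

/-- The simulated view of the receiver. -/
noncomputable def receiverView (v : Sample P P.n P.m 𝔽 K) (W : Fin P.n → Point P)
    (Z : Finset (Point P)) : ReceiverView P 𝔽 K where
  input := W
  fmap := v.fmap W
  share := v.share
  fn := program (filterList W v.ident) v.filter
  bits j := (pointList Z)[(v.order j).val]?.isSome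
  items j := (pointList Z)[(v.order j).val]?

end Sample

variable {e : 𝔽 ≃ Fin N} {eK : K ≃ Fin M} {s : ℕ} {ω : Tape}

theorem length_item_one {inp out : Data} :
    ((simulatorInput s P N M inp out).item 1).toList.length = P.m := Data.length_unary _

theorem length_item_two {inp out : Data} :
    ((simulatorInput s P N M inp out).item 2).toList.length = P.n := Data.length_unary _

theorem simulatedItems_eq [Nonempty 𝔽] [Nonempty K] {a b : ℕ} (Q : Fin P.m → Point P) (out : Data) :
    simulatedItems ω (simulatorInput s P N M (Data.ofFamily encodePoint Q) out) =
      Data.ofFamily encodePoint fun j =>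
        Q ((readSample e eK ω : Sample P a b 𝔽 K).order j) := by
  unfold simulatedItems
  rw [samplePerm_eq (a := a) (b := b) e eK ω length_item_one]
  simp only [Data.ofFamily, Data.toList_ofList, List.map_ofFn]
  congr 2
  funext j
  exact Data.nth_ofFamily encodePoint Q _

theorem simulatedMessages_eq [Nonempty 𝔽] [Nonempty K] {a b : ℕ} (inp : Data) (Z : Finset (Point P)) :
    simulatedMessages ω (simulatorInput s P N M inp (encodeSet Z)) =
      Data.ofFamily
        (fun z : Option (Point P) => z.elim (.num 0) fun x => .pair (.num 1) (encodePoint x))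
        fun j => (pointList Z)[((readSample e eK ω : Sample P a b 𝔽 K).order j).val]? := by
  unfold simulatedMessages
  rw [samplePerm_eq (a := a) (b := b) e eK ω length_item_one]
  have h : (simulatorInput s P N M inp (encodeSet Z)).item 9 = encodeSet Z := rfl
  rw [h, encodeSet_eq]
  simp only [Data.ofFamily, Data.toList_ofList, List.map_ofFn, List.map_map]
  congr 2
  funext j
  simp only [Function.comp_apply, encodeFin, Data.toNat_num, Data.nth, Data.toList_ofList,
    List.getD_eq_getElem?_getD, List.getElem?_map]
  rcases (pointList Z)[((readSample e eK ω : Sample P a b 𝔽 K).order j).val]? <;> rfl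

theorem simulatedBits_eq [Nonempty 𝔽] [Nonempty K] {a b : ℕ} (inp : Data) (Z : Finset (Point P)) :
    simulatedBits ω (simulatorInput s P N M inp (encodeSet Z)) =
      Data.ofFamily (fun b : Bool => Data.ofProp (b = true))
        fun j => (pointList Z)[((readSample e eK ω : Sample P a b 𝔽 K).order j).val]?.isSome := by
  unfold simulatedBits
  rw [simulatedMessages_eq (a := a) (b := b) (e := e) (eK := eK)]
  simp only [Data.ofFamily, Data.toList_ofList, List.map_ofFn]
  congr 2
  funext j
  simp only [Function.comp_apply, ofProp_eq_bit]
  rcases (pointList Z)[((readSample e eK ω : Sample P a b 𝔽 K).order j).val]? with _ | x <;>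
    simp

theorem setupSender_eq [Field 𝔽] {a b : ℕ} {inp : Data} {x : Fin a → Point P} {flag : ℕ}
    {r : Fin a → Fin P.d → 𝔽} {dummy : Fin (listSize P a) → 𝔽} {key : K}
    {partner : Fin b → Fin P.d → 𝔽} {own : Fin a → Fin P.d → 𝔽} {input : Data}
    {share : Fin P.m → Fin P.d → 𝔽} {ex₁ ex₂ z ids : Data} :
    setupSender (.pair (preData e eK inp x flag r dummy key partner own input share ex₁ ex₂ z) ids) =
      .pair (handlerEnv e inp x r dummy flag ids) (.pair (.ofList [input, ex₁,
        .ofList [Data.ofMatrix (encodeBy e) r, Data.ofFamily (encodeBy e) dummy,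
          encodeBy eK key, Data.ofMatrix (encodeBy e) partner,
          Data.ofMatrix (encodeBy e) own, ids], Data.ofMatrix (encodeBy e) share]) z) := rfl

theorem setupReceiver_eq [Field 𝔽] {a b : ℕ} {inp : Data} {x : Fin a → Point P} {flag : ℕ}
    {r : Fin a → Fin P.d → 𝔽} {dummy : Fin (listSize P a) → 𝔽} {key : K}
    {partner : Fin b → Fin P.d → 𝔽} {own : Fin a → Fin P.d → 𝔽} {input : Data}
    {share : Fin P.m → Fin P.d → 𝔽} {ex₁ ex₂ z ids : Data} :
    setupReceiver (.pair (preData e eK inp x flag r dummy key partner own input share ex₁ ex₂ z) ids) =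
      .pair (handlerEnv e inp x r dummy flag ids) (.pair (.ofList [input,
        .ofList [Data.ofMatrix (encodeBy e) r, Data.ofFamily (encodeBy e) dummy,
          encodeBy eK key, Data.ofMatrix (encodeBy e) partner,
          Data.ofMatrix (encodeBy e) own, ids], Data.ofMatrix (encodeBy e) share, ex₁, ex₂]) z) := rfl

end Views

/-! ### Simulators that turn a uniform sample into a view -/

section Simulators

variable {P : ℕ → Params} {𝔽 K : ℕ → Type} [∀ s, Field (𝔽 s)] [∀ s, Fintype (𝔽 s)]
  [∀ s, AddCommGroup (K s)] [∀ s, Fintype (K s)]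
  {eF : ∀ s, 𝔽 s ≃ Fin (Fintype.card (𝔽 s))}

theorem exists_simSender (hfield : EfficientField 𝔽 eF)
    (eK : ∀ s, K s ≃ Fin (Fintype.card (K s))) : ∃ S : Simulator, S.IsPPT ∧
    ∀ s (Q : Fin (P s).m → Point (P s)) (Z : Finset (Point (P s))) ω,
      S.observation (simulatorInput s (P s) (Fintype.card (𝔽 s)) (Fintype.card (K s))
        (Data.ofFamily encodePoint Q) (.num 0)) (encodeSet Z) ω =
      obsSender (eF s) (eK s) ((readSample (eF s) (eK s) ω :
        Sample (P s) (P s).m (P s).n (𝔽 s) (K s)).senderView Q) Z := by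
  obtain ⟨Zp, hZ, hZ'⟩ := exists_zeroProgram hfield
  obtain ⟨S, hS, hS'⟩ := exists_simulator pt_setupSender (pt_simulatedPre hZ 1 2 0
    pt_simulatedItems (ex₁ := fun ω x => samplePerm ω (x.item 1))
    (ex₂ := fun _ _ => .num 0) (PT.samplePerm (PT.id.item 1)) (PT.const (.num 0))) (pt_simulatedIds 1)
  refine ⟨S, hS, fun s Q Z ω => ?_⟩
  rw [hS', simulatedPre_eq (a := (P s).m) (b := (P s).n) (eF s) (eK s) ω length_item_one
      length_item_two (hZ' ..) (simulatedItems_eq (a := (P s).m) (b := (P s).n)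
      (e := eF s) (eK := eK s) _ _),
    simulatedIds_eq (a := (P s).m) (b := (P s).n) (eF s) (eK s) ω length_item_one,
    setupSender_eq, samplePerm_eq (a := (P s).m) (b := (P s).n) (eF s) (eK s) ω
      length_item_one]
  simp only [Data.fst_pair, Data.snd_pair]
  rw [Handler.oracles_sender (ρ := (readSample (eF s) (eK s) ω :
    Sample (P s) (P s).m (P s).n (𝔽 s) (K s)).map) fun key => encodeBy_symm (eF s) _]
  rfl

/-- Only the ideal output is used for the messages: the points of `Z` are placed at random
positions, and position `j` stays empty if its index exceeds the list. -/
theorem exists_simReceiver (hfield : EfficientField 𝔽 eF)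
    (eK : ∀ s, K s ≃ Fin (Fintype.card (K s))) : ∃ S : Simulator, S.IsPPT ∧
    ∀ s (W : Fin (P s).n → Point (P s)) (Z : Finset (Point (P s))) ω,
      S.observation (simulatorInput s (P s) (Fintype.card (𝔽 s)) (Fintype.card (K s))
        (Data.ofFamily encodePoint W) (encodeSet Z)) (encodeSet Z) ω =
      obsReceiver (eF s) (eK s) ((readSample (eF s) (eK s) ω :
        Sample (P s) (P s).n (P s).m (𝔽 s) (K s)).receiverView W Z) Z := by
  obtain ⟨Zp, hZ, hZ'⟩ := exists_zeroProgram hfield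
  obtain ⟨S, hS, hS'⟩ := exists_simulator pt_setupReceiver (pt_simulatedPre hZ 2 1 1
    (items := fun _ x => x.item 8) (PT.id.item 8) pt_simulatedBits pt_simulatedMessages)
    (pt_simulatedIds 2)
  refine ⟨S, hS, fun s W Z ω => ?_⟩
  rw [hS', simulatedPre_eq (a := (P s).n) (b := (P s).m) (eF s) (eK s) ω length_item_two
      length_item_one (hZ' ..) (x := W) rfl,
    simulatedIds_eq (a := (P s).n) (b := (P s).m) (eF s) (eK s) ω length_item_two,
    setupReceiver_eq, simulatedBits_eq (a := (P s).n) (b := (P s).m) (e := eF s) (eK := eK s),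
    simulatedMessages_eq (a := (P s).n) (b := (P s).m) (e := eF s) (eK := eK s)]
  simp only [Data.fst_pair, Data.snd_pair]
  rw [Handler.oracles_receiver (ρ₁ := (readSample (eF s) (eK s) ω :
      Sample (P s) (P s).n (P s).m (𝔽 s) (K s)).map) (fun key => encodeBy_symm (eF s) _)
    (ρ₂ := (readSample (eF s) (eK s) ω :
      Sample (P s) (P s).n (P s).m (𝔽 s) (K s)).filter) fun key => encodeBy_symm (eF s) _]
  rfl

end Simulators

end FuzzyPSI

namespace FuzzyPSI

open scoped Classical BigOperators

/-! ### Replacing the pseudorandom function -/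

/-! ### Polynomial bounds for the sizes of inputs and simulator states -/

section Sizes

theorem Data.size_ofList_le {l : List Data} {n b : ℕ} (hn : l.length ≤ n) (h : ∀ e ∈ l, e.size ≤ b) :
    (Data.ofList l).size ≤ n * (b + 1) + 1 := by
  rw [Data.size_ofList]
  have h1 := List.sum_le_card_nsmul (l.map fun e => e.size + 1) (b + 1)
    (by simp only [List.mem_map]; rintro _ ⟨e, he, rfl⟩; have := h e he; omega)
  simp only [List.length_map, smul_eq_mul] at h1
  have := Nat.mul_le_mul_right (b + 1) hn
  omega

theorem Data.size_ofFamily_le' {n t : ℕ} (hn : n ≤ t) {α : Type} (enc : α → Data) (f : Fin n → α) {b : ℕ}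
    (h : ∀ i, (enc (f i)).size ≤ b) : (Data.ofFamily enc f).size ≤ t * (b + 1) + 1 :=
  Data.size_ofList_le (by simpa using hn) (by
    simp only [List.mem_ofFn]; rintro _ ⟨i, rfl⟩; exact h i)

theorem Data.size_unary (n : ℕ) : (Data.unary n).size = 2 * n + 1 := by
  rw [Data.unary, Data.size_ofList]
  simp [Data.size]; ring

variable {P : Params} {𝔽 K : Type} {N M t : ℕ} {e : 𝔽 ≃ Fin N}

/-- All parameters are bounded by `t`. -/
structure Bounded (P : Params) (N M s t : ℕ) : Prop where
  s : s ≤ t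
  m : P.m ≤ t
  n : P.n ≤ t
  d : P.d ≤ t
  δ : P.δ ≤ t
  u : Nat.size P.u ≤ t
  N : Nat.size N ≤ t
  M : Nat.size M ≤ t

variable {s : ℕ} (h : Bounded P N M s t)
include h

theorem Bounded.encodeBy (x : 𝔽) : (encodeBy e x).size ≤ t + 1 :=
  (size_encodeBy_le e x).trans (Nat.add_le_add_right h.N 1)

theorem Bounded.encodePoint (x : Point P) : (encodePoint x).size ≤ t * (t + 2) + 1 :=
  Data.size_ofFamily_le' h.d _ _ fun k => by
    have h1 := Nat.size_le_size (x k).2.le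
    have h2 := h.u
    simp only [encodeFin, Data.size]; omega

theorem Bounded.ofFamily {a : ℕ} (ha : a ≤ t) (f : Fin a → 𝔽) :
    (Data.ofFamily (FuzzyPSI.encodeBy e) f).size ≤ t * (t + 2) + 1 :=
  Data.size_ofFamily_le' ha _ _ fun _ => h.encodeBy _

theorem Bounded.ofMatrix {a : ℕ} (ha : a ≤ t) (f : Fin a → Fin P.d → 𝔽) :
    (Data.ofMatrix (FuzzyPSI.encodeBy e) f).size ≤ t * (t * (t + 2) + 2) + 1 :=
  Data.size_ofFamily_le' ha _ _ fun _ => h.ofFamily h.d _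

theorem Bounded.points {a : ℕ} (ha : a ≤ t) (x : Fin a → Point P) :
    (Data.ofFamily FuzzyPSI.encodePoint x).size ≤ t * (t * (t + 2) + 2) + 1 :=
  Data.size_ofFamily_le' ha _ _ fun _ => h.encodePoint _

theorem Bounded.encodeSet {Z : Finset (Point P)} (hZ : Z.card ≤ t) :
    (encodeSet Z).size ≤ t * (t * (t + 2) + 2) + 1 := by
  have h1 : (pointList Z).toFinset = Z := by ext p; simp [mem_pointList]
  rw [encodeSet_eq]
  refine Data.size_ofList_le ?_ ?_
  · rw [List.length_map, ← List.toFinset_card_of_nodup (nodup_pointList Z), h1]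
    exact hZ
  · simp only [List.mem_map]
    rintro _ ⟨x, -, rfl⟩
    exact h.encodePoint x

theorem Bounded.simulatorInput {inp out : Data} {C : ℕ} (h₁ : inp.size ≤ C) (h₂ : out.size ≤ C) :
    (simulatorInput s P N M inp out).size ≤ 10 * (2 * t + 1 + C + 1) + 1 := by
  obtain ⟨hs, hm, hn, hd, hδ, hu, hN, hM⟩ := h
  refine Data.size_ofList_le (b := 2 * t + 1 + C) (by simp) ?_
  simp only [List.mem_cons, List.not_mem_nil, or_false]
  rintro e (rfl | rfl | rfl | rfl | rfl | rfl | rfl | rfl | rfl | rfl) <;>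
    (try simp only [Data.size_unary, Data.size]) <;> omega

/-- A bound for the size of the state of a simulator. -/
def preBound (t : ℕ) : ℕ :=
  let C := t * (t * (t + 2) + 2) + 1
  14 * (10 * (2 * t + 1 + C + 1) + 1 + (t * t * (2 * t + 1) * (t + 2) + 1) + C + (t + 1) + 2 + 1) + 1

theorem Bounded.preData [Field 𝔽] {a b : ℕ} (ha : a ≤ t) (hb : b ≤ t) {eK : K ≃ Fin M}
    {inp out : Data} {x : Fin a → Point P} {flag : ℕ} (hflag : flag ≤ 1)
    {r : Fin a → Fin P.d → 𝔽} {dummy : Fin (listSize P a) → 𝔽} {key : K}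
    {partner : Fin b → Fin P.d → 𝔽} {own : Fin a → Fin P.d → 𝔽}
    {share : Fin P.m → Fin P.d → 𝔽} {ex₁ ex₂ z : Data}
    (hinp : inp.size ≤ t * (t * (t + 2) + 2) + 1) (hout : out.size ≤ t * (t * (t + 2) + 2) + 1)
    (h₁ : ex₁.size ≤ t * (t * (t + 2) + 2) + 1) (h₂ : ex₂.size ≤ t * (t * (t + 2) + 2) + 1)
    (hz : z.size ≤ t * (t * (t + 2) + 2) + 1) :
    (preData e eK (FuzzyPSI.simulatorInput s P N M inp out) x flag r dummy key partner own inp share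
      ex₁ ex₂ z).size ≤ preBound t := by
  have i1 := h.simulatorInput hinp hout
  have i2 := h.points ha x
  have i3 := h.ofMatrix (e := e) ha r
  have i4 : (Data.ofFamily (FuzzyPSI.encodeBy e) dummy).size ≤
      t * t * (2 * t + 1) * (t + 2) + 1 := Data.size_ofFamily_le' (n := listSize P a) (t := t * t * (2 * t + 1)) (by
    unfold listSize
    exact Nat.mul_le_mul (Nat.mul_le_mul ha h.d) (by have := h.δ; omega)) (FuzzyPSI.encodeBy e) dummy
    fun i => h.encodeBy _
  have i5 := h.encodeBy (e := e) 0
  have i6 : (Data.num flag).size ≤ 2 := by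
    have := Nat.size_le_self' flag
    simp only [Data.size]; omega
  have i7 : (FuzzyPSI.encodeBy eK key).size ≤ t + 1 :=
    (size_encodeBy_le eK key).trans (Nat.add_le_add_right h.M 1)
  have i8 := h.ofMatrix (e := e) hb partner
  have i9 := h.ofMatrix (e := e) ha own
  have i10 := h.ofMatrix (e := e) h.m share
  refine Data.size_ofList_le (n := 14) (by simp) ?_
  simp only [List.mem_cons, List.not_mem_nil, or_false]
  rintro d (rfl | rfl | rfl | rfl | rfl | rfl | rfl | rfl | rfl | rfl | rfl | rfl | rfl | rfl) <;>
    omega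

end Sizes

/-! ### Uniform identifiers in place of pseudorandom ones -/

section Hybrid

variable {P : ℕ → Params} {𝔽 K : ℕ → Type} [∀ s, Field (𝔽 s)] [∀ s, Fintype (𝔽 s)]
  [∀ s, AddCommGroup (K s)] [∀ s, Fintype (K s)]
  {eF : ∀ s, 𝔽 s ≃ Fin (Fintype.card (𝔽 s))} {F : (s : ℕ) → K s → 𝔽 s → 𝔽 s}

theorem preparedProb_le_one (h : Tape → Data → Data) (setup : Data → Data) (s : ℕ) (D : Code)
    (a pre ids : Data) : preparedProb h setup s D a pre ids ≤ 1 := by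
  have : IsProbabilityMeasure tapeMeasure := by unfold tapeMeasure; infer_instance
  refine (lintegral_mono fun ω => acceptProb_le_one _ _ _).trans ?_
  simp

/-- If the inputs of the pseudorandom function are different, then its outputs can be replaced by
uniformly random and independent ones. -/
theorem ident_hybrid (hF : IsPRF 𝔽 eF K F) {h : Tape → Data → Data} (hh : IsHandler h)
    {setup : Data → Data} (hs : PT fun _ _ x => setup x) {D : Code} (hD : PolyTime D)
    (p : Polynomial ℕ) : ∃ ε : ℕ → ℝ, Negligible ε ∧
      ∀ (s : ℕ) (a : Data) (Ω : Type) [Fintype Ω] [Nonempty Ω] (n : ℕ) (pre : Ω → Data)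
        (G : Ω → Fin n → 𝔽 s), a.size ≤ p.eval s → (∀ c, (pre c).size ≤ p.eval s) →
        (∀ c, (Data.ofFamily (encodeBy (eF s)) (G c)).size ≤ p.eval s) →
        |𝔼 c, 𝔼 k : K s, (preparedProb h setup s D a (pre c)
            (Data.ofFamily (encodeBy (eF s)) fun i => F s k (G c i))).toReal
          - 𝔼 c, 𝔼 v : Fin n → 𝔽 s, (preparedProb h setup s D a (pre c)
            (Data.ofFamily (encodeBy (eF s)) v)).toReal|
          ≤ ε s + prob fun c => ¬ Function.Injective (G c) := by
  obtain ⟨ε, hε, hε'⟩ := prf_hybrid hF hh hs hD p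
  refine ⟨ε, hε, fun s a Ω _ _ n pre G ha hpre hG => ?_⟩
  -- The PRF bound applies for each `c` separately, with `pre c` and `G c` as advice; averaging over
  -- `c` preserves it.
  have h1 := abs_expect_sub_le
    (fun c => 𝔼 k : K s, (preparedProb h setup s D a (pre c)
      (Data.ofFamily (encodeBy (eF s)) fun i => F s k (G c i))).toReal)
    (fun c => 𝔼 f : 𝔽 s → 𝔽 s, (preparedProb h setup s D a (pre c)
      (Data.ofFamily (encodeBy (eF s)) fun i => f (G c i))).toReal)
    fun c => hε' s a (pre c) n (G c) ha (hpre c) (hG c)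
  have hmem : ∀ c ids, 0 ≤ (preparedProb h setup s D a (pre c) ids).toReal ∧
      (preparedProb h setup s D a (pre c) ids).toReal ≤ 1 := fun c ids =>
    ⟨ENNReal.toReal_nonneg, ENNReal.toReal_le_of_le_ofReal zero_le_one
      (by simpa using preparedProb_le_one ..)⟩
  have hE : ∀ {X : Type} [Fintype X] [Nonempty X] (f : X → ℝ), (∀ x, 0 ≤ f x ∧ f x ≤ 1) →
      0 ≤ 𝔼 x, f x ∧ 𝔼 x, f x ≤ 1 := fun f hf =>
    ⟨Finset.expect_nonneg fun x _ => (hf x).1,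
      (Finset.expect_le_expect fun x _ => (hf x).2).trans (by rw [Fintype.expect_const])⟩
  -- At distinct points a random function has independent uniform values, so this replacement costs
  -- only the collision probability.
  have h2 := abs_expect_sub_le_prob
    (fun c => 𝔼 f : 𝔽 s → 𝔽 s, (preparedProb h setup s D a (pre c)
      (Data.ofFamily (encodeBy (eF s)) fun i => f (G c i))).toReal)
    (fun c => 𝔼 v : Fin n → 𝔽 s, (preparedProb h setup s D a (pre c)
      (Data.ofFamily (encodeBy (eF s)) v)).toReal)
    (fun c => ¬ Function.Injective (G c))
    (fun c => hE _ fun _ => hmem c _) (fun c => hE _ fun _ => hmem c _) (fun c hc =>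
      expect_comp_injective (not_not.1 hc) fun v => (preparedProb h setup s D a (pre c)
        (Data.ofFamily (encodeBy (eF s)) v)).toReal)
  exact (abs_sub_le _ _ _).trans (add_le_add h1 h2)

/-- A program that detects repetitions in a list. -/
theorem exists_duplicateTest : ∃ D : Code, PolyTime D ∧ ∀ (s n : ℕ) (N : ℕ) (α : Type)
    (e : α ≃ Fin N) (a : Data) (f : Fin n → α),
    acceptProb noOracles D (.pair (Data.unary s) (.pair a (Data.ofFamily (encodeBy e) f))) =
      if ¬ Function.Injective f then 1 else 0 := by
  have hpt : PT fun _ _ x => bit (∃ i ∈ (Data.ofList ((List.range x.snd.snd.toList.length).map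
      Data.num)).toList, ∃ j ∈ (Data.ofList ((List.range x.snd.snd.toList.length).map
      Data.num)).toList, (¬ i = j) ∧ x.snd.snd.nth i.toNat = x.snd.snd.nth j.toNat) :=
    PT.any (p := fun _ _ x i => ∃ j ∈ (Data.ofList ((List.range x.snd.snd.toList.length).map
      Data.num)).toList, (¬ i = j) ∧ x.snd.snd.nth i.toNat = x.snd.snd.nth j.toNat)
      PT.id.snd.snd.range (PT.any (p := fun _ _ y j => (¬ y.snd = j) ∧
        y.fst.snd.snd.nth y.snd.toNat = y.fst.snd.snd.nth j.toNat) PT.id.fst.snd.snd.range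
        ((PT.not (p := fun _ _ z => z.fst.snd = z.snd) (PT.id.fst.snd.eq PT.id.snd)).and
          ((PT.id.fst.fst.snd.snd.nth_toNat PT.id.fst.snd).eq
            (PT.id.fst.fst.snd.snd.nth_toNat PT.id.snd))))
  obtain ⟨D, hD, hD'⟩ := hpt.polyTime
  refine ⟨D, hD, fun s n N α e a f => ?_⟩
  have : IsProbabilityMeasure tapeMeasure := by unfold tapeMeasure; infer_instance
  have key : ∀ ω, (∃ t, Runs noOracles ω D
      (.pair (Data.unary s) (.pair a (Data.ofFamily (encodeBy e) f))) (.num 1) t) ↔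
      ¬ Function.Injective f := by
    intro ω
    obtain ⟨t, ht⟩ := hD' noOracles ⟨_, fun _ _ => le_rfl⟩ ω
      (.pair (Data.unary s) (.pair a (Data.ofFamily (encodeBy e) f)))
    have h1 : (∃ t, Runs noOracles ω D
      (.pair (Data.unary s) (.pair a (Data.ofFamily (encodeBy e) f))) (.num 1) t) ↔
      _ = Data.num 1 := ⟨fun ⟨_, h⟩ => (ht.deterministic h).1, fun h => ⟨t, h ▸ ht⟩⟩
    have h2 : ∀ p : Prop, bit p = .num 1 ↔ p := fun p =>
      ⟨fun h => by by_contra hp; rw [bit_false hp] at h; simp at h, bit_true⟩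
    rw [h1, h2]
    simp only [Data.snd_pair, Data.toList_ofList, List.mem_map, List.mem_range,
      Data.length_ofFamily]
    unfold Function.Injective
    push Not
    constructor
    · rintro ⟨_, ⟨i, hi, rfl⟩, _, ⟨j, hj, rfl⟩, hne, h⟩
      refine ⟨⟨i, hi⟩, ⟨j, hj⟩, ?_, fun h => hne (by rw [Fin.mk.inj_iff.1 h])⟩
      apply encodeBy_injective e
      rw [← Data.nth_ofFamily (encodeBy e) f, ← Data.nth_ofFamily (encodeBy e) f]
      exact h
    · rintro ⟨i, j, h, hne⟩
      refine ⟨_, ⟨i, i.2, rfl⟩, _, ⟨j, j.2, rfl⟩, fun h => hne (Fin.ext (Data.num.inj h)), ?_⟩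
      simp only [Data.toNat_num, Data.nth_ofFamily, h]
  unfold acceptProb
  simp only [key]
  split_ifs with h <;> simp [h]

theorem isHandler_zero : IsHandler fun _ _ => .num 0 where
  pt := PT.const _
  bound := ⟨1, fun _ _ _ => by simp [Data.size]⟩
  right _ _ _ := rfl

end Hybrid

end FuzzyPSI

namespace FuzzyPSI

open scoped Classical BigOperators

/-! ### Negligible functions and polynomial bounds -/

section Negligible

theorem Negligible.add {ε ε' : ℕ → ℝ} (h : Negligible ε) (h' : Negligible ε') :
    Negligible fun s => ε s + ε' s :=
  Asymptotics.SuperpolynomialDecay.add h h'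

theorem Negligible.eval_mul {ε : ℕ → ℝ} (h : Negligible ε) (p : Polynomial ℕ) :
    Negligible fun s => ((p.eval s : ℕ) : ℝ) * ε s := by
  have := Asymptotics.SuperpolynomialDecay.polynomial_mul h (p.map (Nat.castRingHom ℝ))
  refine this.congr fun s => ?_
  simp

theorem exists_preBound_polynomial : ∃ q : Polynomial ℕ, ∀ t, q.eval t = preBound t := by
  let C : Polynomial ℕ := .X * (.X * (.X + 2) + 2) + 1
  refine ⟨14 * (10 * (2 * .X + 1 + C + 1) + 1 + (.X * .X * (2 * .X + 1) * (.X + 2) + 1) + C +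
    (.X + 1) + 2 + 1) + 1, fun t => ?_⟩
  simp [preBound, C]

end Negligible

/-! ### Collisions of identifiers -/

theorem prob_not_injective_le {𝔽 : Type} [Field 𝔽] [Fintype 𝔽] (a : ℕ) :
    prob (fun v : Fin a → 𝔽 => ¬ Function.Injective v) ≤ (a : ℝ) ^ 2 * (1 / Fintype.card 𝔽) := by
  -- If the field has at least `a` elements, a uniform vector is a random function at `a` different
  -- points. Otherwise the claimed bound is at least one.
  by_cases h : a ≤ Fintype.card 𝔽
  · obtain ⟨G⟩ := Function.Embedding.nonempty_of_card_le (α := Fin a) (β := 𝔽) (by simpa using h)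
    refine (le_of_eq ?_).trans (prob_random_function_not_injective_le G.injective)
    unfold prob
    rw [← expect_comp_injective G.injective]
  · have h1 : prob (fun v : Fin a → 𝔽 => ¬ Function.Injective v) ≤ 1 :=
      (Finset.expect_le_expect (g := fun _ => (1 : ℝ)) fun _ _ => by split_ifs <;> simp).trans
        (by rw [Fintype.expect_const])
    have h2 : (Fintype.card 𝔽 : ℝ) ≤ a := by exact_mod_cast (not_le.1 h).le
    have h3 : (0 : ℝ) < Fintype.card 𝔽 := by exact_mod_cast Fintype.card_pos
    have h4 : (1 : ℝ) ≤ a := le_trans (by exact_mod_cast Fintype.card_pos) h2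
    refine h1.trans ?_
    rw [mul_one_div, le_div_iff₀ h3]
    nlinarith

section Security

variable {P : ℕ → Params} {𝔽 K : ℕ → Type} [∀ s, Field (𝔽 s)] [∀ s, Fintype (𝔽 s)]
  [∀ s, AddCommGroup (K s)] [∀ s, Fintype (K s)]
  {eF : ∀ s, 𝔽 s ≃ Fin (Fintype.card (𝔽 s))} {eK : ∀ s, K s ≃ Fin (Fintype.card (K s))}
  {F : (s : ℕ) → K s → 𝔽 s → 𝔽 s}

theorem exists_bounded (hP : PolyBounded P 𝔽 K) : ∃ q : Polynomial ℕ, ∀ s,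
    Bounded (P s) (Fintype.card (𝔽 s)) (Fintype.card (K s)) s (q.eval s) := by
  obtain ⟨p, hp⟩ := hP
  refine ⟨p + .X, fun s => ?_⟩
  obtain ⟨h1, h2, h3, h4, h5, h6, h7⟩ := hp s
  simp only [Polynomial.eval_add, Polynomial.eval_X]
  constructor <;> omega

/-- Repetitions among the identifiers can be detected in polynomial time. So they are no likelier
than for uniform identifiers, up to the PRF advantage and the collision probability of the PRF
inputs. -/
theorem exists_prob_identW_le (hP : PolyBounded P 𝔽 K)
    (hcard : Negligible fun s => 1 / (Fintype.card (𝔽 s) : ℝ)) (hF : IsPRF 𝔽 eF K F) :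
    ∃ ε : ℕ → ℝ, Negligible ε ∧ ∀ (s : ℕ) (i : Inputs (P s)),
      prob (fun c : Coins (P s) (𝔽 s) (K s) => ¬ Function.Injective (c.identW (F s) i.Q i.W)) ≤
        ε s := by
  obtain ⟨q, hq⟩ := exists_bounded hP
  obtain ⟨D, hD, hD'⟩ := exists_duplicateTest
  -- The test sees the identifiers alone, so state, environment and handler are trivial.
  have hs : PT fun _ _ x => Data.pair (.num 0) x.snd := (PT.const _).pair PT.id.snd
  obtain ⟨ε, hε, hε'⟩ := ident_hybrid hF isHandler_zero hs hD (q * (q + 2) + 1)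
  refine ⟨fun s => (ε s + (((q ^ 2).eval s : ℕ) : ℝ) * (1 / Fintype.card (𝔽 s))) +
    (((q ^ 2).eval s : ℕ) : ℝ) * (1 / Fintype.card (𝔽 s)),
    (hε.add (hcard.eval_mul _)).add (hcard.eval_mul _), fun s i => ?_⟩
  have hn : ((P s).n : ℝ) ^ 2 * (1 / Fintype.card (𝔽 s)) ≤
      (((q ^ 2).eval s : ℕ) : ℝ) * (1 / Fintype.card (𝔽 s)) := by
    rw [Polynomial.eval_pow]
    push_cast
    have : ((P s).n : ℝ) ≤ q.eval s := by exact_mod_cast (hq s).n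
    gcongr
  have hprep : ∀ {n : ℕ} (v : Fin n → 𝔽 s), (preparedProb (fun _ _ => .num 0)
      (fun x => Data.pair (.num 0) x.snd) s D (.num 0) (.num 0)
      (Data.ofFamily (encodeBy (eF s)) v)).toReal = if ¬ Function.Injective v then 1 else 0 := by
    intro n v
    have : IsProbabilityMeasure tapeMeasure := by unfold tapeMeasure; infer_instance
    have h1 : preparedProb (fun _ _ => .num 0) (fun x => Data.pair (.num 0) x.snd) s D (.num 0)
        (.num 0) (Data.ofFamily (encodeBy (eF s)) v) =
        ∫⁻ _, (if ¬ Function.Injective v then 1 else 0) ∂tapeMeasure :=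
      lintegral_congr fun ω => hD' s n _ _ (eF s) (.num 0) v
    rw [h1]
    split_ifs <;> simp
  have h1 := hε' s (.num 0) (Coins (P s) (𝔽 s) (K s)) (P s).n (fun _ => .num 0)
    (fun c => c.inputW i.Q i.W) (by simp [Data.size]) (fun _ => by simp [Data.size])
    (fun c => by simpa using (hq s).ofFamily (e := eF s) (hq s).n (c.inputW i.Q i.W))
  simp only [hprep] at h1
  have h2 : 𝔼 c : Coins (P s) (𝔽 s) (K s), 𝔼 v : Fin (P s).n → 𝔽 s,
      (if ¬ Function.Injective v then (1 : ℝ) else 0) ≤ (P s).n ^ 2 * (1 / Fintype.card (𝔽 s)) := by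
    refine (Fintype.expect_const (ι := Coins (P s) (𝔽 s) (K s)) _).trans_le
      ((le_of_eq ?_).trans (prob_not_injective_le _))
    exact Finset.expect_congr rfl fun v _ => by congr
  -- The sum of the key shares is uniform and independent of the PRF inputs.
  have h3 := resample (fun c : Coins (P s) (𝔽 s) (K s) => c.keyS + c.keyR)
    (fun k c => { c with keyS := k - c.keyR }) (fun _ _ => by simp) (fun _ => by simp)
    (fun _ _ _ => rfl) (fun c k => if ¬ Function.Injective fun j => F s k (c.inputW i.Q i.W j)
      then (1 : ℝ) else 0) (fun _ _ _ => rfl)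
  have h4 := prob_inputW_le (K := K s) (𝔽 := 𝔽 s) i.Q i.disjW
  have h5 := (abs_le.1 h1).2
  have h6 : prob (fun c : Coins (P s) (𝔽 s) (K s) =>
      ¬ Function.Injective (c.identW (F s) i.Q i.W)) = _ :=
    (Finset.expect_congr rfl fun c _ => by congr).trans h3
  linarith

end Security

end FuzzyPSI

namespace FuzzyPSI

open scoped Classical BigOperators

/-! ### Hybrids -/

section Hybrids

variable {P : Params} {𝔽 K : Type} [Field 𝔽] [Fintype 𝔽] [AddCommGroup K] [Fintype K] {N M : ℕ}
  (e : 𝔽 ≃ Fin N) (eK : K ≃ Fin M) (F : K → 𝔽 → 𝔽) (Q : Fin P.m → Point P) (W : Fin P.n → Point P)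
  (Z : Finset (Point P)) (s : ℕ) (D : Code) (a : Data)

theorem prob_bad_le_add (hQ : DisjointProjection Q) :
    prob (fun c : Coins P 𝔽 K => c.Bad F Q W) ≤
      prob (fun c : Coins P 𝔽 K => ¬ Function.Injective (c.identW F Q W)) +
        P.m * (1 / Fintype.card 𝔽) :=
  (prob_mono fun _ hc => or_iff_not_imp_left.2 fun h => ⟨not_not.1 h, hc⟩).trans
    ((prob_or_le _ _).trans (add_le_add_right (prob_bad_le F (W := W) hQ) _))

/-- A view of the sender in which the shares that it gets from oblivious programmable PRFs, the
function `f` behind its programmed function, and its identifiers are given. -/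
noncomputable def Coins.maskedSender (c : Coins P 𝔽 K) (f : MapKey P P.m → 𝔽)
    (ident : Fin P.m → 𝔽) : SenderView P 𝔽 K where
  input := Q
  order := c.order
  fmap :=
    { r := c.rS, dummy := c.dummyS, key := c.keyS, partnerShare := fun i k => c.yS (i, k),
      fn := program (localList (c.q Q) c.rS c.dummyS) f, ownShare := fun j k => c.yR (j, k),
      ident := ident }
  share := fun j k => c.yF (j, k)

/-- The coins with the shares of the sender in place of those of the receiver. -/
noncomputable def Coins.flipSender (c : Coins P 𝔽 K) : Coins P 𝔽 K :=
  { c with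
    yR := fun x => c.progR W (Sum.inl (x.2, toCoord P (c.q Q x.1 x.2))) - c.yR x
    yF := fun x => c.filterValue F Q W x.1 x.2 - c.yF x }

/-- The values from which the shares are subtracted do not depend on `yR` and `yF`. So the exchange
of the two shares of each value is a bijection of the coins. -/
theorem Coins.flipSender_involutive :
    Function.Involutive (Coins.flipSender F Q W : Coins P 𝔽 K → Coins P 𝔽 K) := by
  intro c
  have h1 : (fun x => c.progR W (Sum.inl (x.2, toCoord P (c.q Q x.1 x.2))) -
      (c.flipSender F Q W).yR x) = c.yR := funext fun x => sub_sub_cancel _ _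
  have h2 : (fun x => c.filterValue F Q W x.1 x.2 - (c.flipSender F Q W).yF x) = c.yF :=
    funext fun x => sub_sub_cancel _ _
  calc (c.flipSender F Q W).flipSender F Q W
      = { c with
          yR := fun x => c.progR W (Sum.inl (x.2, toCoord P (c.q Q x.1 x.2))) -
            (c.flipSender F Q W).yR x
          yF := fun x => c.filterValue F Q W x.1 x.2 - (c.flipSender F Q W).yF x } := rfl
    _ = c := by rw [h1, h2]

/-- After the exchange of shares, the view depends on `keyR` only through the key sum, and the
identifiers do not involve `fnS`. Both can be drawn afresh, the former with `keyS` kept. -/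
theorem expect_senderView (g : SenderView P 𝔽 K → ℝ) :
    𝔼 c : Coins P 𝔽 K, g (c.senderView F Q W) =
      𝔼 c : Coins P 𝔽 K, 𝔼 k : K, 𝔼 f : MapKey P P.m → 𝔽,
        g (c.maskedSender Q f fun j => F k (c.inputQ Q W j)) := by
  calc 𝔼 c : Coins P 𝔽 K, g (c.senderView F Q W)
      = 𝔼 c : Coins P 𝔽 K, g (c.maskedSender Q c.fnS (c.identQ F Q W)) :=
        Fintype.expect_equiv (Coins.flipSender_involutive F Q W).toPerm _ _ fun _ => rfl
    _ = 𝔼 c : Coins P 𝔽 K, 𝔼 x : K × (MapKey P P.m → 𝔽),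
          g (c.maskedSender Q x.2 fun j => F x.1 (c.inputQ Q W j)) :=
        resample (fun c : Coins P 𝔽 K => (c.keyS + c.keyR, c.fnS))
          (fun x c => { c with keyR := x.1 - c.keyS, fnS := x.2 }) (fun _ _ => by simp)
          (fun _ => by simp) (fun _ _ _ => rfl)
          (fun c x => g (c.maskedSender Q x.2 fun j => F x.1 (c.inputQ Q W j))) fun _ _ _ => rfl
    _ = _ := Finset.expect_congr rfl fun c _ => by
        rw [← Finset.univ_product_univ, Finset.expect_product]

/-- The state of the simulator of the sender for given coins. -/
noncomputable def Coins.senderData (c : Coins P 𝔽 K) : Data :=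
  preData e eK (simulatorInput s P N M (Data.ofFamily encodePoint Q) (.num 0)) (c.q Q) 0 c.rS
    c.dummyS c.keyS (fun i k => c.yS (i, k)) (fun j k => c.yR (j, k)) (Data.ofFamily encodePoint Q)
    (fun j k => c.yF (j, k)) (Data.ofFamily encodeFin c.order) (.num 0) (encodeSet Z)

/-- The handler reads the function behind the oracle from the cells of tag `1`, so integrating over
its tape averages over `f`. -/
theorem preparedProb_sender (c : Coins P 𝔽 K) (ident : Fin P.m → 𝔽) :
    (preparedProb Handler.answer setupSender s D a (c.senderData e eK Q Z s)
      (Data.ofFamily (encodeBy e) ident)).toReal =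
      𝔼 f : MapKey P P.m → 𝔽, (accept s D a (obsSender e eK (c.maskedSender Q f ident) Z)).toReal := by
  rw [← lintegral_cells_toReal (fun key : MapKey P P.m => (N - 1, Data.pair (.num 1) (encodeMapKey key)))
    (fun _ _ h => encodeMapKey_injective (Data.pair.inj (Prod.mk.inj h).2).2)
    (V := fun _ => 𝔽) (fun _ => e.trans (finCongr (sub_one_add_one_of_equiv e)))
    (fun f => accept s D a (obsSender e eK (c.maskedSender Q f ident) Z))
    fun _ => accept_le_one _ _ _ _]
  congr 1
  refine lintegral_congr fun ω => ?_
  unfold Coins.senderData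
  rw [setupSender_eq]
  simp only [Data.fst_pair, Data.snd_pair]
  rw [Handler.oracles_sender fun key => encodeBy_symm e (ω (N - 1, .pair (.num 1) (encodeMapKey key)))]
  rfl

theorem expect_maskedSender (g : SenderView P 𝔽 K → ℝ) :
    𝔼 c : Coins P 𝔽 K, 𝔼 v : Fin P.m → 𝔽, 𝔼 f : MapKey P P.m → 𝔽, g (c.maskedSender Q f v) =
      𝔼 v : Sample P P.m P.n 𝔽 K, g (v.senderView Q) := by
  have h := expect_get (Ω := Coins P 𝔽 K × (Fin P.m → 𝔽) × (MapKey P P.m → 𝔽))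
    (X := Sample P P.m P.n 𝔽 K)
    (fun ω cell => match cell with
      | .code i => (permEquiv P.m).symm ω.1.order i
      | .key => ω.1.keyS
      | .r i k => ω.1.rS i k
      | .dummy i => ω.1.dummyS i
      | .partner j k => ω.1.yS (j, k)
      | .own i k => ω.1.yR (i, k)
      | .share j k => ω.1.yF (j, k)
      | .ident i => ω.2.1 i
      | .map x => ω.2.2 x
      -- The sender's view ignores the filter cells; `fnF` supplies values for them so that whole
      -- samples are obtained.
      | .filter x => ω.1.fnF x)
    (fun v ω => ({ ω.1 with
        order := v.order, keyS := v.key, rS := v.r, dummyS := v.dummy,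
        yS := fun x => v.partner x.1 x.2, yR := fun x => v.own x.1 x.2,
        yF := fun x => v.share x.1 x.2, fnF := v.filter }, v.ident, v.map))
    (fun v ω => by
      funext cell
      cases cell <;> try rfl
      exact congrFun ((permEquiv P.m).symm_apply_apply _) _)
    (fun ω => by
      refine Prod.ext ?_ rfl
      exact congrArg (fun π => { ω.1 with order := π }) ((permEquiv P.m).apply_symm_apply ω.1.order))
    (fun _ _ _ => rfl) (fun v => g (v.senderView Q))
  rw [← h, ← Finset.univ_product_univ, Finset.expect_product]
  refine Finset.expect_congr rfl fun c _ => ?_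
  rw [← Finset.univ_product_univ, Finset.expect_product]
  refine Finset.expect_congr rfl fun v _ => Finset.expect_congr rfl fun f _ => congrArg g ?_
  simp only [Sample.senderView, Coins.maskedSender, Sample.fmap, Sample.order, Equiv.apply_symm_apply]
  rfl

/-- The simulator of the receiver does not know the sender's enumeration. A fixed permutation
carries the items of the intersection to their places in the coded list and all others beyond its
end. -/
theorem exists_perm_getElem_pointList (hQ : Function.Injective Q) (W : Fin P.n → Point P) :
    ∃ τ : Equiv.Perm (Fin P.m), ∀ j, (pointList (idealFPSI Q W))[(τ j).val]? =
      if Q j ∈ idealFPSI Q W then some (Q j) else none := by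
  set Z := idealFPSI Q W with hZ
  have hsub : ∀ p ∈ pointList Z, ∃ j, Q j = p := fun p hp => by
    have := (Finset.mem_filter.1 (hZ ▸ (mem_pointList Z p).1 hp)).1
    obtain ⟨j, -, hj⟩ := Finset.mem_image.1 this
    exact ⟨j, hj⟩
  choose g hg using hsub
  let e : Fin (pointList Z).length ≃ {j // Q j ∈ Z} := Equiv.ofBijective
    (fun i => ⟨g _ (List.get_mem _ i), by
      rw [hg, ← mem_pointList]
      exact List.get_mem _ i⟩) ⟨fun i i' h => by
        have := congrArg (fun j : {j // Q j ∈ Z} => Q j.1) h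
        simp only [hg] at this
        exact (nodup_pointList Z).injective_get this, fun ⟨j, hj⟩ => by
        obtain ⟨i, hi⟩ := List.get_of_mem ((mem_pointList Z _).2 hj)
        refine ⟨i, Subtype.ext (hQ ?_)⟩
        rw [hg, hi]⟩
  have he : ∀ i, Q (e i).1 = (pointList Z).get i := fun i => hg _ _
  have hlen : (pointList Z).length ≤ P.m := by
    have := Fintype.card_le_of_injective (fun i => (e i).1)
      (Subtype.val_injective.comp e.injective)
    simpa using this
  -- Positions in the list are positions among the `m` items, so the partial matching extends to a
  -- permutation of all of them.
  let e' : {j // Q j ∈ Z} ≃ {i : Fin P.m // i.val < (pointList Z).length} :=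
    e.symm.trans ⟨fun i => ⟨⟨i, i.2.trans_le hlen⟩, i.2⟩, fun i => ⟨i.1, i.2⟩, fun _ => rfl,
      fun _ => rfl⟩
  refine ⟨e'.extendSubtype, fun j => ?_⟩
  split_ifs with hj
  · have h1 : (e'.extendSubtype j).val = (e.symm ⟨j, hj⟩).val :=
      congrArg Fin.val (e'.extendSubtype_apply_of_mem j hj)
    rw [h1, List.getElem?_eq_getElem (e.symm ⟨j, hj⟩).2]
    congr 1
    refine (he (e.symm ⟨j, hj⟩)).symm.trans ?_
    rw [Equiv.apply_symm_apply]
  · rw [List.getElem?_eq_none]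
    exact not_lt.1 (e'.extendSubtype_not_mem j hj)

/-- A view of the receiver in which the shares that it gets from oblivious programmable PRFs, the
functions `f` behind its programmed functions, and its identifiers are given, and in which it gets
the items of the set `Z`. -/
noncomputable def Coins.maskedReceiver (c : Coins P 𝔽 K) (f : MapKey P P.n ⊕ FilterKey P 𝔽 → 𝔽)
    (ident : Fin P.n → 𝔽) : ReceiverView P 𝔽 K where
  input := W
  fmap :=
    { r := c.rR, dummy := c.dummyR, key := c.keyR, partnerShare := fun j k => c.yR (j, k),
      fn := program (localList W c.rR c.dummyR) fun x => f (.inl x),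
      ownShare := fun i k => c.yS (i, k), ident := ident }
  share := fun j k => c.yF (j, k)
  fn := program (filterList W ident) fun x => f (.inr x)
  bits := fun j => decide (c.q Q j ∈ Z)
  items := fun j => if c.q Q j ∈ Z then some (c.q Q j) else none

/-- The coins with the shares of the receiver in place of those of the sender. -/
noncomputable def Coins.flipReceiver (c : Coins P 𝔽 K) : Coins P 𝔽 K :=
  { c with yS := fun x => c.progS Q (Sum.inl (x.2, toCoord P (W x.1 x.2))) - c.yS x }

theorem Coins.flipReceiver_involutive :
    Function.Involutive (Coins.flipReceiver Q W : Coins P 𝔽 K → Coins P 𝔽 K) := by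
  intro c
  have h : (fun x => c.progS Q (Sum.inl (x.2, toCoord P (W x.1 x.2))) -
      (c.flipReceiver Q W).yS x) = c.yS := funext fun x => sub_sub_cancel _ _
  calc (c.flipReceiver Q W).flipReceiver Q W
      = { c with yS := fun x => c.progS Q (Sum.inl (x.2, toCoord P (W x.1 x.2))) -
            (c.flipReceiver Q W).yS x } := rfl
    _ = c := by rw [h]

/-- The view of the receiver if the equality tests give the right results. -/
noncomputable def Coins.correctReceiver (c : Coins P 𝔽 K) : ReceiverView P 𝔽 K :=
  (c.flipReceiver Q W).maskedReceiver Q W (idealFPSI Q W) (Sum.elim c.fnR c.fnF) (c.identW F Q W)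

/-- Outside the bad event the test bits, and with them the transferred messages, are determined by
the ideal output and the order. -/
theorem Coins.receiverView_eq {c : Coins P 𝔽 K} (h : ¬ c.Bad F Q W) :
    c.receiverView F Q W = c.correctReceiver F Q W := by
  have h1 : ∀ j, c.bits F Q W j = decide (c.q Q j ∈ idealFPSI Q W) := fun j => by
    rw [Bool.eq_iff_iff, c.bits_iff h, decide_eq_true_iff]
  have h2 : c.bits F Q W = fun j => decide (c.q Q j ∈ idealFPSI Q W) := funext h1
  unfold Coins.receiverView
  rw [h2]
  simp only [decide_eq_true_eq]
  rfl

/-- The PRF inputs of the receiver involve only the sender's programmed function. So `fnR`, `fnF`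
and the key sum are independent of them and can be drawn afresh, with `keyR` kept. -/
theorem expect_correctReceiver (g : ReceiverView P 𝔽 K → ℝ) :
    𝔼 c : Coins P 𝔽 K, g (c.correctReceiver F Q W) =
      𝔼 c : Coins P 𝔽 K, 𝔼 k : K, 𝔼 f : MapKey P P.n ⊕ FilterKey P 𝔽 → 𝔽,
        g (c.maskedReceiver Q W (idealFPSI Q W) f fun i => F k (c.inputW Q W i)) := by
  calc 𝔼 c : Coins P 𝔽 K, g (c.correctReceiver F Q W)
      = 𝔼 c : Coins P 𝔽 K, g (c.maskedReceiver Q W (idealFPSI Q W) (Sum.elim c.fnR c.fnF)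
          (c.identW F Q W)) :=
        Fintype.expect_equiv (Coins.flipReceiver_involutive Q W).toPerm _ _ fun _ => rfl
    _ = 𝔼 c : Coins P 𝔽 K, 𝔼 x : K × (MapKey P P.n ⊕ FilterKey P 𝔽 → 𝔽),
          g (c.maskedReceiver Q W (idealFPSI Q W) x.2 fun i => F x.1 (c.inputW Q W i)) :=
        resample (fun c : Coins P 𝔽 K => (c.keyS + c.keyR, Sum.elim c.fnR c.fnF))
          (fun x c => { c with
            keyS := x.1 - c.keyR, fnR := fun y => x.2 (.inl y), fnF := fun y => x.2 (.inr y) })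
          (fun x _ => Prod.ext (by simp) (by funext y; cases y <;> rfl))
          (fun _ => by simp) (fun _ _ _ => rfl)
          (fun c x => g (c.maskedReceiver Q W (idealFPSI Q W) x.2
            fun i => F x.1 (c.inputW Q W i))) fun _ _ _ => rfl
    _ = _ := Finset.expect_congr rfl fun c _ => by
        rw [← Finset.univ_product_univ, Finset.expect_product]

/-- The state of the simulator of the receiver for given coins. -/
noncomputable def Coins.receiverData (c : Coins P 𝔽 K) : Data :=
  preData e eK (simulatorInput s P N M (Data.ofFamily encodePoint W) (encodeSet Z)) W 1 c.rR
    c.dummyR c.keyR (fun j k => c.yR (j, k)) (fun i k => c.yS (i, k)) (Data.ofFamily encodePoint W)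
    (fun j k => c.yF (j, k))
    (Data.ofFamily (fun b : Bool => Data.ofProp (b = true)) fun j => decide (c.q Q j ∈ Z))
    (Data.ofFamily
      (fun z : Option (Point P) => z.elim (.num 0) fun x => .pair (.num 1) (encodePoint x))
      fun j => if c.q Q j ∈ Z then some (c.q Q j) else none) (encodeSet Z)

theorem preparedProb_receiver (c : Coins P 𝔽 K) (ident : Fin P.n → 𝔽) :
    (preparedProb Handler.answer setupReceiver s D a (c.receiverData e eK Q W Z s)
      (Data.ofFamily (encodeBy e) ident)).toReal =
      𝔼 f : MapKey P P.n ⊕ FilterKey P 𝔽 → 𝔽,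
        (accept s D a (obsReceiver e eK (c.maskedReceiver Q W Z f ident) Z)).toReal := by
  let address : MapKey P P.n ⊕ FilterKey P 𝔽 → ℕ × Data := Sum.elim
    (fun key => (N - 1, .pair (.num 1) (encodeMapKey key)))
    (fun key => (N - 1, .pair (.num 2) (encodeFilterKey e key)))
  have haddress : Function.Injective address := by
    rintro (x | x) (y | y) h <;>
      simp [address, encodeMapKey_injective.eq_iff, (encodeFilterKey_injective e).eq_iff] at h <;>
      rw [h]
  have hN : ∀ x, N - 1 + 1 = (address x).1 + 1 := by rintro (x | x) <;> rfl
  rw [← lintegral_cells_toReal address haddress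
    (V := fun _ => 𝔽) (fun x => (e.trans (finCongr (sub_one_add_one_of_equiv e))).trans
      (finCongr (hN x)))
    (fun f => accept s D a (obsReceiver e eK (c.maskedReceiver Q W Z f ident) Z))
    fun _ => accept_le_one _ _ _ _]
  congr 1
  refine lintegral_congr fun ω => ?_
  unfold Coins.receiverData
  rw [setupReceiver_eq]
  simp only [Data.fst_pair, Data.snd_pair]
  rw [Handler.oracles_receiver
    (fun key => encodeBy_symm e (ω (N - 1, .pair (.num 1) (encodeMapKey key))))
    (fun key => encodeBy_symm e (ω (N - 1, .pair (.num 2) (encodeFilterKey e key))))]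
  rfl

theorem expect_maskedReceiver (hQ : Function.Injective Q) (g : ReceiverView P 𝔽 K → ℝ) :
    𝔼 c : Coins P 𝔽 K, 𝔼 v : Fin P.n → 𝔽, 𝔼 f : MapKey P P.n ⊕ FilterKey P 𝔽 → 𝔽,
      g (c.maskedReceiver Q W (idealFPSI Q W) f v) =
      𝔼 v : Sample P P.n P.m 𝔽 K, g (v.receiverView W (idealFPSI Q W)) := by
  obtain ⟨τ, hτ⟩ := exists_perm_getElem_pointList Q hQ W
  have h := expect_get
    (Ω := Coins P 𝔽 K × (Fin P.n → 𝔽) × (MapKey P P.n ⊕ FilterKey P 𝔽 → 𝔽))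
    (X := Sample P P.n P.m 𝔽 K)
    (fun ω cell => match cell with
      -- The simulated order is the real one followed by the fixed `τ`, hence again uniform.
      | .code i => (permEquiv P.m).symm (τ * ω.1.order) i
      | .key => ω.1.keyR
      | .r i k => ω.1.rR i k
      | .dummy i => ω.1.dummyR i
      | .partner j k => ω.1.yR (j, k)
      | .own i k => ω.1.yS (i, k)
      | .share j k => ω.1.yF (j, k)
      | .ident i => ω.2.1 i
      | .map x => ω.2.2 (.inl x)
      | .filter x => ω.2.2 (.inr x))
    (fun v ω => ({ ω.1 with
        order := τ⁻¹ * v.order, keyR := v.key, rR := v.r, dummyR := v.dummy,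
        yR := fun x => v.partner x.1 x.2, yS := fun x => v.own x.1 x.2,
        yF := fun x => v.share x.1 x.2 }, v.ident, Sum.elim v.map v.filter))
    (fun v ω => by
      funext cell
      cases cell <;> try rfl
      refine congrFun (congrArg (permEquiv P.m).symm (mul_inv_cancel_left τ v.order) |>.trans
        ((permEquiv P.m).symm_apply_apply _)) _)
    (fun ω => by
      refine Prod.ext ?_ (Prod.ext rfl (by funext x; cases x <;> rfl))
      refine congrArg (fun π => { ω.1 with order := π }) ?_
      refine (congrArg (τ⁻¹ * ·) ((permEquiv P.m).apply_symm_apply (τ * ω.1.order))).trans ?_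
      exact inv_mul_cancel_left _ _)
    (fun _ _ _ => rfl) (fun v => g (v.receiverView W (idealFPSI Q W)))
  rw [← h, ← Finset.univ_product_univ, Finset.expect_product]
  refine Finset.expect_congr rfl fun c _ => ?_
  rw [← Finset.univ_product_univ, Finset.expect_product]
  refine Finset.expect_congr rfl fun v _ => Finset.expect_congr rfl fun f _ => congrArg g ?_
  simp only [Sample.receiverView, Coins.maskedReceiver, Sample.order, Equiv.apply_symm_apply,
    Equiv.Perm.mul_apply, hτ]
  congr 1
  funext j
  simp only [Coins.q]
  split_ifs with hj <;> simp [hj]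

end Hybrids

end FuzzyPSI

namespace FuzzyPSI

open scoped Classical BigOperators

/-! ### Security against the sender and the receiver -/

section Simulation

variable {P : ℕ → Params} {𝔽 K : ℕ → Type} [∀ s, Field (𝔽 s)] [∀ s, Fintype (𝔽 s)]
  [∀ s, AddCommGroup (K s)] [∀ s, Fintype (K s)]
  {eF : ∀ s, 𝔽 s ≃ Fin (Fintype.card (𝔽 s))} (eK : ∀ s, K s ≃ Fin (Fintype.card (K s)))
  {F : (s : ℕ) → K s → 𝔽 s → 𝔽 s}

theorem card_idealFPSI_le {P : Params} (Q : Fin P.m → Point P) (W : Fin P.n → Point P) :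
    (idealFPSI Q W).card ≤ P.m :=
  (Finset.card_filter_le _ _).trans (Finset.card_image_le.trans (by simp))

/-- The error has two parts: the bad event, outside which the real output may be replaced by the
ideal one, and the replacement of the sender's identifiers by uniform values. After the latter, real
and simulated views have the same distribution. -/
theorem exists_simulates_sender (hP : PolyBounded P 𝔽 K)
    (hcard : Negligible fun s => 1 / (Fintype.card (𝔽 s) : ℝ)) (hfield : EfficientField 𝔽 eF)
    (hF : IsPRF 𝔽 eF K F) : ∃ S : Simulator, S.IsPPT ∧
      Simulates S (fun s => Inputs (P s))
        (fun s i => (fuzzyPSI (P s) (F s) i.Q i.W).map (observeSender (eF s) (eK s)))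
        (fun s i => simulatorInput s (P s) (Fintype.card (𝔽 s)) (Fintype.card (K s))
          (Data.ofFamily encodePoint i.Q) (.num 0))
        (fun _ i => encodeSet (idealFPSI i.Q i.W)) := by
  obtain ⟨S, hS, hS'⟩ := exists_simSender (K := K) hfield eK
  refine ⟨S, hS, fun D hD p => ?_⟩
  obtain ⟨q, hq⟩ := exists_bounded hP
  obtain ⟨pre, hpre⟩ := exists_preBound_polynomial
  obtain ⟨ε₁, hε₁, hε₁'⟩ := exists_prob_identW_le hP hcard hF
  obtain ⟨ε₂, hε₂, hε₂'⟩ := ident_hybrid hF Handler.isHandler_answer pt_setupSender hD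
    -- A sum of polynomials that bounds the advice, the state and the encoded PRF inputs at once.
    (p + pre.comp q + (q * (q + 2) + 1))
  refine ⟨fun s => (ε₁ s + (q.eval s : ℕ) * (1 / Fintype.card (𝔽 s))) +
    (ε₂ s + ((q ^ 2).eval s : ℕ) * (1 / Fintype.card (𝔽 s))),
    (hε₁.add (hcard.eval_mul _)).add (hε₂.add (hcard.eval_mul _)), fun s i a ha => ?_⟩
  have hm : ((P s).m : ℝ) ≤ (q.eval s : ℕ) := by exact_mod_cast (hq s).m
  set Z := idealFPSI i.Q i.W with hZ
  have hZc : Z.card ≤ q.eval s := (card_idealFPSI_le i.Q i.W).trans (hq s).m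
  let g : SenderView (P s) (𝔽 s) (K s) → ℝ := fun v =>
    (accept s D a (obsSender (eF s) (eK s) v Z)).toReal
  have hreal : (distProb s D a ((fuzzyPSI (P s) (F s) i.Q i.W).map
      (observeSender (eF s) (eK s)))).toReal = 𝔼 c : Coins (P s) (𝔽 s) (K s),
      (accept s D a (obsSender (eF s) (eK s) (c.senderView (F s) i.Q i.W)
        (c.exec (F s) i.Q i.W).output)).toReal := by
    rw [fuzzyPSI_eq_map, PMF.map_comp, distProb_unif_map_toReal]
    rfl
  have hsim : (simProb s D a S (simulatorInput s (P s) (Fintype.card (𝔽 s)) (Fintype.card (K s))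
      (Data.ofFamily encodePoint i.Q) (.num 0)) (encodeSet Z)).toReal =
      𝔼 v : Sample (P s) (P s).m (P s).n (𝔽 s) (K s), g (v.senderView i.Q) := by
    refine .trans ?_ (integral_readSample (eF s) (eK s)
      (fun v => accept s D a (obsSender (eF s) (eK s) (v.senderView i.Q) Z))
      fun _ => accept_le_one _ _ _ _)
    exact congrArg ENNReal.toReal (lintegral_congr fun ω => congrArg (accept s D a) (hS' s i.Q Z ω))
  have h1 : |𝔼 c : Coins (P s) (𝔽 s) (K s),
      (accept s D a (obsSender (eF s) (eK s) (c.senderView (F s) i.Q i.W)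
        (c.exec (F s) i.Q i.W).output)).toReal -
      𝔼 c : Coins (P s) (𝔽 s) (K s), g (c.senderView (F s) i.Q i.W)| ≤ _ :=
    abs_expect_sub_le_prob _ _ (fun c => c.Bad (F s) i.Q i.W)
      (fun _ => accept_toReal_mem _ _ _ _) (fun _ => accept_toReal_mem _ _ _ _)
      fun c hc => by rw [Coins.output_eq hc]
  have h2 := hε₂' s a (Coins (P s) (𝔽 s) (K s)) (P s).m
    (fun c => c.senderData (eF s) (eK s) i.Q Z s) (fun c => c.inputQ i.Q i.W)
    (by simp only [Polynomial.eval_add]; omega)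
    (fun c => by
      refine ((hq s).preData (e := eF s) (eK := eK s) (hq s).m (hq s).n zero_le_one
        ((hq s).points (hq s).m _) ?_ ?_ ?_ ((hq s).encodeSet hZc)).trans ?_
      · simp [Data.size]
      · refine Data.size_ofFamily_le' (hq s).m _ _ fun j => ?_
        have h1 := Nat.size_le_self' (c.order j).val
        have h2 := (c.order j).2.trans_le (hq s).m
        simp only [encodeFin, Data.size]
        nlinarith
      · simp [Data.size]
      · simp only [Polynomial.eval_add, Polynomial.eval_comp, hpre]; omega)
    (fun c => by
      refine ((hq s).ofFamily (hq s).m _).trans ?_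
      simp only [Polynomial.eval_add, Polynomial.eval_mul, Polynomial.eval_one,
        Polynomial.eval_ofNat]
      omega)
  simp only [preparedProb_sender] at h2
  rw [← expect_senderView (F s) i.Q i.W g, expect_maskedSender i.Q g] at h2
  rw [hreal, hsim]
  refine (abs_sub_le _ _ _).trans (add_le_add (h1.trans ?_) (h2.trans ?_))
  · refine (prob_bad_le_add (F s) i.Q i.W i.disjQ).trans (add_le_add (hε₁' s i) ?_)
    gcongr
  · refine add_le_add le_rfl ((prob_inputQ_le i.disjQ i.W).trans ?_)
    rw [Polynomial.eval_pow]
    push_cast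
    gcongr

/-- As for the sender, except that the bad event now also covers wrong test bits in the view, and
the order of the items is hidden by its uniform distribution. -/
theorem exists_simulates_receiver (hP : PolyBounded P 𝔽 K)
    (hcard : Negligible fun s => 1 / (Fintype.card (𝔽 s) : ℝ)) (hfield : EfficientField 𝔽 eF)
    (hF : IsPRF 𝔽 eF K F) : ∃ S : Simulator, S.IsPPT ∧
      Simulates S (fun s => Inputs (P s))
        (fun s i => (fuzzyPSI (P s) (F s) i.Q i.W).map (observeReceiver (eF s) (eK s)))
        (fun s i => simulatorInput s (P s) (Fintype.card (𝔽 s)) (Fintype.card (K s))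
          (Data.ofFamily encodePoint i.W) (encodeSet (idealFPSI i.Q i.W)))
        (fun _ i => encodeSet (idealFPSI i.Q i.W)) := by
  obtain ⟨S, hS, hS'⟩ := exists_simReceiver (K := K) hfield eK
  refine ⟨S, hS, fun D hD p => ?_⟩
  obtain ⟨q, hq⟩ := exists_bounded hP
  obtain ⟨pre, hpre⟩ := exists_preBound_polynomial
  obtain ⟨ε₁, hε₁, hε₁'⟩ := exists_prob_identW_le hP hcard hF
  obtain ⟨ε₂, hε₂, hε₂'⟩ := ident_hybrid hF Handler.isHandler_answer pt_setupReceiver hD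
    (p + pre.comp (q + 2) + (q * (q + 2) + 1))
  refine ⟨fun s => (ε₁ s + (q.eval s : ℕ) * (1 / Fintype.card (𝔽 s))) +
    (ε₂ s + ((q ^ 2).eval s : ℕ) * (1 / Fintype.card (𝔽 s))),
    (hε₁.add (hcard.eval_mul _)).add (hε₂.add (hcard.eval_mul _)), fun s i a ha => ?_⟩
  have hm : ((P s).m : ℝ) ≤ (q.eval s : ℕ) := by exact_mod_cast (hq s).m
  have hn : ((P s).n : ℝ) ≤ (q.eval s : ℕ) := by exact_mod_cast (hq s).n
  set Z := idealFPSI i.Q i.W with hZ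
  -- A transferred message is a point with an option tag and thus slightly longer than a point; the
  -- larger parameter makes room for it in `preBound`.
  have hq₂ : Bounded (P s) (Fintype.card (𝔽 s)) (Fintype.card (K s)) s (q.eval s + 2) := by
    obtain ⟨h1, h2, h3, h4, h5, h6, h7, h8⟩ := hq s
    constructor <;> omega
  have hZc : Z.card ≤ q.eval s + 2 := (card_idealFPSI_le i.Q i.W).trans hq₂.m
  let g : ReceiverView (P s) (𝔽 s) (K s) → ℝ := fun v =>
    (accept s D a (obsReceiver (eF s) (eK s) v Z)).toReal
  have hreal : (distProb s D a ((fuzzyPSI (P s) (F s) i.Q i.W).map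
      (observeReceiver (eF s) (eK s)))).toReal = 𝔼 c : Coins (P s) (𝔽 s) (K s),
      (accept s D a (obsReceiver (eF s) (eK s) (c.receiverView (F s) i.Q i.W)
        (c.exec (F s) i.Q i.W).output)).toReal := by
    rw [fuzzyPSI_eq_map, PMF.map_comp, distProb_unif_map_toReal]
    rfl
  have hsim : (simProb s D a S (simulatorInput s (P s) (Fintype.card (𝔽 s)) (Fintype.card (K s))
      (Data.ofFamily encodePoint i.W) (encodeSet Z)) (encodeSet Z)).toReal =
      𝔼 v : Sample (P s) (P s).n (P s).m (𝔽 s) (K s), g (v.receiverView i.W Z) := by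
    refine .trans ?_ (integral_readSample (eF s) (eK s)
      (fun v => accept s D a (obsReceiver (eF s) (eK s) (v.receiverView i.W Z) Z))
      fun _ => accept_le_one _ _ _ _)
    exact congrArg ENNReal.toReal (lintegral_congr fun ω => congrArg (accept s D a) (hS' s i.W Z ω))
  have h1 : |𝔼 c : Coins (P s) (𝔽 s) (K s),
      (accept s D a (obsReceiver (eF s) (eK s) (c.receiverView (F s) i.Q i.W)
        (c.exec (F s) i.Q i.W).output)).toReal -
      𝔼 c : Coins (P s) (𝔽 s) (K s), g (c.correctReceiver (F s) i.Q i.W)| ≤ _ :=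
    abs_expect_sub_le_prob _ _ (fun c => c.Bad (F s) i.Q i.W)
      (fun _ => accept_toReal_mem _ _ _ _) (fun _ => accept_toReal_mem _ _ _ _)
      fun c hc => by rw [Coins.output_eq hc, Coins.receiverView_eq _ _ _ hc]
  have h2 := hε₂' s a (Coins (P s) (𝔽 s) (K s)) (P s).n
    (fun c => c.receiverData (eF s) (eK s) i.Q i.W Z s) (fun c => c.inputW i.Q i.W)
    (by simp only [Polynomial.eval_add]; omega)
    (fun c => by
      refine (hq₂.preData (e := eF s) (eK := eK s) hq₂.n hq₂.m le_rfl (hq₂.points hq₂.n _)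
        (hq₂.encodeSet hZc) ?_ ?_ (hq₂.encodeSet hZc)).trans ?_
      · refine Data.size_ofFamily_le' hq₂.m _ _ fun j => ?_
        have h1 : ∀ (p : Prop) [Decidable p], (Data.ofProp p).size ≤ 2 := fun p => by
          unfold Data.ofProp; split_ifs <;> simp [Data.size]
        refine (h1 _).trans ?_
        nlinarith
      · refine (Data.size_ofFamily_le' (hq s).m _ _ (b := (q.eval s + 2) * q.eval s + 4) fun j => ?_).trans ?_
        · split_ifs
          · have := (hq s).encodePoint (c.q i.Q j)
            simp only [Option.elim, Data.size, Nat.size_one]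
            nlinarith
          · simp [Data.size]
        · nlinarith
      · simp only [Polynomial.eval_add, Polynomial.eval_comp, hpre, Polynomial.eval_ofNat]; omega)
    (fun c => by
      refine ((hq s).ofFamily (hq s).n _).trans ?_
      simp only [Polynomial.eval_add, Polynomial.eval_mul, Polynomial.eval_one,
        Polynomial.eval_ofNat]
      omega)
  simp only [preparedProb_receiver] at h2
  rw [← expect_correctReceiver (F s) i.Q i.W g,
    expect_maskedReceiver i.Q i.W i.disjQ.injective g] at h2
  rw [hreal, hsim]
  refine (abs_sub_le _ _ _).trans (add_le_add (h1.trans ?_) (h2.trans ?_))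
  · refine (prob_bad_le_add (F s) i.Q i.W i.disjQ).trans (add_le_add (hε₁' s i) ?_)
    gcongr
  · refine add_le_add le_rfl ((prob_inputW_le i.Q i.disjW).trans ?_)
    rw [Polynomial.eval_pow]
    push_cast
    gcongr

end Simulation

end FuzzyPSI

theorem mainTheorem3
    (P : ℕ → Params) (𝔽 K : ℕ → Type)
    [∀ s, Field (𝔽 s)] [∀ s, Fintype (𝔽 s)] [∀ s, AddCommGroup (K s)] [∀ s, Fintype (K s)]
    (eF : ∀ s, 𝔽 s ≃ Fin (Fintype.card (𝔽 s))) (eK : ∀ s, K s ≃ Fin (Fintype.card (K s)))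
    (F : (s : ℕ) → K s → 𝔽 s → 𝔽 s)
    (hP : PolyBounded P 𝔽 K)
    (hcard : Negligible fun s => 1 / (Fintype.card (𝔽 s) : ℝ))
    (hfield : EfficientField 𝔽 eF)
    (hF : IsPRF 𝔽 eF K F) :
    RealizesFPSI P 𝔽 K eF eK F ∧
    (∀ (s : ℕ) (i : Inputs (P s)), ∀ e ∈ (fuzzyPSI (P s) (F s) i.Q i.W).support,
      idealFPSI i.Q i.W ⊆ e.output) ∧
    (∀ (s : ℕ) (i : Inputs (P s)),
      (fuzzyPSI (P s) (F s) i.Q i.W).toOuterMeasure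
          {e | Function.Injective e.receiver.fmap.ident ∧ e.output ≠ idealFPSI i.Q i.W}
        ≤ ((P s).m : ENNReal) / (Fintype.card (𝔽 s) : ENNReal)) ∧
    (∃ ε : ℕ → ℝ, Negligible ε ∧ ∀ (s : ℕ) (i : Inputs (P s)),
      ((fuzzyPSI (P s) (F s) i.Q i.W).toOuterMeasure
        {e | ¬ Function.Injective e.receiver.fmap.ident}).toReal ≤ ε s) := by
  obtain ⟨simS, hS, hS'⟩ := exists_simulates_sender eK hP hcard hfield hF
  obtain ⟨simR, hR, hR'⟩ := exists_simulates_receiver eK hP hcard hfield hF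
  refine ⟨⟨simS, simR, hS, hR, hS', hR'⟩, fun s i e he => subset_of_mem_support _ _ _ he,
    fun s i => toOuterMeasure_wrong_output_le _ i.disjQ _, ?_⟩
  obtain ⟨ε, hε, hε'⟩ := exists_prob_identW_le hP hcard hF
  refine ⟨ε, hε, fun s i => ?_⟩
  rw [fuzzyPSI_eq_map, toOuterMeasure_unif_map, ENNReal.toReal_ofReal]
  · exact hε' s i
  · exact prob_nonneg _
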